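/- Setting. Let $s\ge 1$, $I=\{1,\dots,s+1\}$, and let $f_i:\mathbb R\to\mathbb R$ $(i\in I)$ be $C^{1}$ diffeomorphisms whose derivatives are $\epsilon$-Hölder continuous for some $\epsilon>0$. Let $\overline{\mathbb R}=\mathbb R\cup\{\pm\infty\}$ be the two-point compactification, with a metric $d$ that induces its topology and is strongly equivalent to the Euclidean metric on every compact subset of $\mathbb R$ (for each compact $K\subset\mathbb R$ there is $C>0$ with $C^{-1}|x-y|\le d(x,y)\le C|x-y|$ for $x,y\in K$). Put $f_i(\pm\infty)=\pm\infty$. Assume that - $(f_i)$ is expanding: there is $\lambda>1$ with $f_i'(x)\ge\lambda$ for all $x\in\mathbb R$, $i\in I$; - $(f_i)$ has no common fixed point in $\mathbb R$; - $(f_i)$ is contracting near infinity: there are neighbourhoods $V^{+}$ of $+\infty$ and $V^{-}$ of $-\infty$ in $\overline{\mathbb R}$ such that each restriction $f_i|_{V^{+}}$ and $f_i|_{V^{-}}$ has Lipschitz constant $<1$ with respect to $d$. Let $\Delta=\{\vec p\in(0,1)^s:\sum_{i=1}^s p_i<1\}$ and, for $\vec p\in\Delta$, $p_{s+1}=1-\sum_{i=1}^s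 p_i$. Let $\Sigma=I^{\mathbb N}$, let $\mu_{\vec p}$ be the $(p_1,\dots,p_{s+1})$-Bernoulli measure on $\Sigma$, and $$M_{\vec p}h=\sum_{i\in I}p_i\,(h\circ f_i),\qquad T_{\vec p}(x)=\mu_{\vec p}\{\omega\in\Sigma:\lim_{n\to\infty}f_{\omega_n}\circ\dots\circ f_{\omega_1}(x)=+\infty\}\quad(x\in\overline{\mathbb R}).$$ For $\alpha>0$ let $\mathcal C^\alpha(\overline{\mathbb R})$ be the space of $\alpha$-Hölder continuous functions on $(\overline{\mathbb R},d)$ with the norm $\|h\|_\alpha=\sup_{x\ne y}|h(x)-h(y)|/d(x,y)^\alpha+\|h\|_\infty$; functions are real-valued, except that spectra are taken on complex-valued functions. A bounded operator has the spectral gap property if its spectrum consists of finitely many eigenvalues of modulus one and of a remaining part contained in a disc about $0$ of radius strictly less than one. Let $B(\vec a,\delta)$ be the open Euclidean ball in $\mathbb R^s$. For $\vec p_0\in\Delta$, $\delta>0$, $\alpha>0$, consider the assertion $(\ast)_{\vec p_0,\delta,\alpha}$: $B(\vec p_0,\delta)\subset\Delta$, and for every $\vec p\in B(\vec p_0,\delta)$: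 $M_{\vec p}$ acts as a bounded operator on $\mathcal C^\alpha(\overline{\mathbb R})$ and has the spectral gap property there; $T_{\vec p}\in\mathcal C^\alpha(\overline{\mathbb R})$; and there are $C>0$ and $0\le r<1$ (depending on $\vec p$) such that $$\|M_{\vec p}^nh-(h(\infty)-h(-\infty))\,T_{\vec p}-h(-\infty)\,1\|_\alpha\le C\,r^n\,\|h\|_\alpha\qquad\text{for all }h\in\mathcal C^\alpha(\overline{\mathbb R}),\ n\ge0.$$ Moreover, the map $\vec p\mapsto T_{\vec p}\in\mathcal C^\alpha(\overline{\mathbb R})$ is real-analytic on $B(\vec p_0,\delta)$. For $\omega\in\Sigma$ let $\pi(\omega)$ be the unique $x\in\mathbb R$ for which the sequence $(f_{\omega_n}\circ\dots\circ f_{\omega_1}(x))_n$ is bounded. With the shift $\sigma$ on $\Sigma$, put $\varphi(\omega)=-\log|f_{\omega_1}'(\pi(\omega))|$, $\psi_{\vec p}(\omega)=\log p_{\omega_1}$, $S_nu=\sum_{k=0}^{n-1}u\circ\sigma^k$, and $$\alpha_-(\vec p)=\inf_{\omega\in\Sigma}\liminf_{n\to\infty}\frac{S_n\psi_{\vec p}(\omega)}{S_n\varphi(\omega)}.$$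 The family satisfies the separating condition if there is a non-empty bounded open interval $O\subset\mathbb R$ with $f_i^{-1}(O)\subset O$ for all $i$ and $f_i^{-1}(\overline O)\cap f_j^{-1}(\overline O)=\emptyset$ for all $i\ne j$. Theorem. (1) For every $\vec p_0\in\Delta$ there exist $\delta>0$ and $\alpha>0$ such that $(\ast)_{\vec p_0,\delta,\alpha}$ holds. (2) If $(f_i)$ satisfies the separating condition, then for every $\vec p_0\in\Delta$ and every $\alpha$ with $0<\alpha<\alpha_-(\vec p_0)$ there exists $\delta>0$ such that $(\ast)_{\vec p_0,\delta,\alpha}$ holds. -/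

import Mathlib

open Set Filter Topology MeasureTheory

noncomputable section

namespace RandomLine

/-! ## The two-point compactification and its metrics -/

/-- A metric on the two-point compactification of the real line (Mathlib's `EReal`) which induces
the topology of the compactification and which is strongly equivalent to the Euclidean metric on
compact subsets of the real line. -/
structure LineMetric where
  d : EReal → EReal → ℝ
  d_self : ∀ x, d x x = 0
  eq_of_d_eq_zero : ∀ x y, d x y = 0 → x = y
  d_comm : ∀ x y, d x y = d y x
  d_triangle : ∀ x y z, d x z ≤ d x y + d y z
  nhds_basis : ∀ x, (𝓝 x).HasBasis (fun r : ℝ => 0 < r) (fun r => {y | d x y < r})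
  strongly_equiv : ∀ K : Set ℝ, IsCompact K → ∃ C : ℝ, 0 < C ∧ ∀ x ∈ K, ∀ y ∈ K,
    C⁻¹ * |x - y| ≤ d (x : EReal) (y : EReal) ∧ d (x : EReal) (y : EReal) ≤ C * |x - y|

theorem LineMetric.d_nonneg (m : LineMetric) (x y : EReal) : 0 ≤ m.d x y := by
  have h := m.d_triangle x y x
  rw [m.d_self, m.d_comm y x] at h
  linarith

/-- The extension of a self-map of the real line fixing `-∞` and `+∞`. -/
def extend (g : ℝ → ℝ) : EReal → EReal
  | ⊥ => ⊥
  | ⊤ => ⊤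
  | (x : ℝ) => (g x : EReal)

/-- The composition `f_{ω_n} ∘ ⋯ ∘ f_{ω_1}` (with the letters of `ω` indexed from `0`). -/
def orbit {ι X : Type*} (f : ι → X → X) (ω : ℕ → ι) : ℕ → X → X
  | 0 => id
  | n + 1 => f (ω n) ∘ orbit f ω n

/-! ## Hypotheses on the family of maps -/

/-- A `C^{1+ε}` diffeomorphism of the real line with `ε`-Hölder continuous derivative. -/
structure IsHolderDiffeo (ε : ℝ) (g : ℝ → ℝ) : Prop where
  contDiff : ContDiff ℝ 1 g
  inverse : ∃ k : ℝ → ℝ, Function.LeftInverse k g ∧ Function.RightInverse k g ∧ ContDiff ℝ 1 k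
  holder_deriv : ∃ C : ℝ, ∀ x y, |deriv g x - deriv g y| ≤ C * |x - y| ^ ε

def IsExpanding {ι : Type*} (f : ι → ℝ → ℝ) : Prop :=
  ∃ lam : ℝ, 1 < lam ∧ ∀ i x, lam ≤ deriv (f i) x

def HasNoCommonFixedPoint {ι : Type*} (f : ι → ℝ → ℝ) : Prop :=
  ¬ ∃ x : ℝ, ∀ i, f i x = x

/-- There are neighbourhoods of `+∞` and of `-∞` on each of which every extended map has
Lipschitz constant less than one. -/
def IsContractingNearInfinity {ι : Type*} (m : LineMetric) (f : ι → ℝ → ℝ) : Prop :=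
  ∃ Vp ∈ 𝓝 (⊤ : EReal), ∃ Vm ∈ 𝓝 (⊥ : EReal), ∀ i, ∃ L : ℝ, L < 1 ∧
    (∀ x ∈ Vp, ∀ y ∈ Vp, m.d (extend (f i) x) (extend (f i) y) ≤ L * m.d x y) ∧
    (∀ x ∈ Vm, ∀ y ∈ Vm, m.d (extend (f i) x) (extend (f i) y) ≤ L * m.d x y)

def SeparatingCondition {ι : Type*} (f : ι → ℝ → ℝ) : Prop :=
  ∃ a b : ℝ, a < b ∧ (∀ i, f i ⁻¹' Ioo a b ⊆ Ioo a b) ∧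
    ∀ i j, i ≠ j → Disjoint (f i ⁻¹' closure (Ioo a b)) (f j ⁻¹' closure (Ioo a b))

/-! ## Probability vectors, the transition operator, the probability of tending to infinity -/

/-- The admissible parameters: `p ∈ (0,1)^s` with `p_1 + ⋯ + p_s < 1`. -/
def params (s : ℕ) : Set (EuclideanSpace ℝ (Fin s)) :=
  {p | (∀ i, p i ∈ Ioo (0 : ℝ) 1) ∧ ∑ i, p i < 1}

/-- The weights `p_1, …, p_s, p_{s+1}`, where `p_{s+1} = 1 - (p_1 + ⋯ + p_s)`. -/
def weight {s : ℕ} (p : EuclideanSpace ℝ (Fin s)) : Fin (s + 1) → ℝ :=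
  Fin.lastCases (1 - ∑ i, p i) (fun i => p i)

theorem weight_pos {s : ℕ} {p : EuclideanSpace ℝ (Fin s)} (hp : p ∈ params s) (i : Fin (s + 1)) :
    0 < weight p i := by
  induction i using Fin.lastCases with
  | last => simpa [weight] using hp.2
  | cast i => simpa [weight] using (hp.1 i).1

theorem sum_weight {s : ℕ} (p : EuclideanSpace ℝ (Fin s)) : ∑ i, weight p i = 1 := by
  simp [Fin.sum_univ_castSucc, weight]

/-- The probability distribution `(p_1, …, p_{s+1})` on the index set. -/
def letterLaw {s : ℕ} (p : EuclideanSpace ℝ (Fin s)) (hp : p ∈ params s) : PMF (Fin (s + 1)) :=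
  PMF.ofFintype (fun i => ENNReal.ofReal (weight p i)) (by
    rw [← ENNReal.ofReal_sum_of_nonneg (fun i _ => (weight_pos hp i).le), sum_weight,
      ENNReal.ofReal_one])

/-- The Bernoulli measure on the space of infinite words. -/
def bernoulli {s : ℕ} (p : EuclideanSpace ℝ (Fin s)) (hp : p ∈ params s) :
    Measure (ℕ → Fin (s + 1)) :=
  Measure.infinitePi (fun _ : ℕ => (letterLaw p hp).toMeasure)

/-- The probability `T_p(x)` of tending to `+∞`. -/
def probInfty {s : ℕ} (f : Fin (s + 1) → ℝ → ℝ) (p : EuclideanSpace ℝ (Fin s))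
    (hp : p ∈ params s) (x : EReal) : ℝ :=
  (bernoulli p hp).real
    {ω | Tendsto (fun n => orbit (fun i => extend (f i)) ω n x) atTop (𝓝 ⊤)}

/-- The transition operator `h ↦ ∑ p_i · (h ∘ f_i)`. -/
def transition {s : ℕ} {𝕜 : Type*} [RCLike 𝕜] (f : Fin (s + 1) → ℝ → ℝ)
    (p : EuclideanSpace ℝ (Fin s)) (h : EReal → 𝕜) (x : EReal) : 𝕜 :=
  ∑ i, (weight p i : 𝕜) * h (extend (f i) x)

/-! ## Hölder spaces -/

/-- The subspace of `α`-Hölder continuous functions of the space of continuous functions on the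
two-point compactification. -/
def holderSubmodule (m : LineMetric) (α : ℝ) (𝕜 : Type*) [RCLike 𝕜] :
    Submodule 𝕜 C(EReal, 𝕜) where
  carrier := {h | ∃ C : ℝ, ∀ x y, ‖h x - h y‖ ≤ C * m.d x y ^ α}
  zero_mem' := ⟨0, fun x y => by simp⟩
  add_mem' := by
    rintro g h ⟨C, hC⟩ ⟨D, hD⟩
    refine ⟨C + D, fun x y => ?_⟩
    have e : (g + h) x - (g + h) y = (g x - g y) + (h x - h y) := by
      simp only [ContinuousMap.add_apply]; ring
    rw [e, add_mul]
    exact (norm_add_le _ _).trans (add_le_add (hC x y) (hD x y))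
  smul_mem' := by
    rintro c h ⟨C, hC⟩
    refine ⟨‖c‖ * C, fun x y => ?_⟩
    have e : (c • h) x - (c • h) y = c * (h x - h y) := by
      simp only [ContinuousMap.smul_apply, smul_eq_mul]; ring
    rw [e, norm_mul, mul_assoc]
    exact mul_le_mul_of_nonneg_left (hC x y) (norm_nonneg c)

/-- The space `C^α` of `α`-Hölder continuous functions on the two-point compactification. -/
def HolderSpace (m : LineMetric) (α : ℝ) (𝕜 : Type*) [RCLike 𝕜] : Type _ :=
  holderSubmodule m α 𝕜

namespace HolderSpace

variable {m : LineMetric} {α : ℝ} {𝕜 : Type*} [RCLike 𝕜]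

instance : AddCommGroup (HolderSpace m α 𝕜) :=
  inferInstanceAs (AddCommGroup (holderSubmodule m α 𝕜))

instance : Module 𝕜 (HolderSpace m α 𝕜) :=
  inferInstanceAs (Module 𝕜 (holderSubmodule m α 𝕜))

/-- The underlying continuous function. -/
def toCont (h : HolderSpace m α 𝕜) : C(EReal, 𝕜) := h.1

instance : CoeFun (HolderSpace m α 𝕜) (fun _ => EReal → 𝕜) := ⟨fun h => toCont h⟩

/-- The Hölder constant `V_α(h) = sup_{x ≠ y} |h x - h y| / d(x, y)^α`; the terms with `x = y`
are zero. -/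
def variation (h : HolderSpace m α 𝕜) : ℝ :=
  ⨆ q : EReal × EReal, ‖h q.1 - h q.2‖ / m.d q.1 q.2 ^ α

theorem bddAbove_variation (h : HolderSpace m α 𝕜) :
    BddAbove (range fun q : EReal × EReal => ‖h q.1 - h q.2‖ / m.d q.1 q.2 ^ α) := by
  obtain ⟨C, hC⟩ := h.2
  refine ⟨max C 0, ?_⟩
  rintro _ ⟨⟨x, y⟩, rfl⟩
  have hd : 0 ≤ m.d x y ^ α := Real.rpow_nonneg (m.d_nonneg x y) α
  exact div_le_of_le_mul₀ hd (le_max_right _ _)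
    ((hC x y).trans (mul_le_mul_of_nonneg_right (le_max_left _ _) hd))

theorem variation_nonneg (h : HolderSpace m α 𝕜) : 0 ≤ variation h :=
  Real.iSup_nonneg fun q =>
    div_nonneg (norm_nonneg _) (Real.rpow_nonneg (m.d_nonneg q.1 q.2) α)

theorem variation_add_le (g h : HolderSpace m α 𝕜) :
    variation (g + h) ≤ variation g + variation h := by
  refine ciSup_le fun q => ?_
  have e : (g + h) q.1 - (g + h) q.2 = (g q.1 - g q.2) + (h q.1 - h q.2) := by
    change (g q.1 + h q.1) - (g q.2 + h q.2) = _
    ring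
  have hd : 0 ≤ m.d q.1 q.2 ^ α := Real.rpow_nonneg (m.d_nonneg q.1 q.2) α
  calc ‖(g + h) q.1 - (g + h) q.2‖ / m.d q.1 q.2 ^ α
      ≤ ‖g q.1 - g q.2‖ / m.d q.1 q.2 ^ α + ‖h q.1 - h q.2‖ / m.d q.1 q.2 ^ α := by
        rw [e, ← add_div]
        exact div_le_div_of_nonneg_right (norm_add_le _ _) hd
    _ ≤ _ := add_le_add (le_ciSup (bddAbove_variation g) q) (le_ciSup (bddAbove_variation h) q)

theorem variation_smul (c : 𝕜) (h : HolderSpace m α 𝕜) :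
    variation (c • h) = ‖c‖ * variation h := by
  unfold variation
  rw [Real.mul_iSup_of_nonneg (norm_nonneg c)]
  congr 1
  funext q
  have e : (c • h) q.1 - (c • h) q.2 = c * (h q.1 - h q.2) := by
    change c * h q.1 - c * h q.2 = _
    ring
  rw [e, norm_mul, mul_div_assoc]

/-- The Hölder norm `‖h‖_α = V_α(h) + ‖h‖_∞`. -/
instance : Norm (HolderSpace m α 𝕜) := ⟨fun h => variation h + ‖toCont h‖⟩

theorem norm_eq (h : HolderSpace m α 𝕜) : ‖h‖ = variation h + ‖toCont h‖ := rfl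

theorem normCore : NormedSpace.Core 𝕜 (HolderSpace m α 𝕜) where
  norm_nonneg h := add_nonneg (variation_nonneg h) (norm_nonneg _)
  norm_smul c h := by
    rw [norm_eq, norm_eq, variation_smul, mul_add]
    congr 1
    exact norm_smul c (toCont h)
  norm_triangle g h := by
    have h1 := variation_add_le g h
    have h2 : ‖toCont (g + h)‖ ≤ ‖toCont g‖ + ‖toCont h‖ := norm_add_le (toCont g) (toCont h)
    rw [norm_eq, norm_eq, norm_eq]
    linarith
  norm_eq_zero_iff h := by
    constructor
    · intro h0
      rw [norm_eq] at h0
      have h1 := variation_nonneg h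
      have h2 := norm_nonneg (toCont h)
      exact Subtype.ext (norm_eq_zero.1 (by linarith : ‖toCont h‖ = 0))
    · rintro rfl
      have h1 := variation_smul (0 : 𝕜) (0 : HolderSpace m α 𝕜)
      rw [zero_smul, norm_zero, zero_mul] at h1
      have h2 : ‖toCont (0 : HolderSpace m α 𝕜)‖ = 0 := norm_zero (E := C(EReal, 𝕜))
      rw [norm_eq, h1, h2, add_zero]

instance : NormedAddCommGroup (HolderSpace m α 𝕜) := NormedAddCommGroup.ofCore normCore

instance : NormedSpace 𝕜 (HolderSpace m α 𝕜) := NormedSpace.ofCore normCore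

/-- The constant function `1`. -/
instance : One (HolderSpace m α 𝕜) := ⟨⟨1, 0, fun x y => by simp⟩⟩

end HolderSpace

/-! ## The spectral gap property -/

/-- The spectrum consists of finitely many eigenvalues of modulus one and of a remaining part
which lies in a disc of radius strictly less than one. -/
def HasSpectralGap {E : Type*} [NormedAddCommGroup E] [NormedSpace ℂ E] (A : E →L[ℂ] E) : Prop :=
  ∃ S : Set ℂ, S.Finite ∧ (∀ z ∈ S, ‖z‖ = 1 ∧ Module.End.HasEigenvalue (A : E →ₗ[ℂ] E) z) ∧
    ∃ r : ℝ, r < 1 ∧ spectrum ℂ A ⊆ S ∪ Metric.ball 0 r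

/-- The bounded operator `A` on the Hölder space is the transition operator. -/
def IsTransition {s : ℕ} {m : LineMetric} {α : ℝ} {𝕜 : Type*} [RCLike 𝕜]
    (f : Fin (s + 1) → ℝ → ℝ) (p : EuclideanSpace ℝ (Fin s))
    (A : HolderSpace m α 𝕜 →L[𝕜] HolderSpace m α 𝕜) : Prop :=
  ∀ (h : HolderSpace m α 𝕜) (x : EReal), (A h) x = transition f p h x

/-- All parameters in the ball `B(p₀, δ)` are admissible and, for these parameters,
the transition operator acts boundedly on `C^α` and has the spectral gap property (the spectrum
being that of the operator on complex-valued functions), `T_p` belongs to `C^α`, the iterates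
converge exponentially fast in `C^α`, and `p ↦ T_p` is real-analytic as a `C^α`-valued map. -/
def SpectralGapOnBall {s : ℕ} (m : LineMetric) (f : Fin (s + 1) → ℝ → ℝ)
    (p₀ : EuclideanSpace ℝ (Fin s)) (δ α : ℝ) : Prop :=
  Metric.ball p₀ δ ⊆ params s ∧
  (∀ p ∈ Metric.ball p₀ δ, ∃ A : HolderSpace m α ℂ →L[ℂ] HolderSpace m α ℂ,
    IsTransition f p A ∧ HasSpectralGap A) ∧
  ∃ T : EuclideanSpace ℝ (Fin s) → HolderSpace m α ℝ,
    (∀ p ∈ Metric.ball p₀ δ, ∀ (hp : p ∈ params s) (x : EReal), T p x = probInfty f p hp x) ∧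
    (∀ p ∈ Metric.ball p₀ δ, ∃ A : HolderSpace m α ℝ →L[ℝ] HolderSpace m α ℝ,
      IsTransition f p A ∧ ∃ C r : ℝ, 0 ≤ r ∧ r < 1 ∧ ∀ (h : HolderSpace m α ℝ) (n : ℕ),
        ‖(A ^ n) h - (h ⊤ - h ⊥) • T p - h ⊥ • (1 : HolderSpace m α ℝ)‖ ≤ C * r ^ n * ‖h‖) ∧
    AnalyticOnNhd ℝ T (Metric.ball p₀ δ)

/-! ## The bottom of the spectrum -/

/-- The coding map: `codingMap f ω` is the unique real number whose orbit under
`f_{ω_1}, f_{ω_2}, …` stays bounded, i.e. stays outside a neighbourhood of `{-∞, +∞}`; see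
`existsUnique_bounded_orbit` and `iInter_preimage_compl_eq`. -/
def codingMap {ι : Type*} (f : ι → ℝ → ℝ) (ω : ℕ → ι) : ℝ :=
  Classical.epsilon fun x : ℝ => Bornology.IsBounded (range fun n => orbit f ω n x)

theorem orbit_add {ι X : Type*} (f : ι → X → X) (ω : ℕ → ι) (n k : ℕ) (x : X) :
    orbit f ω (n + k) x = orbit f (fun j => ω (n + j)) k (orbit f ω n x) := by
  induction k with
  | zero => rfl
  | succ k ih =>
    change f (ω (n + k)) (orbit f ω (n + k) x) = f (ω (n + k)) (orbit f _ k (orbit f ω n x))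
    rw [ih]

theorem orbit_extend_coe {ι : Type*} (f : ι → ℝ → ℝ) (ω : ℕ → ι) (n : ℕ) (x : ℝ) :
    orbit (fun i => extend (f i)) ω n (x : EReal) = ((orbit f ω n x : ℝ) : EReal) := by
  induction n with
  | zero => rfl
  | succ n ih =>
    change extend (f (ω n)) (orbit (fun i => extend (f i)) ω n (x : EReal)) = _
    rw [ih]
    rfl

theorem orbit_extend_top {ι : Type*} (f : ι → ℝ → ℝ) (ω : ℕ → ι) (n : ℕ) :
    orbit (fun i => extend (f i)) ω n ⊤ = ⊤ := by
  induction n with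
  | zero => rfl
  | succ n ih =>
    change extend (f (ω n)) (orbit (fun i => extend (f i)) ω n ⊤) = _
    rw [ih]
    rfl

theorem orbit_extend_bot {ι : Type*} (f : ι → ℝ → ℝ) (ω : ℕ → ι) (n : ℕ) :
    orbit (fun i => extend (f i)) ω n ⊥ = ⊥ := by
  induction n with
  | zero => rfl
  | succ n ih =>
    change extend (f (ω n)) (orbit (fun i => extend (f i)) ω n ⊥) = _
    rw [ih]
    rfl

theorem expanding_dist {lam : ℝ} {g : ℝ → ℝ} (hg : Differentiable ℝ g)
    (hl : ∀ x, lam ≤ deriv g x) (x y : ℝ) : lam * |x - y| ≤ |g x - g y| := by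
  wlog h : y ≤ x generalizing x y
  · rw [abs_sub_comm x y, abs_sub_comm (g x) (g y)]
    exact this y x (le_of_not_ge h)
  have h1 := mul_sub_le_image_sub_of_le_deriv hg hl h
  rw [abs_of_nonneg (sub_nonneg.2 h)]
  exact h1.trans (le_abs_self _)

/-- For an expanding family of surjective maps every infinite word has exactly one real point with
bounded orbit. -/
theorem existsUnique_bounded_orbit {ι : Type*} [Finite ι] {f : ι → ℝ → ℝ} (hexp : IsExpanding f)
    (hd : ∀ i, Differentiable ℝ (f i)) (hs : ∀ i, Function.Surjective (f i)) (ω : ℕ → ι) :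
    ∃! x : ℝ, Bornology.IsBounded (range fun n => orbit f ω n x) := by
  obtain ⟨lam, h1, hl⟩ := hexp
  have key : ∀ i x y, lam * |x - y| ≤ |f i x - f i y| := fun i => expanding_dist (hd i) (hl i)
  obtain ⟨M, hM⟩ := (Set.finite_range fun i => |f i 0|).bddAbove
  have hM' : ∀ i, |f i 0| ≤ M := fun i => hM ⟨i, rfl⟩
  have hM0 : 0 ≤ M := (abs_nonneg _).trans (hM' (ω 0))
  have hpos : 0 < lam - 1 := by linarith
  set R : ℝ := M / (lam - 1) with hR
  have hR0 : 0 ≤ R := div_nonneg hM0 hpos.le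
  have hRM : lam * R = R + M := by
    have : R * (lam - 1) = M := div_mul_cancel₀ M hpos.ne'
    linarith
  have inv : ∀ i x, |f i x| ≤ R → |x| ≤ R := by
    intro i x hx
    have h2 := key i x 0
    rw [sub_zero] at h2
    have h3 : |f i x - f i 0| ≤ |f i x| + |f i 0| := abs_sub _ _
    have h4 : lam * |x| ≤ lam * R := by linarith [hM' i]
    exact le_of_mul_le_mul_left h4 (by linarith)
  have back : ∀ n y, |y| ≤ R → ∃ x, orbit f ω n x = y ∧ ∀ k ≤ n, |orbit f ω k x| ≤ R := by
    intro n
    induction n with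
    | zero =>
      intro y hy
      refine ⟨y, rfl, fun k hk => ?_⟩
      obtain rfl : k = 0 := by omega
      exact hy
    | succ n ih =>
      intro y hy
      obtain ⟨z, rfl⟩ := hs (ω n) y
      obtain ⟨x, hx, hk⟩ := ih z (inv _ _ hy)
      have hx' : orbit f ω (n + 1) x = f (ω n) z := by
        change f (ω n) (orbit f ω n x) = _
        rw [hx]
      refine ⟨x, hx', fun k hkn => ?_⟩
      rcases Nat.lt_or_ge n k with h | h
      · obtain rfl : k = n + 1 := by omega
        rw [hx']
        exact hy
      · exact hk k h
  have hcont : ∀ n, Continuous (orbit f ω n) := by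
    intro n
    induction n with
    | zero => exact continuous_id
    | succ n ih => exact (hd _).continuous.comp ih
  let K : ℕ → Set ℝ := fun n => {x | ∀ k ≤ n, |orbit f ω k x| ≤ R}
  have hKclosed : ∀ n, IsClosed (K n) := fun n => by
    have : K n = ⋂ k, ⋂ (_ : k ≤ n), {x | |orbit f ω k x| ≤ R} := by
      ext x
      simp [K]
    rw [this]
    exact isClosed_iInter fun k => isClosed_iInter fun _ =>
      isClosed_le (hcont k).abs continuous_const
  have hK0 : IsCompact (K 0) := by
    refine (isCompact_Icc (a := -R) (b := R)).of_isClosed_subset (hKclosed 0) fun x hx => ?_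
    exact abs_le.1 (hx 0 le_rfl)
  obtain ⟨x, hx⟩ := IsCompact.nonempty_iInter_of_sequence_nonempty_isCompact_isClosed K
    (fun n x hx k hk => hx k (by omega))
    (fun n => by
      obtain ⟨x, -, hx⟩ := back n 0 (by simpa using hR0)
      exact ⟨x, hx⟩) hK0 hKclosed
  refine ⟨x, ?_, ?_⟩
  · refine isBounded_iff_forall_norm_le.2 ⟨R, ?_⟩
    rintro _ ⟨n, rfl⟩
    exact mem_iInter.1 hx n n le_rfl
  · intro y hy
    obtain ⟨B, hB⟩ := isBounded_iff_forall_norm_le.1 hy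
    have grow : ∀ n, lam ^ n * |y - x| ≤ |orbit f ω n y - orbit f ω n x| := by
      intro n
      induction n with
      | zero => simp [orbit]
      | succ n ih =>
        refine le_trans ?_ (key (ω n) (orbit f ω n y) (orbit f ω n x))
        rw [pow_succ', mul_assoc]
        exact mul_le_mul_of_nonneg_left ih (by linarith)
    by_contra hne
    have hyx : 0 < |y - x| := abs_pos.2 (sub_ne_zero.2 hne)
    obtain ⟨n, hn⟩ := pow_unbounded_of_one_lt ((B + R) / |y - x|) h1
    have h5 := grow n
    have h6 : |orbit f ω n y| ≤ B := hB _ ⟨n, rfl⟩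
    have h7 : |orbit f ω n x| ≤ R := mem_iInter.1 hx n n le_rfl
    have h8 : |orbit f ω n y - orbit f ω n x| ≤ |orbit f ω n y| + |orbit f ω n x| := abs_sub _ _
    rw [div_lt_iff₀ hyx] at hn
    linarith

theorem codingMap_spec {ι : Type*} [Finite ι] {f : ι → ℝ → ℝ} (hexp : IsExpanding f)
    (hd : ∀ i, Differentiable ℝ (f i)) (hs : ∀ i, Function.Surjective (f i)) (ω : ℕ → ι) :
    Bornology.IsBounded (range fun n => orbit f ω n (codingMap f ω)) :=
  Classical.epsilon_spec (p := fun x : ℝ => Bornology.IsBounded (range fun n => orbit f ω n x))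
    (existsUnique_bounded_orbit hexp hd hs ω).exists

/-- If `Vp` and `Vm` are neighbourhoods of `+∞` and `-∞` all of whose points tend to `+∞` and
`-∞`, respectively, along every infinite word, then `codingMap f ω` is the only point whose
forward orbit along `ω` avoids `V = Vp ∪ Vm`. -/
theorem iInter_preimage_compl_eq {ι : Type*} [Finite ι] {f : ι → ℝ → ℝ} (hexp : IsExpanding f)
    (hd : ∀ i, Differentiable ℝ (f i)) (hs : ∀ i, Function.Surjective (f i))
    {Vp Vm : Set EReal} (hVp : Vp ∈ 𝓝 ⊤) (hVm : Vm ∈ 𝓝 ⊥)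
    (hp : ∀ x ∈ Vp, ∀ ω : ℕ → ι,
      Tendsto (fun n => orbit (fun i => extend (f i)) ω n x) atTop (𝓝 ⊤))
    (hm : ∀ x ∈ Vm, ∀ ω : ℕ → ι,
      Tendsto (fun n => orbit (fun i => extend (f i)) ω n x) atTop (𝓝 ⊥)) (ω : ℕ → ι) :
    ⋂ n : ℕ, orbit (fun i => extend (f i)) ω (n + 1) ⁻¹' (Vp ∪ Vm)ᶜ =
      {((codingMap f ω : ℝ) : EReal)} := by
  have hb := codingMap_spec hexp hd hs ω
  ext x
  simp only [mem_iInter, mem_preimage, mem_compl_iff, mem_union, not_or, mem_singleton_iff]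
  constructor
  · intro hx
    induction x with
    | bot => exact absurd (mem_of_mem_nhds hVm) (by simpa [orbit_extend_bot] using (hx 0).2)
    | top => exact absurd (mem_of_mem_nhds hVp) (by simpa [orbit_extend_top] using (hx 0).1)
    | coe x =>
      obtain ⟨a, ha⟩ := EReal.mem_nhds_top_iff.1 hVp
      obtain ⟨b, hb'⟩ := EReal.mem_nhds_bot_iff.1 hVm
      congr 1
      refine (existsUnique_bounded_orbit hexp hd hs ω).unique ?_ hb
      refine isBounded_iff_forall_norm_le.2 ⟨max |x| (max |a| |b|), ?_⟩
      rintro _ ⟨n, rfl⟩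
      rcases n with _ | n
      · exact le_max_left _ _
      · have hn := hx n
        rw [orbit_extend_coe] at hn
        have h1 : orbit f ω (n + 1) x ≤ a := by
          by_contra h
          exact hn.1 (ha (by simpa using h))
        have h2 : b ≤ orbit f ω (n + 1) x := by
          by_contra h
          exact hn.2 (hb' (by simpa using h))
        refine le_trans ?_ (le_max_right _ _)
        rw [Real.norm_eq_abs]
        refine abs_le.2 ⟨?_, ?_⟩
        · have := neg_abs_le b
          have := le_max_right |a| |b|
          linarith
        · exact h1.trans ((le_abs_self a).trans (le_max_left _ _))
  · rintro rfl n
    obtain ⟨B, hB⟩ := isBounded_iff_forall_norm_le.1 hb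
    have hB' : ∀ k, |orbit f ω k (codingMap f ω)| ≤ B := fun k => hB _ ⟨k, rfl⟩
    constructor
    · intro h
      have ht := (hp _ h (fun j => ω (n + 1 + j))).eventually
        (EReal.mem_nhds_top_iff.2 ⟨B, Subset.rfl⟩)
      obtain ⟨k, hk⟩ := ht.exists
      rw [← orbit_add, orbit_extend_coe] at hk
      have hk' : B < orbit f ω (n + 1 + k) (codingMap f ω) := by simpa using hk
      linarith [(abs_le.1 (hB' (n + 1 + k))).2]
    · intro h
      have ht := (hm _ h (fun j => ω (n + 1 + j))).eventually
        (EReal.mem_nhds_bot_iff.2 ⟨-B, Subset.rfl⟩)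
      obtain ⟨k, hk⟩ := ht.exists
      rw [← orbit_add, orbit_extend_coe] at hk
      have hk' : orbit f ω (n + 1 + k) (codingMap f ω) < -B :=
        EReal.coe_lt_coe_iff.1 hk
      linarith [(abs_le.1 (hB' (n + 1 + k))).1]

def shift {ι : Type*} (ω : ℕ → ι) : ℕ → ι := fun n => ω (n + 1)

/-- The geometric potential `φ(ω) = -log |f_{ω_1}'(π(ω))|`. -/
def geomPotential {ι : Type*} (f : ι → ℝ → ℝ) (ω : ℕ → ι) : ℝ :=
  -Real.log |deriv (f (ω 0)) (codingMap f ω)|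

/-- The potential `ψ_p(ω) = log p_{ω_1}`. -/
def weightPotential {s : ℕ} (p : EuclideanSpace ℝ (Fin s)) (ω : ℕ → Fin (s + 1)) : ℝ :=
  Real.log (weight p (ω 0))

/-- The bottom of the spectrum `α_-(p) = inf_ω liminf_n S_n ψ_p(ω) / S_n φ(ω)`, as an extended
real number. -/
def alphaMinus {s : ℕ} (f : Fin (s + 1) → ℝ → ℝ) (p : EuclideanSpace ℝ (Fin s)) : EReal :=
  ⨅ ω : ℕ → Fin (s + 1), liminf (fun n : ℕ =>
    ((birkhoffSum shift (weightPotential p) n ω / birkhoffSum shift (geomPotential f) n ω : ℝ) :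
      EReal)) atTop

end RandomLine

end

noncomputable section

namespace RandomLine

/-! ## Averaging operators -/

/-! Everything reduces to one estimate: on the Hölder functions vanishing at both infinities,
suitable powers of the transition operator have arbitrarily small norm. Evaluation at each infinity
is preserved and constants are fixed, so the linear algebra of `IsAbsorbed` does the rest. A Neumann
series produces the fixed vector with values 1 and 0 at the two infinities, the powers converge
exponentially to a rank-two projection, the spectrum is the eigenvalue 1 together with a smaller
disc, and the fixed vector is analytic in the operator, which is affine in the parameter. This
vector is the escape probability: along a random orbit its expectation is constant, and almost every
orbit is absorbed near infinity (`eq_probInfty`).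

The estimate, `contract_kernel`, is a Doeblin–Fortet argument. For the sup norm, expansion and the
absence of a common fixed point give an `N` such that from every point some word of length `N` leads
into the absorbing set `outer R` (`exists_trapped_eq_empty`), where distances to infinity contract.
For the Hölder constant, the average over words of the `α`-th power of the distance between the
images of two close points has to shrink. Paths already in `outer R` contract by themselves, so it
suffices that the paths not yet absorbed contribute a factor below one (`IsMeanContracting`);
`exists_avg_pow_le` combines the two regimes, and serves for both norms.

For part (1), the unabsorbed mass loses a fixed factor in `N` steps while distances to the power `α`
grow at most by `(Λ ^ α) ^ N`, which tends to 1 as `α` tends to 0. For part (2), separation leaves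
at most one word that keeps a given point in the interval. Its contribution is the product of the
weights times the `α`-th power of the derivative, and this is small at some time because `α` is
below `alphaMinus`; compactness makes the time uniform. With `N` fixed, mean contraction survives
small changes of the weights, which gives the ball. Finally `α ≤ 1` is automatic in part (2), since
mean contraction with exponent one would make the invariant function locally constant on the line.
-/

/-- The averaging operator `G ↦ ∑ w_i · (G ∘ F_i)`. -/
def avg {ι X : Type*} [Fintype ι] (w : ι → ℝ) (F : ι → X → X) : Module.End ℝ (X → ℝ) where
  toFun G x := ∑ i, w i * G (F i x)
  map_add' G H := by
    funext x
    simp [mul_add, Finset.sum_add_distrib]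
  map_smul' c G := by
    funext x
    simp only [Pi.smul_apply, smul_eq_mul, RingHom.id_apply, Finset.mul_sum]
    exact Finset.sum_congr rfl fun i _ => by ring

section Avg

variable {ι X : Type*} [Fintype ι] {w w' : ι → ℝ} {F : ι → X → X} {G H : X → ℝ}

theorem avg_apply (w : ι → ℝ) (F : ι → X → X) (G : X → ℝ) (x : X) :
    avg w F G x = ∑ i, w i * G (F i x) := rfl

theorem avg_pow_succ_apply (w : ι → ℝ) (F : ι → X → X) (n : ℕ) (G : X → ℝ) (x : X) :
    (avg w F ^ (n + 1)) G x = ∑ i, w i * (avg w F ^ n) G (F i x) := by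
  rw [pow_succ']
  rfl

theorem avg_pow_add_apply (w : ι → ℝ) (F : ι → X → X) (m n : ℕ) (G : X → ℝ) :
    (avg w F ^ (m + n)) G = (avg w F ^ m) ((avg w F ^ n) G) := by
  rw [pow_add]
  rfl

/-- The filter is later `⊤` (pointwise bounds) or the neighbourhoods of the diagonal (close pairs).
Its invariance under the maps absorbs the shrinking, as `n` grows, of the set on which the
inequality is known. -/
theorem avg_pow_le_of_eventuallyLE (hw : ∀ i, 0 ≤ w i) {l : Filter X}
    (hF : ∀ i, Tendsto (F i) l l) (h : G ≤ᶠ[l] H) (n : ℕ) :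
    (avg w F ^ n) G ≤ᶠ[l] (avg w F ^ n) H := by
  induction n with
  | zero => simpa using h
  | succ n ih =>
    have h1 : ∀ᶠ x in l, ∀ i, (avg w F ^ n) G (F i x) ≤ (avg w F ^ n) H (F i x) :=
      eventually_all.2 fun i => (hF i).eventually ih
    filter_upwards [h1] with x hx
    rw [avg_pow_succ_apply, avg_pow_succ_apply]
    exact Finset.sum_le_sum fun i _ => mul_le_mul_of_nonneg_left (hx i) (hw i)

theorem avg_pow_mono (hw : ∀ i, 0 ≤ w i) (h : ∀ x, G x ≤ H x) (n : ℕ) (x : X) :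
    (avg w F ^ n) G x ≤ (avg w F ^ n) H x := by
  have := avg_pow_le_of_eventuallyLE hw (F := F) (l := ⊤) (fun i => tendsto_top)
    (eventually_top.2 h) n
  exact eventually_top.1 this x

theorem avg_pow_zero_fun (n : ℕ) : (avg w F ^ n) (0 : X → ℝ) = 0 := map_zero _

theorem avg_pow_nonneg (hw : ∀ i, 0 ≤ w i) (h : ∀ x, 0 ≤ G x) (n : ℕ) (x : X) :
    0 ≤ (avg w F ^ n) G x := by
  have := avg_pow_mono hw (F := F) (G := 0) h n x
  rwa [avg_pow_zero_fun] at this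

theorem avg_pow_const (hw : ∑ i, w i = 1) (c : ℝ) (n : ℕ) :
    (avg w F ^ n) (fun _ => c) = fun _ => c := by
  induction n with
  | zero => simp
  | succ n ih =>
    funext x
    rw [avg_pow_succ_apply, ih, ← Finset.sum_mul, hw, one_mul]

theorem avg_pow_le_pow_smul (hw : ∀ i, 0 ≤ w i) (hw1 : ∑ i, w i = 1) {c : ℝ} (hc : 0 ≤ c)
    (h : ∀ i x, G (F i x) ≤ c * G x) (n : ℕ) (x : X) :
    (avg w F ^ n) G x ≤ c ^ n * G x := by
  induction n generalizing x with
  | zero => simp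
  | succ n ih =>
    rw [avg_pow_succ_apply]
    calc ∑ i, w i * (avg w F ^ n) G (F i x) ≤ ∑ i, w i * (c ^ (n + 1) * G x) := by
          refine Finset.sum_le_sum fun i _ => mul_le_mul_of_nonneg_left ?_ (hw i)
          refine (ih _).trans ?_
          rw [pow_succ, mul_assoc]
          exact mul_le_mul_of_nonneg_left (h i x) (pow_nonneg hc n)
      _ = c ^ (n + 1) * G x := by rw [← Finset.sum_mul, hw1, one_mul]

/-- Source of the stability in the parameter: for a fixed number of steps, a relative change `t` of
the weights costs only `t ^ n`. -/
theorem avg_pow_le_of_weight_le (hw : ∀ i, 0 ≤ w i) {t : ℝ} (hw' : ∀ i, w i ≤ t * w' i)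
    (hG : ∀ x, 0 ≤ G x) (n : ℕ) (x : X) :
    (avg w F ^ n) G x ≤ t ^ n * (avg w' F ^ n) G x := by
  induction n generalizing x with
  | zero => simp
  | succ n ih =>
    rw [avg_pow_succ_apply, avg_pow_succ_apply, Finset.mul_sum]
    refine Finset.sum_le_sum fun i _ => ?_
    calc w i * (avg w F ^ n) G (F i x) ≤ (t * w' i) * (t ^ n * (avg w' F ^ n) G (F i x)) :=
          mul_le_mul (hw' i) (ih _) (avg_pow_nonneg hw hG _ _) ((hw i).trans (hw' i))
      _ = _ := by ring

/-- If `D` contracts on the forward invariant set `W`, and the averaged mass outside `W` after `N`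
steps is a definite fraction, then the iterated averages of `D` become arbitrarily small. -/
theorem exists_avg_pow_le (hw : ∀ i, 0 ≤ w i) (hw1 : ∑ i, w i = 1) {l : Filter X}
    (hF : ∀ i, Tendsto (F i) l l) {D B : X → ℝ} (hD : ∀ x, 0 ≤ D x) (hB : ∀ x, 0 ≤ B x)
    {W : Set X} {κ : ℝ} (hκ0 : 0 ≤ κ) (hκ1 : κ < 1)
    (hW : ∀ᶠ x in l, x ∈ W → ∀ i, F i x ∈ W ∧ D (F i x) ≤ κ * D x)
    {N : ℕ} (hN : N ≠ 0) {θ : ℝ} (hθ0 : 0 ≤ θ) (hθ1 : θ < 1)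
    (hθ : ∀ᶠ x in l, (avg w F ^ N) (Wᶜ.indicator B) x ≤ θ * B x)
    {C : ℝ} (hC0 : 0 ≤ C) (hC : ∀ᶠ x in l, (avg w F ^ N) D x ≤ C * B x)
    {C' : ℝ} (hC' : ∀ᶠ x in l, D x ≤ C' * B x) {e : ℝ} (he : 0 < e) :
    ∃ n, n ≠ 0 ∧ ∀ᶠ x in l, (avg w F ^ n) D x ≤ e * B x := by
  have contr : ∀ m, ∀ᶠ x in l, x ∈ W → (avg w F ^ m) D x ≤ κ ^ m * D x := by
    intro m
    induction m with
    | zero => exact Eventually.of_forall fun x _ => by simp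
    | succ m ih =>
      have h1 : ∀ᶠ x in l, ∀ i, F i x ∈ W →
          (avg w F ^ m) D (F i x) ≤ κ ^ m * D (F i x) :=
        eventually_all.2 fun i => (hF i).eventually ih
      filter_upwards [h1, hW] with x hx hxW hxm
      rw [avg_pow_succ_apply]
      calc ∑ i, w i * (avg w F ^ m) D (F i x) ≤ ∑ i, w i * (κ ^ (m + 1) * D x) := by
            refine Finset.sum_le_sum fun i _ => mul_le_mul_of_nonneg_left ?_ (hw i)
            refine (hx i (hxW hxm i).1).trans ?_
            rw [pow_succ, mul_assoc]
            exact mul_le_mul_of_nonneg_left (hxW hxm i).2 (pow_nonneg hκ0 m)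
        _ = κ ^ (m + 1) * D x := by rw [← Finset.sum_mul, hw1, one_mul]
  -- Split at time `N`: paths inside `W` use the contraction `κ ^ m` for the remaining `m` steps,
  -- the others use the bound `c` already known but carry only the fraction `θ`.
  have step : ∀ m c, 0 ≤ c → (∀ᶠ x in l, (avg w F ^ m) D x ≤ c * B x) →
      ∀ᶠ x in l, (avg w F ^ (N + m)) D x ≤ (κ ^ m * C + c * θ) * B x := by
    intro m c hc hm
    have h1 : (avg w F ^ m) D ≤ᶠ[l] κ ^ m • D + c • Wᶜ.indicator B := by
      filter_upwards [hm, contr m] with x h2 h3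
      simp only [Pi.add_apply, Pi.smul_apply, smul_eq_mul]
      by_cases hx : x ∈ W
      · rw [indicator_of_notMem (by simpa using hx)]
        simpa using h3 hx
      · rw [indicator_of_mem (by simpa using hx)]
        have := mul_nonneg (pow_nonneg hκ0 m) (hD x)
        linarith
    filter_upwards [avg_pow_le_of_eventuallyLE hw hF h1 N, hθ, hC] with x h2 h3 h4
    rw [avg_pow_add_apply]
    refine h2.trans ?_
    rw [map_add, map_smul, map_smul]
    simp only [Pi.add_apply, Pi.smul_apply, smul_eq_mul]
    have h5 := mul_le_mul_of_nonneg_left h4 (pow_nonneg hκ0 m)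
    have h6 := mul_le_mul_of_nonneg_left h3 hc
    calc _ ≤ κ ^ m * (C * B x) + c * (θ * B x) := add_le_add h5 h6
      _ = _ := by ring
  have hκN : κ ^ N < 1 := pow_lt_one₀ hκ0 hκ1 hN
  -- Any rate `ρ` above both `θ` and `κ ^ N` works: `A` is chosen with `C ≤ A * (ρ - θ)`, so that
  -- the recursion of `step` preserves the bound `A * ρ ^ k`.
  obtain ⟨ρ, hρ, hρ1⟩ := exists_between (max_lt hθ1 hκN)
  have hρθ : θ < ρ := (le_max_left _ _).trans_lt hρ
  have hρκ : κ ^ N < ρ := (le_max_right _ _).trans_lt hρ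
  have hρ0 : 0 ≤ ρ := hθ0.trans hρθ.le
  set A : ℝ := max C' (C / (ρ - θ)) with hA
  have hAC : C ≤ A * (ρ - θ) := by
    have := le_max_right C' (C / (ρ - θ))
    rwa [← hA, div_le_iff₀ (sub_pos.2 hρθ)] at this
  have hA0 : 0 ≤ A := (div_nonneg hC0 (sub_pos.2 hρθ).le).trans (le_max_right _ _)
  have main : ∀ k, ∀ᶠ x in l, (avg w F ^ (N * k)) D x ≤ (A * ρ ^ k) * B x := by
    intro k
    induction k with
    | zero =>
      filter_upwards [hC'] with x hx
      simp only [mul_zero, pow_zero, Module.End.one_apply, mul_one]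
      exact hx.trans (mul_le_mul_of_nonneg_right (le_max_left _ _) (hB x))
    | succ k ih =>
      have h1 := step (N * k) _ (mul_nonneg hA0 (pow_nonneg hρ0 k)) ih
      rw [show N * (k + 1) = N + N * k by ring]
      filter_upwards [h1] with x hx
      refine hx.trans (mul_le_mul_of_nonneg_right ?_ (hB x))
      have h2 : κ ^ (N * k) ≤ ρ ^ k := by
        rw [pow_mul]
        exact pow_le_pow_left₀ (pow_nonneg hκ0 N) hρκ.le k
      have h3 := mul_le_mul_of_nonneg_right h2 hC0
      have h4 := mul_le_mul_of_nonneg_left hAC (pow_nonneg hρ0 k)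
      calc _ ≤ ρ ^ k * (A * (ρ - θ)) + A * ρ ^ k * θ := by linarith
        _ = A * ρ ^ (k + 1) := by ring
  have hlim : Tendsto (fun k => A * ρ ^ k) atTop (𝓝 (A * 0)) :=
    (tendsto_pow_atTop_nhds_zero_of_lt_one hρ0 hρ1).const_mul A
  rw [mul_zero] at hlim
  obtain ⟨k, hk, hk0⟩ := ((hlim.eventually (gt_mem_nhds he)).and (eventually_ne_atTop 0)).exists
  refine ⟨N * k, mul_ne_zero hN hk0, ?_⟩
  filter_upwards [main k] with x hx
  exact hx.trans (mul_le_mul_of_nonneg_right hk.le (hB x))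

end Avg

/-! ## Metrics on the compactified line -/

namespace LineMetric

variable (m : LineMetric)

theorem tendsto_d (x : EReal) : Tendsto (fun y => m.d x y) (𝓝 x) (𝓝 0) := by
  refine Metric.tendsto_nhds.2 fun e he => ?_
  filter_upwards [(m.nhds_basis x).mem_of_mem he] with y hy
  rw [Real.dist_eq, sub_zero, abs_of_nonneg (m.d_nonneg x y)]
  exact hy

theorem continuous_d : Continuous fun q : EReal × EReal => m.d q.1 q.2 := by
  refine continuous_iff_continuousAt.2 fun ⟨a, b⟩ => ?_
  have h1 : Tendsto (fun q : EReal × EReal => m.d a q.1 + m.d b q.2) (𝓝 (a, b)) (𝓝 (0 + 0)) := by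
    rw [nhds_prod_eq]
    exact ((m.tendsto_d a).comp tendsto_fst).add ((m.tendsto_d b).comp tendsto_snd)
  rw [add_zero] at h1
  refine tendsto_iff_dist_tendsto_zero.2 (squeeze_zero (fun _ => dist_nonneg) (fun q => ?_) h1)
  rw [Real.dist_eq, abs_le]
  have h2 := m.d_triangle a q.1 b
  have h3 := m.d_triangle q.1 q.2 b
  have h4 := m.d_triangle q.1 a q.2
  have h5 := m.d_triangle a b q.2
  rw [m.d_comm q.2 b] at h3
  rw [m.d_comm q.1 a] at h4
  constructor <;> linarith

theorem d_pos {x y : EReal} (h : x ≠ y) : 0 < m.d x y :=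
  lt_of_le_of_ne (m.d_nonneg x y) fun h0 => h (m.eq_of_d_eq_zero x y h0.symm)

theorem exists_d_le : ∃ Δ : ℝ, 1 ≤ Δ ∧ ∀ x y, m.d x y ≤ Δ := by
  obtain ⟨C, hC⟩ := (isCompact_range m.continuous_d).bddAbove
  exact ⟨max 1 C, le_max_left _ _, fun x y => (hC ⟨(x, y), rfl⟩).trans (le_max_right _ _)⟩

/-- By compactness the metric has a positive minimum off an open neighbourhood of the diagonal. This
turns statements local at each point into statements about all pairs closer than a uniform `η`. -/
theorem exists_pos_of_eventually_nhdsSet_diagonal {P : EReal × EReal → Prop}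
    (hP : ∀ᶠ q in 𝓝ˢ (diagonal EReal), P q) :
    ∃ η : ℝ, 0 < η ∧ ∀ x y, m.d x y < η → P (x, y) := by
  obtain ⟨U, hU, hdU, hUP⟩ := mem_nhdsSet_iff_exists.1 hP
  rcases (Uᶜ).eq_empty_or_nonempty with h | h
  · exact ⟨1, one_pos, fun x y _ => hUP (by
      have := compl_empty_iff.1 h
      rw [this]; trivial)⟩
  · obtain ⟨q, hq, hmin⟩ := hU.isClosed_compl.isCompact.exists_isMinOn h m.continuous_d.continuousOn
    refine ⟨m.d q.1 q.2, m.d_pos fun h => hq (hdU h), fun x y hxy => hUP ?_⟩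
    by_contra hn
    exact absurd (isMinOn_iff.1 hmin (x, y) hn) (not_le.2 hxy)

end LineMetric

theorem tendsto_prodMap_nhdsSet_diagonal {X : Type*} [TopologicalSpace X] {g : X → X}
    (hg : Continuous g) :
    Tendsto (Prod.map g g) (𝓝ˢ (diagonal X)) (𝓝ˢ (diagonal X)) :=
  (hg.prodMap hg).tendsto_nhdsSet fun q hq => by
    rw [mem_diagonal_iff] at hq ⊢
    simp [hq]

/-- A property depending monotonically on a natural number which holds locally holds for a uniform
value of the number near a compact set. -/
theorem _root_.IsCompact.exists_nat_eventually_nhdsSet {X : Type*} [TopologicalSpace X] {K : Set X}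
    (hK : IsCompact K) {P : ℕ → X → Prop} (hmono : ∀ m n x, m ≤ n → P m x → P n x)
    (hP : ∀ z ∈ K, ∃ n, ∀ᶠ x in 𝓝 z, P n x) : ∃ n, ∀ᶠ x in 𝓝ˢ K, P n x := by
  refine hK.induction_on (p := fun S => ∃ n, ∀ᶠ x in 𝓝ˢ S, P n x) ⟨0, by simp⟩ ?_ ?_ ?_
  · rintro s t hst ⟨n, hn⟩
    exact ⟨n, hn.filter_mono (nhdsSet_mono hst)⟩
  · rintro s t ⟨n, hn⟩ ⟨k, hk⟩
    refine ⟨max n k, ?_⟩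
    rw [nhdsSet_union, eventually_sup]
    exact ⟨hn.mono fun x => hmono _ _ _ (le_max_left _ _),
      hk.mono fun x => hmono _ _ _ (le_max_right _ _)⟩
  · intro z hz
    obtain ⟨n, hn⟩ := hP z hz
    obtain ⟨U, hU, hUo, hzU⟩ := eventually_nhds_iff.1 hn
    exact ⟨U, mem_nhdsWithin_of_mem_nhds (hUo.mem_nhds hzU), n,
      (eventually_nhdsSet_iff_forall.2 fun x hx => (hUo.eventually_mem hx).mono hU)⟩

/-! ## Hölder spaces as Banach spaces -/

namespace HolderSpace

variable {m : LineMetric} {α : ℝ} {𝕜 : Type*} [RCLike 𝕜]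

theorem add_apply (g h : HolderSpace m α 𝕜) (x : EReal) : (g + h) x = g x + h x := rfl

theorem one_apply (x : EReal) : (1 : HolderSpace m α 𝕜) x = 1 := rfl

theorem sum_apply {ι : Type*} (s : Finset ι) (g : ι → HolderSpace m α 𝕜) (x : EReal) :
    (∑ i ∈ s, g i) x = ∑ i ∈ s, g i x := by
  classical
  induction s using Finset.induction_on with
  | empty => rfl
  | insert i s hi ih => rw [Finset.sum_insert hi, Finset.sum_insert hi, add_apply, ih]

theorem ext {g h : HolderSpace m α 𝕜} (H : ∀ x, g x = h x) : g = h :=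
  Subtype.ext (ContinuousMap.ext H)

theorem norm_sub_le (h : HolderSpace m α 𝕜) (x y : EReal) :
    ‖h x - h y‖ ≤ variation h * m.d x y ^ α := by
  rcases eq_or_ne x y with rfl | hxy
  · rw [sub_self, norm_zero]
    exact mul_nonneg (variation_nonneg h) (Real.rpow_nonneg (m.d_nonneg _ _) _)
  · rw [← div_le_iff₀ (Real.rpow_pos_of_pos (m.d_pos hxy) _)]
    exact le_ciSup (bddAbove_variation h) (x, y)

theorem variation_le {h : HolderSpace m α 𝕜} {C : ℝ} (hC : 0 ≤ C)
    (H : ∀ x y, ‖h x - h y‖ ≤ C * m.d x y ^ α) : variation h ≤ C :=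
  ciSup_le fun _ => div_le_of_le_mul₀ (Real.rpow_nonneg (m.d_nonneg _ _) _) hC (H _ _)

theorem variation_le_norm (h : HolderSpace m α 𝕜) : variation h ≤ ‖h‖ := by
  rw [norm_eq]
  linarith [norm_nonneg (toCont h)]

theorem norm_toCont_le (h : HolderSpace m α 𝕜) : ‖toCont h‖ ≤ ‖h‖ := by
  rw [norm_eq]
  linarith [variation_nonneg h]

theorem norm_apply_le (h : HolderSpace m α 𝕜) (x : EReal) : ‖h x‖ ≤ ‖h‖ :=
  ((toCont h).norm_coe_le_norm x).trans (norm_toCont_le h)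

theorem norm_le {h : HolderSpace m α 𝕜} {C C' : ℝ} (hC : 0 ≤ C) (hC' : 0 ≤ C')
    (H : ∀ x y, ‖h x - h y‖ ≤ C * m.d x y ^ α) (H' : ∀ x, ‖h x‖ ≤ C') : ‖h‖ ≤ C + C' := by
  rw [norm_eq]
  exact add_le_add (variation_le hC H) ((ContinuousMap.norm_le _ hC').2 H')

/-- Uniform convergence gives a continuous limit, and the Hölder bounds on `u n - u k` pass to the
limit in `k` pointwise. Completeness is needed for the Neumann series. -/
instance : CompleteSpace (HolderSpace m α 𝕜) := by
  refine Metric.complete_of_cauchySeq_tendsto fun u hu => ?_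
  have hu' : CauchySeq fun n => toCont (u n) := by
    refine Metric.cauchySeq_iff.2 fun e he => ?_
    obtain ⟨N, hN⟩ := Metric.cauchySeq_iff.1 hu e he
    refine ⟨N, fun k hk n hn => lt_of_le_of_lt ?_ (hN k hk n hn)⟩
    rw [dist_eq_norm, dist_eq_norm]
    exact norm_toCont_le (u k - u n)
  obtain ⟨g, hg⟩ := cauchySeq_tendsto_of_complete hu'
  have hgx : ∀ x, Tendsto (fun n => u n x) atTop (𝓝 (g x)) := fun x =>
    ((continuous_eval_const x).tendsto g).comp hg
  have key : ∀ e > 0, ∃ N, ∀ n ≥ N,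
      (∀ x y, ‖(u n x - g x) - (u n y - g y)‖ ≤ e * m.d x y ^ α) ∧ ∀ x, ‖u n x - g x‖ ≤ e := by
    intro e he
    obtain ⟨N, hN⟩ := Metric.cauchySeq_iff.1 hu e he
    refine ⟨N, fun n hn => ⟨fun x y => ?_, fun x => ?_⟩⟩
    · have h1 : Tendsto (fun k => ‖(u n x - u k x) - (u n y - u k y)‖) atTop
          (𝓝 ‖(u n x - g x) - (u n y - g y)‖) :=
        ((tendsto_const_nhds.sub (hgx x)).sub (tendsto_const_nhds.sub (hgx y))).norm
      refine le_of_tendsto h1 ((eventually_ge_atTop N).mono fun k hk => ?_)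
      have h2 : ‖u n - u k‖ ≤ e := by
        rw [← dist_eq_norm]
        exact (hN n hn k hk).le
      exact (norm_sub_le (u n - u k) x y).trans (mul_le_mul_of_nonneg_right
        ((variation_le_norm _).trans h2) (Real.rpow_nonneg (m.d_nonneg _ _) _))
    · refine le_of_tendsto (tendsto_const_nhds.sub (hgx x)).norm
        ((eventually_ge_atTop N).mono fun k hk => ?_)
      have h2 : ‖u n - u k‖ ≤ e := by
        rw [← dist_eq_norm]
        exact (hN n hn k hk).le
      exact (norm_apply_le (u n - u k) x).trans h2
  have hmem : g ∈ holderSubmodule m α 𝕜 := by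
    obtain ⟨N, hN⟩ := key 1 one_pos
    refine ⟨variation (u N) + 1, fun x y => ?_⟩
    have h1 := (hN N le_rfl).1 x y
    have h2 := norm_sub_le (u N) x y
    have e : g x - g y = (u N x - u N y) - ((u N x - g x) - (u N y - g y)) := by ring
    rw [e, add_mul]
    exact (_root_.norm_sub_le _ _).trans (add_le_add h2 h1)
  let G : HolderSpace m α 𝕜 := ⟨g, hmem⟩
  refine ⟨G, Metric.tendsto_atTop.2 fun e he => ?_⟩
  obtain ⟨N, hN⟩ := key (e / 4) (by linarith)
  refine ⟨N, fun n hn => ?_⟩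
  rw [dist_eq_norm]
  have h3 : ‖u n - G‖ ≤ e / 4 + e / 4 :=
    norm_le (by linarith) (by linarith) (hN n hn).1 (hN n hn).2
  linarith

/-- Evaluation at a point. -/
def evalCLM (x : EReal) : HolderSpace m α 𝕜 →L[𝕜] 𝕜 :=
  LinearMap.mkContinuous
    { toFun := fun h => h x
      map_add' := fun _ _ => rfl
      map_smul' := fun _ _ => rfl } 1 fun h => by
    rw [one_mul]
    exact norm_apply_le h x

theorem evalCLM_apply (x : EReal) (h : HolderSpace m α 𝕜) : evalCLM x h = h x := rfl

/-- Composition with a Lipschitz map. -/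
theorem exists_compCLM {g : EReal → EReal} (hg : Continuous g) {Λ : ℝ} (hα : 0 < α)
    (hΛ : ∀ x y, m.d (g x) (g y) ≤ Λ * m.d x y) :
    ∃ K : HolderSpace m α 𝕜 →L[𝕜] HolderSpace m α 𝕜, ∀ h x, (K h) x = h (g x) := by
  have hΛ' : ∀ x y, m.d (g x) (g y) ^ α ≤ |Λ| ^ α * m.d x y ^ α := by
    intro x y
    rw [← Real.mul_rpow (abs_nonneg _) (m.d_nonneg _ _)]
    exact Real.rpow_le_rpow (m.d_nonneg _ _) ((hΛ x y).trans
      (mul_le_mul_of_nonneg_right (le_abs_self _) (m.d_nonneg _ _))) hα.le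
  have bd : ∀ (h : HolderSpace m α 𝕜) x y,
      ‖h (g x) - h (g y)‖ ≤ variation h * |Λ| ^ α * m.d x y ^ α := by
    intro h x y
    rw [mul_assoc]
    exact (norm_sub_le h _ _).trans (mul_le_mul_of_nonneg_left (hΛ' x y) (variation_nonneg h))
  let K : HolderSpace m α 𝕜 →ₗ[𝕜] HolderSpace m α 𝕜 :=
    { toFun := fun h => ⟨(toCont h).comp ⟨g, hg⟩, variation h * |Λ| ^ α, bd h⟩
      map_add' := fun _ _ => rfl
      map_smul' := fun _ _ => rfl }
  have hΛ0 : 0 ≤ |Λ| ^ α := Real.rpow_nonneg (abs_nonneg _) _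
  refine ⟨K.mkContinuous (|Λ| ^ α + 1) fun h => ?_, fun h x => rfl⟩
  refine (norm_le (mul_nonneg (variation_nonneg h) hΛ0) (norm_nonneg h) (bd h)
    fun x => norm_apply_le h (g x)).trans ?_
  have := mul_le_mul_of_nonneg_right (variation_le_norm h) hΛ0
  linarith

/-- A function in `C^α` which is `1` at `+∞` and `0` at `-∞`. -/
theorem exists_top_eq_one (m : LineMetric) (𝕜 : Type*) [RCLike 𝕜] {α : ℝ} (hα : 0 < α)
    (hα1 : α ≤ 1) : ∃ h : HolderSpace m α 𝕜, h ⊤ = 1 ∧ h ⊥ = 0 := by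
  have hd : 0 < m.d ⊤ ⊥ ^ α := Real.rpow_pos_of_pos (m.d_pos (by simp)) _
  have hc : Continuous fun x : EReal => ((m.d x ⊥ ^ α / m.d ⊤ ⊥ ^ α : ℝ) : 𝕜) := by
    refine RCLike.continuous_ofReal.comp (Continuous.div_const ?_ _)
    exact (m.continuous_d.comp (continuous_id.prodMk continuous_const)).rpow_const
      fun x => Or.inr hα.le
  refine ⟨⟨⟨_, hc⟩, (m.d ⊤ ⊥ ^ α)⁻¹, fun x y => ?_⟩, ?_, ?_⟩
  · change ‖((m.d x ⊥ ^ α / m.d ⊤ ⊥ ^ α : ℝ) : 𝕜) - ((m.d y ⊥ ^ α / m.d ⊤ ⊥ ^ α : ℝ) : 𝕜)‖ ≤ _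
    rw [← RCLike.ofReal_sub, RCLike.norm_ofReal, ← sub_div, abs_div, abs_of_pos hd, div_eq_inv_mul]
    refine mul_le_mul_of_nonneg_left ?_ (inv_pos.2 hd).le
    -- Here `α ≤ 1` enters: the power `t ^ α` is subadditive, so the `α`-th power of the distance
    -- satisfies the triangle inequality.
    have key : ∀ x y : EReal, m.d x ⊥ ^ α - m.d y ⊥ ^ α ≤ m.d x y ^ α := fun x y => by
      have h1 := Real.rpow_le_rpow (m.d_nonneg _ _) (m.d_triangle x y ⊥) hα.le
      have h2 := Real.rpow_add_le_add_rpow (m.d_nonneg x y) (m.d_nonneg y ⊥) hα.le hα1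
      linarith
    have h3 := key y x
    rw [m.d_comm y x] at h3
    exact abs_le.2 ⟨by linarith, key x y⟩
  · change ((m.d ⊤ ⊥ ^ α / m.d ⊤ ⊥ ^ α : ℝ) : 𝕜) = 1
    rw [div_self hd.ne', RCLike.ofReal_one]
  · change ((m.d ⊥ ⊥ ^ α / m.d ⊤ ⊥ ^ α : ℝ) : 𝕜) = 0
    rw [m.d_self, Real.zero_rpow hα.ne', zero_div, RCLike.ofReal_zero]

end HolderSpace

/-! ## Operators contracting the common kernel of two invariant functionals -/

/-- The rate is the `k`-th root of a number between `‖a ^ k‖` and 1; the constant takes care of the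
exponents below `k`, and larger exponents are reduced by `k` at a time. -/
theorem exists_norm_pow_le {R : Type*} [NormedRing R] {a : R} {k : ℕ} (hk : k ≠ 0)
    (ha : ‖a ^ k‖ < 1) :
    ∃ C r : ℝ, 0 ≤ C ∧ 0 ≤ r ∧ r < 1 ∧ ∀ n, ‖a ^ n‖ ≤ C * r ^ n := by
  obtain ⟨q, hq0, hq1⟩ := exists_between ha
  have hqpos : 0 < q := (norm_nonneg _).trans_lt hq0
  have hkpos : (0 : ℝ) < k := by exact_mod_cast Nat.pos_of_ne_zero hk
  set r : ℝ := q ^ ((k : ℝ)⁻¹) with hr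
  have hrpos : 0 < r := Real.rpow_pos_of_pos hqpos _
  have hrk : r ^ k = q := by
    rw [hr, ← Real.rpow_natCast, ← Real.rpow_mul hqpos.le, inv_mul_cancel₀ hkpos.ne', Real.rpow_one]
  have hr1 : r < 1 := Real.rpow_lt_one hqpos.le hq1 (inv_pos.2 hkpos)
  set C : ℝ := ∑ j ∈ Finset.range k, ‖a ^ j‖ / r ^ j with hC
  have hterm : ∀ j, 0 ≤ ‖a ^ j‖ / r ^ j := fun j => div_nonneg (norm_nonneg _) (pow_pos hrpos j).le
  have hC0 : 0 ≤ C := Finset.sum_nonneg fun j _ => hterm j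
  refine ⟨C, r, hC0, hrpos.le, hr1, fun n => ?_⟩
  induction n using Nat.strong_induction_on with
  | _ n ih =>
    rcases lt_or_ge n k with h | h
    · have := Finset.single_le_sum (fun j _ => hterm j) (Finset.mem_range.2 h)
      rwa [← hC, div_le_iff₀ (pow_pos hrpos n)] at this
    · obtain ⟨j, rfl⟩ := Nat.exists_eq_add_of_le h
      rw [pow_add, pow_add, hrk]
      calc ‖a ^ k * a ^ j‖ ≤ ‖a ^ k‖ * ‖a ^ j‖ := norm_mul_le _ _
        _ ≤ q * (C * r ^ j) := mul_le_mul hq0.le (ih j (by omega)) (norm_nonneg _) hqpos.le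
        _ = C * (q * r ^ j) := by ring

/-- `1 - a` is one of two commuting factors of the unit `1 - a ^ k`, by the geometric sum. -/
theorem isUnit_one_sub_of_norm_pow_lt_one {R : Type*} [NormedRing R] [CompleteSpace R] {a : R}
    {k : ℕ} (ha : ‖a ^ k‖ < 1) : IsUnit (1 - a) := by
  have h1 : IsUnit (1 - a ^ k) := isUnit_one_sub_of_norm_lt_one ha
  have hc : Commute (1 - a) (∑ i ∈ Finset.range k, a ^ i) :=
    ((Commute.one_left _).sub_left (Commute.sum_right _ _ _ fun i _ => Commute.self_pow a i))
  rw [← mul_neg_geom_sum] at h1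
  exact (hc.isUnit_mul_iff.1 h1).1

section Absorbed

variable {𝕜 E : Type*} [RCLike 𝕜] [NormedAddCommGroup E] [NormedSpace 𝕜 E]

/-- The operator `A` preserves the functionals `ℓ₁` and `ℓ₂`, fixes `v`, and its powers contract
the common kernel of `ℓ₁` and `ℓ₂`. -/
structure IsAbsorbed (A : E →L[𝕜] E) (ℓ₁ ℓ₂ : E →L[𝕜] 𝕜) (u v : E) : Prop where
  fst_u : ℓ₁ u = 1
  snd_u : ℓ₂ u = 0
  fst_v : ℓ₁ v = 1
  snd_v : ℓ₂ v = 1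
  fst_map : ∀ h, ℓ₁ (A h) = ℓ₁ h
  snd_map : ∀ h, ℓ₂ (A h) = ℓ₂ h
  map_v : A v = v
  contract : ∀ e : ℝ, 0 < e → ∃ k : ℕ, k ≠ 0 ∧
    ∀ h, ℓ₁ h = 0 → ℓ₂ h = 0 → ‖(A ^ k) h‖ ≤ e * ‖h‖

/-- The interpolation operator `h ↦ (ℓ₁ h - ℓ₂ h) u + (ℓ₂ h) v`. -/
def interp (ℓ₁ ℓ₂ : E →L[𝕜] 𝕜) (u v : E) : E →L[𝕜] E :=
  (ℓ₁ - ℓ₂).smulRight u + ℓ₂.smulRight v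

theorem interp_apply (ℓ₁ ℓ₂ : E →L[𝕜] 𝕜) (u v h : E) :
    interp ℓ₁ ℓ₂ u v h = (ℓ₁ h - ℓ₂ h) • u + ℓ₂ h • v := rfl

/-- The fixed vector of `A` with the same values of `ℓ₁` and `ℓ₂` as `u`. -/
def fixedVec (A : E →L[𝕜] E) (ℓ₁ ℓ₂ : E →L[𝕜] 𝕜) (u v : E) : E :=
  u + Ring.inverse (1 - A * (1 - interp ℓ₁ ℓ₂ u v)) (A u - u)

namespace IsAbsorbed

variable {A : E →L[𝕜] E} {ℓ₁ ℓ₂ : E →L[𝕜] 𝕜} {u v : E}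

theorem fst_pow (H : IsAbsorbed A ℓ₁ ℓ₂ u v) (n : ℕ) (h : E) : ℓ₁ ((A ^ n) h) = ℓ₁ h := by
  induction n with
  | zero => simp
  | succ n ih => rw [pow_succ', mul_apply_eq_comp, H.fst_map, ih]

theorem snd_pow (H : IsAbsorbed A ℓ₁ ℓ₂ u v) (n : ℕ) (h : E) : ℓ₂ ((A ^ n) h) = ℓ₂ h := by
  induction n with
  | zero => simp
  | succ n ih => rw [pow_succ', mul_apply_eq_comp, H.snd_map, ih]

theorem fst_sub_interp (H : IsAbsorbed A ℓ₁ ℓ₂ u v) (h : E) :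
    ℓ₁ (h - interp ℓ₁ ℓ₂ u v h) = 0 := by
  simp [interp_apply, H.fst_u, H.fst_v]

theorem snd_sub_interp (H : IsAbsorbed A ℓ₁ ℓ₂ u v) (h : E) :
    ℓ₂ (h - interp ℓ₁ ℓ₂ u v h) = 0 := by
  simp [interp_apply, H.snd_u, H.snd_v]

theorem interp_eq_zero {h : E} (h1 : ℓ₁ h = 0) (h2 : ℓ₂ h = 0) : interp ℓ₁ ℓ₂ u v h = 0 := by
  simp [interp_apply, h1, h2]

theorem reduced_pow_apply (H : IsAbsorbed A ℓ₁ ℓ₂ u v) (n : ℕ) {h : E} (h1 : ℓ₁ h = 0)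
    (h2 : ℓ₂ h = 0) : ((A * (1 - interp ℓ₁ ℓ₂ u v)) ^ n) h = (A ^ n) h := by
  induction n with
  | zero => simp
  | succ n ih =>
    rw [pow_succ', pow_succ', mul_apply_eq_comp, ih, mul_apply_eq_comp,
      mul_apply_eq_comp, sub_apply,
      interp_eq_zero (by rw [H.fst_pow, h1]) (by rw [H.snd_pow, h2]), sub_zero,
      one_apply_eq_self]

/-- `1 - interp` is a projection onto the common kernel, which `A` preserves; hence only the first
projection has an effect. -/
theorem reduced_pow_succ (H : IsAbsorbed A ℓ₁ ℓ₂ u v) (n : ℕ) (h : E) :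
    ((A * (1 - interp ℓ₁ ℓ₂ u v)) ^ (n + 1)) h = (A ^ (n + 1)) (h - interp ℓ₁ ℓ₂ u v h) := by
  set J := interp ℓ₁ ℓ₂ u v with hJ
  rw [← H.reduced_pow_apply (n + 1) (H.fst_sub_interp h) (H.snd_sub_interp h), ← hJ, pow_succ]
  change ((A * (1 - J)) ^ n) (A (h - J h)) =
    ((A * (1 - J)) ^ n) (A ((h - J h) - J (h - J h)))
  rw [hJ, interp_eq_zero (H.fst_sub_interp h) (H.snd_sub_interp h), sub_zero]

theorem exists_norm_reduced_pow_lt (H : IsAbsorbed A ℓ₁ ℓ₂ u v) :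
    ∃ k, k ≠ 0 ∧ ‖(A * (1 - interp ℓ₁ ℓ₂ u v)) ^ k‖ < 1 := by
  set J := interp ℓ₁ ℓ₂ u v with hJ
  have hpos : 0 < 2 * (‖1 - J‖ + 1) := by positivity
  -- The kernel has to be contracted strongly enough to outweigh the norm of the projection `1 - J`;
  -- the resulting norm is at most one half.
  obtain ⟨k, hk, hc⟩ := H.contract (2 * (‖1 - J‖ + 1))⁻¹ (inv_pos.2 hpos)
  refine ⟨k, hk, lt_of_le_of_lt (b := (1 / 2 : ℝ)) ?_ (by norm_num)⟩
  refine ContinuousLinearMap.opNorm_le_bound _ (by norm_num) fun h => ?_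
  obtain ⟨n, rfl⟩ := Nat.exists_eq_succ_of_ne_zero hk
  rw [Nat.succ_eq_add_one, hJ, H.reduced_pow_succ, ← hJ]
  refine (hc _ (H.fst_sub_interp h) (H.snd_sub_interp h)).trans ?_
  have h1 : ‖h - J h‖ ≤ (‖1 - J‖ + 1) * ‖h‖ :=
    ((1 - J).le_opNorm h).trans (mul_le_mul_of_nonneg_right (by linarith) (norm_nonneg h))
  refine (mul_le_mul_of_nonneg_left h1 (inv_pos.2 hpos).le).trans (le_of_eq ?_)
  have : ‖1 - J‖ + 1 ≠ 0 := by positivity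
  field_simp

theorem isUnit_one_sub [CompleteSpace E] (H : IsAbsorbed A ℓ₁ ℓ₂ u v) :
    IsUnit (1 - A * (1 - interp ℓ₁ ℓ₂ u v)) := by
  obtain ⟨k, -, hk⟩ := H.exists_norm_reduced_pow_lt
  exact isUnit_one_sub_of_norm_pow_lt_one hk

/-- For `u + g` to be fixed one needs `g - A g = A u - u`. On the common kernel `A` agrees with the
reduced operator `A * (1 - J)`, and `1` minus the latter is invertible on the whole space. The
solution lies in the kernel because both functionals vanish on `A u - u` and on the range of the
reduced operator. -/
theorem exists_fixedVec_eq [CompleteSpace E] (H : IsAbsorbed A ℓ₁ ℓ₂ u v) :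
    ∃ g, fixedVec A ℓ₁ ℓ₂ u v = u + g ∧ ℓ₁ g = 0 ∧ ℓ₂ g = 0 ∧ g - A g = A u - u := by
  set N := A * (1 - interp ℓ₁ ℓ₂ u v) with hN
  set g := Ring.inverse (1 - N) (A u - u) with hg
  have h1 : g - N g = A u - u := by
    have := congrArg (fun B : E →L[𝕜] E => B (A u - u)) (Ring.mul_inverse_cancel _ H.isUnit_one_sub)
    simpa [← hN, mul_apply_eq_comp, ← hg] using this
  have hNg : N g = A (g - interp ℓ₁ ℓ₂ u v g) := rfl
  have e : g = N g + (A u - u) := by rw [← h1]; abel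
  have h2 : ℓ₁ g = 0 := by
    rw [e, map_add, map_sub, H.fst_map, sub_self, hNg, H.fst_map, H.fst_sub_interp, add_zero]
  have h3 : ℓ₂ g = 0 := by
    rw [e, map_add, map_sub, H.snd_map, sub_self, hNg, H.snd_map, H.snd_sub_interp, add_zero]
  refine ⟨g, rfl, h2, h3, ?_⟩
  rw [hNg, interp_eq_zero h2 h3, sub_zero] at h1
  exact h1

theorem fst_fixedVec [CompleteSpace E] (H : IsAbsorbed A ℓ₁ ℓ₂ u v) :
    ℓ₁ (fixedVec A ℓ₁ ℓ₂ u v) = 1 := by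
  obtain ⟨g, e, h1, h2, h3⟩ := H.exists_fixedVec_eq
  rw [e, map_add, H.fst_u, h1, add_zero]

theorem snd_fixedVec [CompleteSpace E] (H : IsAbsorbed A ℓ₁ ℓ₂ u v) :
    ℓ₂ (fixedVec A ℓ₁ ℓ₂ u v) = 0 := by
  obtain ⟨g, e, h1, h2, h3⟩ := H.exists_fixedVec_eq
  rw [e, map_add, H.snd_u, h2, add_zero]

theorem map_fixedVec [CompleteSpace E] (H : IsAbsorbed A ℓ₁ ℓ₂ u v) :
    A (fixedVec A ℓ₁ ℓ₂ u v) = fixedVec A ℓ₁ ℓ₂ u v := by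
  obtain ⟨g, e, h1, h2, h3⟩ := H.exists_fixedVec_eq
  rw [e, map_add]
  have : A u + A g - (u + g) = (A u - u) - (g - A g) := by abel
  rw [← sub_eq_zero, this, h3, sub_self]

/-- The contraction does not involve `u`. With the fixed vector in place of `u`, the interpolation
operator becomes a projection onto fixed vectors. -/
theorem replace_u [CompleteSpace E] (H : IsAbsorbed A ℓ₁ ℓ₂ u v) :
    IsAbsorbed A ℓ₁ ℓ₂ (fixedVec A ℓ₁ ℓ₂ u v) v :=
  { H with fst_u := H.fst_fixedVec, snd_u := H.snd_fixedVec }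

theorem pow_interp_fixedVec [CompleteSpace E] (H : IsAbsorbed A ℓ₁ ℓ₂ u v) (n : ℕ) (h : E) :
    (A ^ n) (interp ℓ₁ ℓ₂ (fixedVec A ℓ₁ ℓ₂ u v) v h) =
      interp ℓ₁ ℓ₂ (fixedVec A ℓ₁ ℓ₂ u v) v h := by
  induction n with
  | zero => simp
  | succ n ih =>
    rw [pow_succ', mul_apply_eq_comp, ih, interp_apply, map_add, map_smul, map_smul,
      H.map_fixedVec, H.map_v]

/-- With `J` the projection onto fixed vectors, `A ^ n - J` equals `A ^ n * (1 - J)`, and on the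
range of `1 - J` the powers of `A` are those of the reduced operator. -/
theorem exists_norm_pow_sub_le [CompleteSpace E] (H : IsAbsorbed A ℓ₁ ℓ₂ u v) :
    ∃ C r : ℝ, 0 ≤ r ∧ r < 1 ∧ ∀ (h : E) (n : ℕ),
      ‖(A ^ n) h - interp ℓ₁ ℓ₂ (fixedVec A ℓ₁ ℓ₂ u v) v h‖ ≤ C * r ^ n * ‖h‖ := by
  set T := fixedVec A ℓ₁ ℓ₂ u v
  have HT : IsAbsorbed A ℓ₁ ℓ₂ T v := H.replace_u
  set J := interp ℓ₁ ℓ₂ T v with hJ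
  obtain ⟨k, hk, hk1⟩ := HT.exists_norm_reduced_pow_lt
  obtain ⟨C, r, hC, hr0, hr1, hb⟩ := exists_norm_pow_le hk hk1
  refine ⟨C * ‖1 - J‖, r, hr0, hr1, fun h n => ?_⟩
  have e : (A ^ n) h - J h = ((A * (1 - J)) ^ n) (h - J h) := by
    rw [HT.reduced_pow_apply n (HT.fst_sub_interp h) (HT.snd_sub_interp h), map_sub,
      H.pow_interp_fixedVec]
  rw [e]
  calc _ ≤ ‖(A * (1 - J)) ^ n‖ * ‖h - J h‖ := ContinuousLinearMap.le_opNorm _ _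
    _ ≤ (C * r ^ n) * (‖1 - J‖ * ‖h‖) :=
        mul_le_mul (hb n) ((1 - J).le_opNorm h) (norm_nonneg _) (mul_nonneg hC (pow_nonneg hr0 n))
    _ = _ := by ring

end IsAbsorbed

/-- The projection `J` satisfies `A * J = J * A = J`, so `B = A - J` annihilates `J` on both sides
and `B ^ (n + 1) = A ^ (n + 1) - J` decays exponentially. The factorization `z - A = (z - B) * (1 -
z⁻¹ • J)` then leaves only 1 outside a smaller disc. -/
theorem IsAbsorbed.hasSpectralGap {E : Type*} [NormedAddCommGroup E] [NormedSpace ℂ E]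
    [CompleteSpace E] {A : E →L[ℂ] E} {ℓ₁ ℓ₂ : E →L[ℂ] ℂ} {u v : E}
    (H : IsAbsorbed A ℓ₁ ℓ₂ u v) : HasSpectralGap A := by
  have hv : v ≠ 0 := fun h => by simpa [h] using H.fst_v
  obtain ⟨C, r, hr0, hr1, hb⟩ := H.exists_norm_pow_sub_le
  set T := fixedVec A ℓ₁ ℓ₂ u v
  have HT : IsAbsorbed A ℓ₁ ℓ₂ T v := H.replace_u
  set J := interp ℓ₁ ℓ₂ T v with hJ
  have hAJ : A * J = J := ContinuousLinearMap.ext fun h => by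
    simpa using H.pow_interp_fixedVec 1 h
  have hJA : J * A = J := ContinuousLinearMap.ext fun h => by
    rw [mul_apply_eq_comp, hJ, interp_apply, interp_apply, H.fst_map, H.snd_map]
  have hJJ : J * J = J := ContinuousLinearMap.ext fun h => by
    have h1 := HT.fst_sub_interp h
    have h2 := HT.snd_sub_interp h
    have h3 := IsAbsorbed.interp_eq_zero (u := T) (v := v) h1 h2
    rw [← hJ, map_sub, sub_eq_zero] at h3
    exact h3.symm
  set B := A - J with hB
  have hBJ : B * J = 0 := by rw [hB, sub_mul, hAJ, hJJ, sub_self]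
  have hJB : J * B = 0 := by rw [hB, mul_sub, hJA, hJJ, sub_self]
  have hAn : ∀ n, A ^ n * J = J := fun n => by
    induction n with
    | zero => simp
    | succ n ih => rw [pow_succ, mul_assoc, hAJ, ih]
  have hBn : ∀ n, B ^ (n + 1) = A ^ (n + 1) - J := fun n => by
    induction n with
    | zero => simp [hB]
    | succ n ih =>
      rw [pow_succ, ih, sub_mul, hJB, sub_zero, hB, mul_sub, hAn, ← pow_succ]
  have hspec : spectrum ℂ B ⊆ Metric.closedBall 0 r := by
    intro z hz
    rw [mem_closedBall_zero_iff]
    by_contra! hzr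
    have hC : ∀ n : ℕ, ‖z‖ ^ (n + 1) ≤ |C| * r ^ (n + 1) * ‖(1 : E →L[ℂ] E)‖ := fun n => by
      have h1 := spectrum.norm_le_norm_mul_of_mem (spectrum.pow_mem_pow B (n + 1) hz)
      rw [norm_pow] at h1
      refine h1.trans (mul_le_mul_of_nonneg_right ?_ (norm_nonneg _))
      refine ContinuousLinearMap.opNorm_le_bound _
        (mul_nonneg (abs_nonneg _) (pow_nonneg hr0 _)) fun h => ?_
      rw [hBn]
      refine (hb h (n + 1)).trans ?_
      rw [mul_assoc, mul_assoc]
      exact mul_le_mul_of_nonneg_right (le_abs_self C)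
        (mul_nonneg (pow_nonneg hr0 _) (norm_nonneg _))
    have hzpos : 0 < ‖z‖ := hr0.trans_lt hzr
    have hlim : Tendsto (fun n : ℕ => |C| * ‖(1 : E →L[ℂ] E)‖ * (r / ‖z‖) ^ (n + 1)) atTop
        (𝓝 (|C| * ‖(1 : E →L[ℂ] E)‖ * 0)) :=
      ((tendsto_add_atTop_iff_nat 1).2 (tendsto_pow_atTop_nhds_zero_of_lt_one
        (div_nonneg hr0 hzpos.le) ((div_lt_one hzpos).2 hzr))).const_mul _
    rw [mul_zero] at hlim
    -- A spectral value with `‖z‖ > r` would bound the null sequence of multiples of `(r / ‖z‖) ^ (n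
    -- + 1)` below by 1.
    refine absurd (ge_of_tendsto' hlim (b := 1) fun n => ?_) (by norm_num)
    rw [div_pow, ← mul_div_assoc, le_div_iff₀ (pow_pos hzpos _), one_mul]
    exact (hC n).trans (le_of_eq (by ring))
  refine ⟨{1}, finite_singleton 1, ?_, (1 + r) / 2, by linarith, ?_⟩
  · rintro z rfl
    refine ⟨norm_one, Module.End.hasEigenvalue_of_hasEigenvector (x := v) ⟨?_, hv⟩⟩
    rw [Module.End.mem_eigenspace_iff, one_smul]
    exact H.map_v
  · intro z hz
    by_contra hn
    simp only [mem_union, mem_singleton_iff, mem_ball_zero_iff, not_or, not_lt] at hn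
    obtain ⟨hz1, hzr⟩ := hn
    have hz0 : z ≠ 0 := by
      rintro rfl
      rw [norm_zero] at hzr
      linarith
    have hzB : z ∉ spectrum ℂ B := fun h => by
      have := mem_closedBall_zero_iff.1 (hspec h)
      linarith
    rw [spectrum.notMem_iff] at hzB
    refine hz ?_
    have e : algebraMap ℂ (E →L[ℂ] E) z - A =
        (algebraMap ℂ (E →L[ℂ] E) z - B) * (1 - z⁻¹ • J) := by
      rw [mul_sub, mul_one, sub_mul, mul_smul_comm, mul_smul_comm, hBJ, smul_zero, sub_zero,
        Algebra.algebraMap_eq_smul_one, smul_mul_assoc, one_mul, smul_smul, inv_mul_cancel₀ hz0,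
        one_smul, hB]
      abel
    change IsUnit (algebraMap ℂ (E →L[ℂ] E) z - A)
    rw [e]
    refine hzB.mul ?_
    have hz1' : z - 1 ≠ 0 := sub_ne_zero.2 hz1
    have mulJ : ∀ a b : ℂ, (1 + a • J) * (1 + b • J) = 1 + (a + b + a * b) • J := fun a b => by
      simp only [add_mul, mul_add, one_mul, mul_one, smul_mul_smul_comm, hJJ, add_smul]
      abel
    rw [sub_eq_add_neg, ← neg_smul]
    -- Since `J` is idempotent, `1 - z⁻¹ • J` has the inverse `1 + (z - 1)⁻¹ • J`.
    refine ⟨⟨1 + -z⁻¹ • J, 1 + (z - 1)⁻¹ • J, ?_, ?_⟩, rfl⟩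
    · rw [mulJ, show -z⁻¹ + (z - 1)⁻¹ + -z⁻¹ * (z - 1)⁻¹ = 0 by field_simp; ring, zero_smul,
        add_zero]
    · rw [mulJ, show (z - 1)⁻¹ + -z⁻¹ + (z - 1)⁻¹ * -z⁻¹ = 0 by field_simp; ring, zero_smul,
        add_zero]

theorem analyticAt_fixedVec {P : Type*} [NormedAddCommGroup P] [NormedSpace 𝕜 P]
    [CompleteSpace E] {A : P → E →L[𝕜] E} {ℓ₁ ℓ₂ : E →L[𝕜] 𝕜} {u v : E} {p : P}
    (hA : AnalyticAt 𝕜 A p) (H : IsAbsorbed (A p) ℓ₁ ℓ₂ u v) :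
    AnalyticAt 𝕜 (fun q => fixedVec (A q) ℓ₁ ℓ₂ u v) p := by
  obtain ⟨z, hz⟩ := H.isUnit_one_sub
  have h1 : AnalyticAt 𝕜 (fun q => 1 - A q * (1 - interp ℓ₁ ℓ₂ u v)) p :=
    analyticAt_const.sub (hA.mul analyticAt_const)
  have h2 : AnalyticAt 𝕜 (fun q => Ring.inverse (1 - A q * (1 - interp ℓ₁ ℓ₂ u v))) p := by
    have h3 := analyticAt_inverse (𝕜 := 𝕜) z
    rw [hz] at h3
    exact AnalyticAt.comp (f := fun q => 1 - A q * (1 - interp ℓ₁ ℓ₂ u v)) h3 h1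
  have h4 : AnalyticAt 𝕜 (fun q => A q u - u) p :=
    ((ContinuousLinearMap.apply 𝕜 E u).analyticAt _ |>.comp hA).sub analyticAt_const
  exact analyticAt_const.add
    (((ContinuousLinearMap.id 𝕜 (E →L[𝕜] E)).analyticAt_bilinear _).comp (h2.prod h4))

end Absorbed

/-! ## The extended maps -/

theorem extend_coe (g : ℝ → ℝ) (x : ℝ) : extend g (x : EReal) = (g x : EReal) := rfl

theorem extend_top (g : ℝ → ℝ) : extend g ⊤ = ⊤ := rfl

theorem extend_bot (g : ℝ → ℝ) : extend g ⊥ = ⊥ := rfl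

theorem monotone_extend {g : ℝ → ℝ} (hg : Monotone g) : Monotone (extend g) := by
  intro x y hxy
  induction x with
  | bot => exact bot_le
  | top => rw [top_le_iff.1 hxy]
  | coe x =>
    induction y with
    | bot => exact absurd (le_bot_iff.1 hxy) (EReal.coe_ne_bot x)
    | top => exact le_top
    | coe y => exact EReal.coe_le_coe_iff.2 (hg (EReal.coe_le_coe_iff.1 hxy))

theorem surjective_extend {g : ℝ → ℝ} (hg : Function.Surjective g) :
    Function.Surjective (extend g) := by
  intro y
  induction y with
  | bot => exact ⟨⊥, rfl⟩
  | top => exact ⟨⊤, rfl⟩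
  | coe y =>
    obtain ⟨x, rfl⟩ := hg y
    exact ⟨x, rfl⟩

theorem continuous_extend {g : ℝ → ℝ} (hg : Monotone g) (hs : Function.Surjective g) :
    Continuous (extend g) :=
  (monotone_extend hg).continuous_of_surjective (surjective_extend hs)

theorem eventually_nhds_coe_coe {z : ℝ} {P : EReal × EReal → Prop} :
    (∀ᶠ q in 𝓝 ((z : EReal), (z : EReal)), P q) ↔
      ∀ᶠ q : ℝ × ℝ in 𝓝 (z, z), P ((q.1 : EReal), (q.2 : EReal)) := by
  rw [EReal.nhds_coe_coe, eventually_map]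

/-- The constant depends on the interval only, not on `g`. Applied to the composition along a long
word, the comparison of `d` with the Euclidean metric is therefore paid once and not at every
letter. The interval is enlarged by one so that nearby points and their images remain in the compact
set. -/
theorem LineMetric.exists_coe_comparison (m : LineMetric) (a b : ℝ) : ∃ C : ℝ, 0 < C ∧
    ∀ (g : ℝ → ℝ) (z g' c : ℝ), z ∈ Icc a b → g z ∈ Icc a b → HasStrictDerivAt g g' z →
      |g'| < c → ∀ᶠ q : ℝ × ℝ in 𝓝 (z, z),
        m.d (g q.1 : EReal) (g q.2 : EReal) ≤ C * c * m.d (q.1 : EReal) (q.2 : EReal) := by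
  obtain ⟨C, hC, hK⟩ := m.strongly_equiv (Icc (a - 1) (b + 1)) isCompact_Icc
  refine ⟨C * C, mul_pos hC hC, fun g z g' c hz hgz hg hc => ?_⟩
  have hc0 : 0 < c := (abs_nonneg _).trans_lt hc
  obtain ⟨s, hs, hL⟩ := hg.hasStrictFDerivAt.exists_lipschitzOnWith_of_nnnorm_lt c.toNNReal (by
    rw [← NNReal.coe_lt_coe, coe_nnnorm, Real.coe_toNNReal c hc0.le]
    simpa using hc)
  have hn : ∀ t ∈ Icc a b, Icc (a - 1) (b + 1) ∈ 𝓝 t := fun t ht =>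
    Icc_mem_nhds (by linarith [ht.1]) (by linarith [ht.2])
  have h1 : ∀ᶠ x in 𝓝 z, x ∈ s ∧ x ∈ Icc (a - 1) (b + 1) ∧ g x ∈ Icc (a - 1) (b + 1) :=
    (eventually_mem_set.2 hs).and ((eventually_mem_set.2 (hn z hz)).and
      (hg.hasDerivAt.continuousAt.eventually (eventually_mem_set.2 (hn _ hgz))))
  rw [nhds_prod_eq]
  filter_upwards [h1.prod_mk h1] with q hq
  obtain ⟨⟨h2, h3, h4⟩, h5, h6, h7⟩ := hq
  have h8 := hL.dist_le_mul _ h2 _ h5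
  rw [Real.dist_eq, Real.dist_eq, Real.coe_toNNReal c hc0.le] at h8
  have h9 := (hK _ h3 _ h6).1
  rw [inv_mul_le_iff₀ hC] at h9
  calc m.d (g q.1 : EReal) (g q.2 : EReal) ≤ C * |g q.1 - g q.2| := (hK _ h4 _ h7).2
    _ ≤ C * (c * (C * m.d (q.1 : EReal) (q.2 : EReal))) := by gcongr; exact h8.trans (by gcongr)
    _ = _ := by ring

/-- Local Lipschitz bounds come from the contraction hypothesis at the infinities and from the
strict derivative at real points. Compactness of the diagonal makes them uniform for close pairs;
for distant pairs the diameter suffices. -/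
theorem LineMetric.exists_lipschitz (m : LineMetric) {g : ℝ → ℝ} (hg : ContDiff ℝ 1 g)
    {Vp Vm : Set EReal} (hVp : Vp ∈ 𝓝 ⊤) (hVm : Vm ∈ 𝓝 ⊥) {L : ℝ}
    (hp : ∀ x ∈ Vp, ∀ y ∈ Vp, m.d (extend g x) (extend g y) ≤ L * m.d x y)
    (hm : ∀ x ∈ Vm, ∀ y ∈ Vm, m.d (extend g x) (extend g y) ≤ L * m.d x y) :
    ∃ Λ : ℝ, 1 ≤ Λ ∧ ∀ x y, m.d (extend g x) (extend g y) ≤ Λ * m.d x y := by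
  have hloc : ∃ n : ℕ, ∀ᶠ q in 𝓝ˢ (diagonal EReal),
      m.d (extend g q.1) (extend g q.2) ≤ n * m.d q.1 q.2 := by
    refine isClosed_diagonal.isCompact.exists_nat_eventually_nhdsSet
      (P := fun n q => m.d (extend g q.1) (extend g q.2) ≤ n * m.d q.1 q.2)
      (fun k n q hkn h => h.trans (mul_le_mul_of_nonneg_right (by exact_mod_cast hkn)
        (m.d_nonneg _ _))) ?_
    suffices ∀ z : EReal, ∃ c : ℝ, ∀ᶠ q in 𝓝 (z, z),
        m.d (extend g q.1) (extend g q.2) ≤ c * m.d q.1 q.2 by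
      rintro ⟨z, z'⟩ hz
      obtain rfl : z = z' := hz
      obtain ⟨c, hc⟩ := this z
      obtain ⟨n, hn⟩ := exists_nat_ge c
      exact ⟨n, hc.mono fun q hq => hq.trans (mul_le_mul_of_nonneg_right hn (m.d_nonneg _ _))⟩
    intro z
    induction z with
    | bot =>
      refine ⟨L, ?_⟩
      filter_upwards [prod_mem_nhds hVm hVm] with q hq using hm _ hq.1 _ hq.2
    | top =>
      refine ⟨L, ?_⟩
      filter_upwards [prod_mem_nhds hVp hVp] with q hq using hp _ hq.1 _ hq.2
    | coe z =>
      obtain ⟨C, -, hC⟩ := m.exists_coe_comparison (min z (g z)) (max z (g z))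
      have hs : HasStrictDerivAt g (deriv g z) z :=
        hg.contDiffAt.hasStrictDerivAt (by norm_num)
      have h1 := hC g z (deriv g z) (|deriv g z| + 1) ⟨min_le_left _ _, le_max_left _ _⟩
        ⟨min_le_right _ _, le_max_right _ _⟩ hs (by linarith)
      exact ⟨_, eventually_nhds_coe_coe.2 h1⟩
  obtain ⟨n, hn⟩ := hloc
  obtain ⟨η, hη, hηn⟩ := m.exists_pos_of_eventually_nhdsSet_diagonal hn
  obtain ⟨Δ, hΔ1, hΔ⟩ := m.exists_d_le
  refine ⟨max 1 (max n (Δ / η)), le_max_left _ _, fun x y => ?_⟩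
  rcases lt_or_ge (m.d x y) η with h | h
  · exact (hηn x y h).trans (mul_le_mul_of_nonneg_right
      ((le_max_left _ _).trans (le_max_right _ _)) (m.d_nonneg _ _))
  · have h1 : Δ / η ≤ max 1 (max (n : ℝ) (Δ / η)) := (le_max_right _ _).trans (le_max_right _ _)
    have h2 : 0 ≤ Δ / η := div_nonneg (by linarith) hη.le
    calc m.d (extend g x) (extend g y) ≤ Δ / η * η := by
          rw [div_mul_cancel₀ _ hη.ne']
          exact hΔ _ _
      _ ≤ _ := mul_le_mul h1 h hη.le (h2.trans h1)

/-! ## The absorbing neighbourhood of infinity -/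

/-- The neighbourhood `[-∞, -R) ∪ (R, +∞]` of infinity. -/
def outer (R : ℝ) : Set EReal := {x | (R : EReal) < x ∨ x < ((-R : ℝ) : EReal)}

theorem isOpen_outer (R : ℝ) : IsOpen (outer R) :=
  (isOpen_lt continuous_const continuous_id).union (isOpen_lt continuous_id continuous_const)

theorem coe_notMem_outer {R x : ℝ} : (x : EReal) ∉ outer R ↔ |x| ≤ R := by
  simp only [outer, mem_ofPred_eq, not_or, not_lt, EReal.coe_le_coe_iff, abs_le]
  exact and_comm

theorem exists_coe_eq_of_notMem_outer {R : ℝ} {x : EReal} (hx : x ∉ outer R) :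
    ∃ y : ℝ, x = y ∧ |y| ≤ R := by
  induction x with
  | bot => exact absurd (Or.inr (EReal.bot_lt_coe _)) hx
  | top => exact absurd (Or.inl (EReal.coe_lt_top _)) hx
  | coe x => exact ⟨x, rfl, coe_notMem_outer.1 hx⟩

/-- The properties of the family of maps that the proof depends on: the extended maps are
`Λ`-Lipschitz, expand Euclidean distances by the factor `lam`, and preserve and contract `outer R`. -/
structure IsAbsorbing {ι : Type*} (m : LineMetric) (f : ι → ℝ → ℝ) (lam Λ R κ : ℝ) : Prop where
  one_lt_lam : 1 < lam
  one_le_Λ : 1 ≤ Λ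
  R_nonneg : 0 ≤ R
  κ_nonneg : 0 ≤ κ
  κ_lt_one : κ < 1
  continuous_extend : ∀ i, Continuous (extend (f i))
  lipschitz : ∀ i x y, m.d (extend (f i) x) (extend (f i) y) ≤ Λ * m.d x y
  expand : ∀ i x y, lam * |x - y| ≤ |f i x - f i y|
  gt_map : ∀ i (x : EReal), (R : EReal) < x → (R : EReal) < extend (f i) x
  map_lt : ∀ i (x : EReal), x < ((-R : ℝ) : EReal) → extend (f i) x < ((-R : ℝ) : EReal)
  add_one_le : ∀ i (x : ℝ), R < x → x + 1 ≤ f i x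
  le_sub_one : ∀ i (x : ℝ), x < -R → f i x ≤ x - 1
  contract : ∀ᶠ q in 𝓝ˢ (diagonal EReal), q.1 ∈ outer R →
    ∀ i, m.d (extend (f i) q.1) (extend (f i) q.2) ≤ κ * m.d q.1 q.2
  contract_top : ∀ i (x : EReal), (R : EReal) < x → m.d (extend (f i) x) ⊤ ≤ κ * m.d x ⊤
  contract_bot : ∀ i (x : EReal), x < ((-R : ℝ) : EReal) → m.d (extend (f i) x) ⊥ ≤ κ * m.d x ⊥

theorem exists_isAbsorbing {ι : Type*} [Fintype ι] {m : LineMetric} {f : ι → ℝ → ℝ} {ε : ℝ}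
    (hdiff : ∀ i, IsHolderDiffeo ε (f i)) (hexp : IsExpanding f)
    (hcontr : IsContractingNearInfinity m f) :
    ∃ lam Λ R κ : ℝ, IsAbsorbing m f lam Λ R κ := by
  obtain ⟨lam, hlam, hl⟩ := hexp
  obtain ⟨Vp, hVp, Vm, hVm, hV⟩ := hcontr
  choose L hL1 hLp hLm using hV
  have hdf : ∀ i, Differentiable ℝ (f i) := fun i => (hdiff i).contDiff.differentiable (by norm_num)
  have hsurj : ∀ i, Function.Surjective (f i) := fun i => by
    obtain ⟨k, -, hk, -⟩ := (hdiff i).inverse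
    exact hk.surjective
  have hmono : ∀ i, StrictMono (f i) := fun i => strictMono_of_deriv_pos fun x => by
    linarith [hl i x]
  have hgrow : ∀ i x y, y ≤ x → lam * (x - y) ≤ f i x - f i y := fun i x y h =>
    mul_sub_le_image_sub_of_le_deriv (hdf i) (hl i) h
  choose Λ hΛ1 hΛ using fun i => m.exists_lipschitz (hdiff i).contDiff hVp hVm (hLp i) (hLm i)
  -- The largest of the finitely many Lipschitz constants; inserting 0 makes it nonnegative.
  obtain ⟨κ, hκ0, hκ1, hκ⟩ : ∃ κ : ℝ, 0 ≤ κ ∧ κ < 1 ∧ ∀ i, L i ≤ κ := by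
    have hfin : (insert (0 : ℝ) (range L)).Finite := (finite_range L).insert 0
    obtain ⟨κ, hκm, hκ⟩ := hfin.exists_maximal (insert_nonempty _ _)
    have hle : ∀ t ∈ insert (0 : ℝ) (range L), t ≤ κ := fun t ht => by
      by_contra! h
      exact absurd (hκ ht h.le) (not_le.2 h)
    refine ⟨κ, hle 0 (mem_insert _ _), ?_, fun i => hle _ (mem_insert_of_mem _ ⟨i, rfl⟩)⟩
    rcases hκm with rfl | ⟨i, rfl⟩
    · exact one_pos
    · exact hL1 i
  obtain ⟨a, ha⟩ := EReal.mem_nhds_top_iff.1 hVp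
  obtain ⟨b, hb⟩ := EReal.mem_nhds_bot_iff.1 hVm
  set M := ∑ i, |f i 0| with hM
  have hMi : ∀ i, |f i 0| ≤ M := fun i =>
    Finset.single_le_sum (f := fun i => |f i 0|) (fun _ _ => abs_nonneg _) (Finset.mem_univ i)
  have hM0 : 0 ≤ M := Finset.sum_nonneg fun _ _ => abs_nonneg _
  have hlam' : 0 < lam - 1 := by linarith
  set R0 := max |a| |b| with hR0
  -- The first term puts `outer R` strictly inside the contraction region beyond `R0`; the second
  -- makes `lam * x - M ≥ x + 1` for `x > R`, so every map moves points outward by at least one.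
  set R := max (R0 + 1) ((1 + M) / (lam - 1)) with hR
  have hR00 : 0 ≤ R0 := (abs_nonneg a).trans (le_max_left _ _)
  have hRR0 : R0 + 1 ≤ R := le_max_left _ _
  have hRM : 1 + M ≤ R * (lam - 1) := by
    rw [← div_le_iff₀ hlam']
    exact le_max_right _ _
  have hRnn : 0 ≤ R := by linarith
  have hsetp : {x : EReal | (R0 : EReal) < x} ⊆ Vp := fun x hx => ha
    (lt_of_le_of_lt (EReal.coe_le_coe_iff.2 ((le_abs_self a).trans (le_max_left _ _))) hx)
  have hsetm : {x : EReal | x < ((-R0 : ℝ) : EReal)} ⊆ Vm := fun x hx => hb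
    (lt_of_lt_of_le hx (EReal.coe_le_coe_iff.2 (by
      have := neg_abs_le b
      have : |b| ≤ R0 := le_max_right _ _
      linarith)))
  have hadd : ∀ i (x : ℝ), R < x → x + 1 ≤ f i x := fun i x hx => by
    have h1 := hgrow i x 0 (by linarith)
    have h2 := neg_abs_le (f i 0)
    have h3 := mul_le_mul_of_nonneg_right hx.le hlam'.le
    have h4 : lam * (x - 0) = x + x * (lam - 1) := by ring
    linarith [hMi i]
  have hsub : ∀ i (x : ℝ), x < -R → f i x ≤ x - 1 := fun i x hx => by
    have h1 := hgrow i 0 x (by linarith)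
    have h2 := le_abs_self (f i 0)
    have h3 : R * (lam - 1) ≤ -x * (lam - 1) := mul_le_mul_of_nonneg_right (by linarith) hlam'.le
    have h4 : lam * (0 - x) = -x + -x * (lam - 1) := by ring
    linarith [hMi i]
  have hRlt : (R0 : EReal) < (R : EReal) := EReal.coe_lt_coe_iff.2 (by linarith)
  have hRlt' : ((-R : ℝ) : EReal) < ((-R0 : ℝ) : EReal) := EReal.coe_lt_coe_iff.2 (by linarith)
  have hcp : ∀ i (x y : EReal), (R0 : EReal) < x → (R0 : EReal) < y →
      m.d (extend (f i) x) (extend (f i) y) ≤ κ * m.d x y := fun i x y hx hy =>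
    (hLp i x (hsetp hx) y (hsetp hy)).trans (mul_le_mul_of_nonneg_right (hκ i) (m.d_nonneg _ _))
  have hcm : ∀ i (x y : EReal), x < ((-R0 : ℝ) : EReal) → y < ((-R0 : ℝ) : EReal) →
      m.d (extend (f i) x) (extend (f i) y) ≤ κ * m.d x y := fun i x y hx hy =>
    (hLm i x (hsetm hx) y (hsetm hy)).trans (mul_le_mul_of_nonneg_right (hκ i) (m.d_nonneg _ _))
  refine ⟨lam, 1 + ∑ i, Λ i, R, κ, ?_⟩
  refine
    { one_lt_lam := hlam
      one_le_Λ := by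
        have : 0 ≤ ∑ i, Λ i := Finset.sum_nonneg fun i _ => zero_le_one.trans (hΛ1 i)
        linarith
      R_nonneg := hRnn
      κ_nonneg := hκ0
      κ_lt_one := hκ1
      continuous_extend := fun i => RandomLine.continuous_extend (hmono i).monotone (hsurj i)
      lipschitz := fun i x y => (hΛ i x y).trans (mul_le_mul_of_nonneg_right ?_ (m.d_nonneg _ _))
      expand := fun i => expanding_dist (hdf i) (hl i)
      gt_map := fun i x hx => ?_
      map_lt := fun i x hx => ?_
      add_one_le := hadd
      le_sub_one := hsub
      contract := ?_
      contract_top := fun i x hx => by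
        simpa [extend_top] using hcp i x ⊤ (hRlt.trans hx) (EReal.coe_lt_top _)
      contract_bot := fun i x hx => by
        simpa [extend_bot] using hcm i x ⊥ (hx.trans hRlt') (EReal.bot_lt_coe _) }
  · have := Finset.single_le_sum (f := Λ) (fun j _ => zero_le_one.trans (hΛ1 j)) (Finset.mem_univ i)
    linarith
  · induction x with
    | bot => exact absurd hx not_lt_bot
    | top => exact hx
    | coe x =>
      rw [EReal.coe_lt_coe_iff] at hx
      rw [extend_coe, EReal.coe_lt_coe_iff]
      linarith [hadd i x hx]
  · induction x with
    | bot => exact hx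
    | top => exact absurd hx not_top_lt
    | coe x =>
      rw [EReal.coe_lt_coe_iff] at hx
      rw [extend_coe, EReal.coe_lt_coe_iff]
      linarith [hsub i x hx]
  -- A diagonal point beyond `R0` has a neighbourhood in the contraction region; at any other point
  -- the strict inequality `R0 < R` keeps nearby first coordinates out of `outer R`.
  · rw [eventually_nhdsSet_iff_forall]
    rintro ⟨z, z'⟩ hz
    obtain rfl : z = z' := hz
    rw [nhds_prod_eq]
    rcases lt_or_ge (R0 : EReal) z with h | h
    · have h1 := eventually_gt_nhds h
      filter_upwards [h1.prod_mk h1] with q hq _ i using hcp i _ _ hq.1 hq.2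
    rcases lt_or_ge z ((-R0 : ℝ) : EReal) with h' | h'
    · have h1 := eventually_lt_nhds h'
      filter_upwards [h1.prod_mk h1] with q hq _ i using hcm i _ _ hq.1 hq.2
    have h1 := (eventually_lt_nhds (h.trans_lt hRlt)).and (eventually_gt_nhds (hRlt'.trans_le h'))
    filter_upwards [h1.prod_mk h1] with q hq hq1
    rcases hq1 with h2 | h2
    · exact absurd hq.1.1 (not_lt.2 h2.le)
    · exact absurd hq.1.2 (not_lt.2 h2.le)

/-! ## Escape to infinity -/

/-- The points all of whose images under words of length `n` lie outside `outer R`. -/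
def trapped {ι : Type*} (f : ι → ℝ → ℝ) (R : ℝ) : ℕ → Set EReal
  | 0 => (outer R)ᶜ
  | n + 1 => ⋂ i, extend (f i) ⁻¹' trapped f R n

namespace IsAbsorbing

variable {ι : Type*} {m : LineMetric} {f : ι → ℝ → ℝ} {lam Λ R κ : ℝ}

theorem mapsTo_outer (H : IsAbsorbing m f lam Λ R κ) (i : ι) {x : EReal} (hx : x ∈ outer R) :
    extend (f i) x ∈ outer R :=
  hx.imp (H.gt_map i x) (H.map_lt i x)

/-- Otherwise the nested compact sets `trapped f R n` share a point. Their intersection is forward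
invariant and bounded, so by expansion it has only one point, which would be a common fixed point.
-/
theorem exists_trapped_eq_empty [Nonempty ι] (H : IsAbsorbing m f lam Λ R κ)
    (hfix : HasNoCommonFixedPoint f) : ∃ N, N ≠ 0 ∧ trapped f R N = ∅ := by
  have hsucc : ∀ n, trapped f R (n + 1) ⊆ trapped f R n := by
    intro n
    induction n with
    | zero =>
      intro x hx hx'
      exact mem_iInter.1 hx (Classical.arbitrary ι) (H.mapsTo_outer _ hx')
    | succ n ih =>
      intro x hx
      exact mem_iInter.2 fun i => ih (mem_iInter.1 hx i)
  have hclosed : ∀ n, IsClosed (trapped f R n) := by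
    intro n
    induction n with
    | zero => exact (isOpen_outer R).isClosed_compl
    | succ n ih => exact isClosed_iInter fun i => ih.preimage (H.continuous_extend i)
  by_contra! hne
  have hne' : ∀ n, (trapped f R n).Nonempty := fun n =>
    (hne (n + 1) n.succ_ne_zero).mono (hsucc n)
  obtain ⟨x, hx⟩ := IsCompact.nonempty_iInter_of_sequence_nonempty_isCompact_isClosed
    (trapped f R) hsucc hne' (hclosed 0).isCompact hclosed
  have hmap : ∀ y : EReal, y ∈ ⋂ n, trapped f R n → ∀ i, extend (f i) y ∈ ⋂ n, trapped f R n :=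
    fun y hy i => mem_iInter.2 fun n => mem_iInter.1 (mem_iInter.1 hy (n + 1)) i
  obtain ⟨x, rfl, -⟩ := exists_coe_eq_of_notMem_outer (mem_iInter.1 hx 0)
  have hbound : ∀ y : ℝ, (y : EReal) ∈ ⋂ n, trapped f R n → |y| ≤ R := fun y hy =>
    coe_notMem_outer.1 (mem_iInter.1 hy 0)
  refine hfix ⟨x, fun i => ?_⟩
  have key : ∀ n (y z : ℝ), (y : EReal) ∈ ⋂ n, trapped f R n →
      (z : EReal) ∈ ⋂ n, trapped f R n → lam ^ n * |y - z| ≤ 2 * R := by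
    intro n
    induction n with
    | zero =>
      intro y z hy hz
      have h1 := abs_le.1 (hbound y hy)
      have h2 := abs_le.1 (hbound z hz)
      rw [pow_zero, one_mul, abs_le]
      constructor <;> linarith
    | succ n ih =>
      intro y z hy hz
      refine le_trans ?_ (ih (f i y) (f i z) (hmap y hy i) (hmap z hz i))
      rw [pow_succ, mul_assoc]
      exact mul_le_mul_of_nonneg_left (H.expand i y z)
        (pow_nonneg (zero_le_one.trans H.one_lt_lam.le) n)
  by_contra hne
  have hpos : 0 < |f i x - x| := abs_pos.2 (sub_ne_zero.2 hne)
  obtain ⟨n, hn⟩ := pow_unbounded_of_one_lt (2 * R / |f i x - x|) H.one_lt_lam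
  rw [div_lt_iff₀ hpos] at hn
  linarith [key n (f i x) x (hmap x hx i) hx]

/-- The mass which has not escaped after `n` steps. -/
theorem avg_pow_indicator_le [Fintype ι] {w : ι → ℝ} (hw1 : ∑ i, w i = 1) {q : ℝ} (hq : 0 < q)
    (hwq : ∀ i, q ≤ w i) (n : ℕ) {x : EReal} (hx : x ∉ trapped f R n) :
    (avg w (fun i => extend (f i)) ^ n) ((outer R)ᶜ.indicator 1) x ≤ 1 - q ^ n := by
  classical
  have hw : ∀ i, 0 ≤ w i := fun i => hq.le.trans (hwq i)
  induction n generalizing x with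
  | zero => simp [trapped] at hx; simp [hx]
  | succ n ih =>
    obtain ⟨j, hj⟩ : ∃ j, extend (f j) x ∉ trapped f R n := by
      by_contra! h
      exact hx (mem_iInter.2 h)
    have hle : ∀ y, (avg w (fun i => extend (f i)) ^ n) ((outer R)ᶜ.indicator 1) y ≤ 1 := by
      intro y
      have h1 := avg_pow_mono hw (F := fun i => extend (f i)) (G := (outer R)ᶜ.indicator 1)
        (H := fun _ => 1) (fun z => indicator_le_self' (fun _ _ => zero_le_one) z) n y
      rwa [avg_pow_const hw1] at h1
    rw [avg_pow_succ_apply]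
    -- Only the letter `j`, which leads out of `trapped f R n`, is used to gain; its weight is at
    -- least `q`.
    calc _ ≤ ∑ i, w i * (1 - if i = j then q ^ n else 0) := by
          refine Finset.sum_le_sum fun i _ => mul_le_mul_of_nonneg_left ?_ (hw i)
          split_ifs with h
          · subst h
            exact ih hj
          · simpa using hle _
      _ = 1 - w j * q ^ n := by
          simp [mul_sub, Finset.sum_sub_distrib, hw1]
      _ ≤ 1 - q ^ (n + 1) := by
          have := mul_le_mul_of_nonneg_right (hwq j) (pow_nonneg hq.le n)
          rw [pow_succ']
          linarith

theorem exists_escape [Fintype ι] [Nonempty ι] (H : IsAbsorbing m f lam Λ R κ)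
    (hfix : HasNoCommonFixedPoint f) {w : ι → ℝ} (hw : ∀ i, 0 < w i) (hw1 : ∑ i, w i = 1) :
    ∃ N, N ≠ 0 ∧ ∃ θ : ℝ, 0 ≤ θ ∧ θ < 1 ∧
      ∀ x, (avg w (fun i => extend (f i)) ^ N) ((outer R)ᶜ.indicator 1) x ≤ θ := by
  obtain ⟨N, hN, hemp⟩ := H.exists_trapped_eq_empty hfix
  obtain ⟨j, hj⟩ := Finite.exists_min w
  have hw1' : w j ≤ 1 := by
    rw [← hw1]
    exact Finset.single_le_sum (fun i _ => (hw i).le) (Finset.mem_univ j)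
  refine ⟨N, hN, 1 - w j ^ N, sub_nonneg.2 (pow_le_one₀ (hw j).le hw1'), ?_, fun x =>
    avg_pow_indicator_le hw1 (hw j) hj N (by simp [hemp])⟩
  linarith [pow_pos (hw j) N]

end IsAbsorbing

/-! ## Contraction of the transition operator on functions vanishing at infinity -/

/-- The diagonal action on pairs of points. -/
def pairMap {ι : Type*} (f : ι → ℝ → ℝ) (i : ι) : EReal × EReal → EReal × EReal :=
  Prod.map (extend (f i)) (extend (f i))

/-- The power `d(x, y)^α` of the distance of a pair of points. -/
def LineMetric.dpow (m : LineMetric) (α : ℝ) (q : EReal × EReal) : ℝ := m.d q.1 q.2 ^ α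

theorem LineMetric.dpow_nonneg (m : LineMetric) (α : ℝ) (q : EReal × EReal) : 0 ≤ m.dpow α q :=
  Real.rpow_nonneg (m.d_nonneg _ _) α

/-- On nearby pairs the averaged `α`-th power of the distance, restricted to the paths which have
not yet entered `outer R`, is eventually contracted. -/
def IsMeanContracting {ι : Type*} [Fintype ι] (m : LineMetric) (f : ι → ℝ → ℝ) (w : ι → ℝ)
    (R α : ℝ) : Prop :=
  ∃ N, N ≠ 0 ∧ ∃ θ : ℝ, 0 ≤ θ ∧ θ < 1 ∧ ∀ᶠ q in 𝓝ˢ (diagonal EReal),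
    (avg w (pairMap f) ^ N) ((Prod.fst ⁻¹' outer R)ᶜ.indicator (m.dpow α)) q ≤ θ * m.dpow α q

/-- Reduces real and complex iterates to real averages. It is applied to the values of the iterates
at points and to their differences at pairs of points. -/
theorem norm_le_avg_pow {ι X 𝕜 : Type*} [Fintype ι] [RCLike 𝕜] {w : ι → ℝ} (hw : ∀ i, 0 ≤ w i)
    {F : ι → X → X} {φ : ℕ → X → 𝕜} (hφ : ∀ n x, φ (n + 1) x = ∑ i, (w i : 𝕜) * φ n (F i x))
    {G : X → ℝ} (h0 : ∀ x, ‖φ 0 x‖ ≤ G x) (n : ℕ) (x : X) : ‖φ n x‖ ≤ (avg w F ^ n) G x := by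
  induction n generalizing x with
  | zero => simpa using h0 x
  | succ n ih =>
    rw [hφ, avg_pow_succ_apply]
    refine (norm_sum_le _ _).trans (Finset.sum_le_sum fun i _ => ?_)
    rw [norm_mul, RCLike.norm_ofReal, abs_of_nonneg (hw i)]
    exact mul_le_mul_of_nonneg_left (ih _) (hw i)

namespace IsAbsorbing

variable {ι : Type*} {m : LineMetric} {f : ι → ℝ → ℝ} {lam Λ R κ α : ℝ} {w : ι → ℝ}

theorem dpow_pairMap_le (H : IsAbsorbing m f lam Λ R κ) (hα : 0 < α) (i : ι) (q : EReal × EReal) :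
    m.dpow α (pairMap f i q) ≤ Λ ^ α * m.dpow α q := by
  unfold LineMetric.dpow
  rw [← Real.mul_rpow (zero_le_one.trans H.one_le_Λ) (m.d_nonneg _ _)]
  exact Real.rpow_le_rpow (m.d_nonneg _ _) (H.lipschitz i _ _) hα.le

theorem tendsto_pairMap (H : IsAbsorbing m f lam Λ R κ) (i : ι) :
    Tendsto (pairMap f i) (𝓝ˢ (diagonal EReal)) (𝓝ˢ (diagonal EReal)) :=
  tendsto_prodMap_nhdsSet_diagonal (H.continuous_extend i)

variable [Fintype ι]

theorem avg_pow_dpow_le (H : IsAbsorbing m f lam Λ R κ) (hα : 0 < α) (hw : ∀ i, 0 ≤ w i)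
    (hw1 : ∑ i, w i = 1) (n : ℕ) (q : EReal × EReal) :
    (avg w (pairMap f) ^ n) (m.dpow α) q ≤ (Λ ^ α) ^ n * m.dpow α q :=
  avg_pow_le_pow_smul hw hw1 (Real.rpow_nonneg (zero_le_one.trans H.one_le_Λ) α)
    (H.dpow_pairMap_le hα) n q

/-- An instance of `exists_avg_pow_le` on pairs, with `W` the pairs whose first point is absorbed:
there close pairs contract by `κ ^ α`, and mean contraction controls the rest. -/
theorem exists_avg_pow_dpow_le (H : IsAbsorbing m f lam Λ R κ) (hα : 0 < α) (hw : ∀ i, 0 ≤ w i)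
    (hw1 : ∑ i, w i = 1) (hmc : IsMeanContracting m f w R α) {e : ℝ} (he : 0 < e) :
    ∃ n, n ≠ 0 ∧ ∀ᶠ q in 𝓝ˢ (diagonal EReal),
      (avg w (pairMap f) ^ n) (m.dpow α) q ≤ e * m.dpow α q := by
  obtain ⟨N, hN, θ, hθ0, hθ1, hθ⟩ := hmc
  refine exists_avg_pow_le hw hw1 H.tendsto_pairMap (m.dpow_nonneg α) (m.dpow_nonneg α)
    (W := Prod.fst ⁻¹' outer R) (Real.rpow_nonneg H.κ_nonneg α)
    (Real.rpow_lt_one H.κ_nonneg H.κ_lt_one hα) ?_ hN hθ0 hθ1 hθ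
    (pow_nonneg (Real.rpow_nonneg (zero_le_one.trans H.one_le_Λ) α) N)
    (Eventually.of_forall (H.avg_pow_dpow_le hα hw hw1 N)) (C' := 1)
    (Eventually.of_forall fun q => (one_mul _).ge) he
  filter_upwards [H.contract] with q hq hq1 i
  refine ⟨H.mapsTo_outer i hq1, ?_⟩
  unfold LineMetric.dpow
  rw [← Real.mul_rpow H.κ_nonneg (m.d_nonneg _ _)]
  exact Real.rpow_le_rpow (m.d_nonneg _ _) (hq hq1 i) hα.le

/-- The averaged distance to infinity becomes uniformly small. -/
theorem exists_avg_pow_dist_le [Nonempty ι] (H : IsAbsorbing m f lam Λ R κ)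
    (hfix : HasNoCommonFixedPoint f) (hα : 0 < α) (hw : ∀ i, 0 < w i) (hw1 : ∑ i, w i = 1)
    {e : ℝ} (he : 0 < e) :
    ∃ n, ∀ x, (avg w (fun i => extend (f i)) ^ n)
      (fun x => if 0 ≤ x then m.d x ⊤ ^ α else m.d x ⊥ ^ α) x ≤ e := by
  obtain ⟨N, hN, θ, hθ0, hθ1, hθ⟩ := H.exists_escape hfix hw hw1
  obtain ⟨Δ, hΔ1, hΔ⟩ := m.exists_d_le
  have hΔ0 : 0 ≤ Δ ^ α := Real.rpow_nonneg (zero_le_one.trans hΔ1) α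
  have hw0 : ∀ i, 0 ≤ w i := fun i => (hw i).le
  have hle : ∀ x y, m.d x y ^ α ≤ Δ ^ α := fun x y =>
    Real.rpow_le_rpow (m.d_nonneg _ _) (hΔ x y) hα.le
  -- On `outer R` the maps preserve the side of zero, so the same infinity serves before and after a
  -- step and `G` contracts by `κ ^ α`.
  set G : EReal → ℝ := fun x => if 0 ≤ x then m.d x ⊤ ^ α else m.d x ⊥ ^ α with hG
  have hGle : ∀ x, G x ≤ Δ ^ α := fun x => by
    simp only [hG]
    split_ifs <;> exact hle _ _
  have hR : (0 : EReal) ≤ R := by exact_mod_cast H.R_nonneg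
  have hR' : ((-R : ℝ) : EReal) ≤ 0 := by
    have := H.R_nonneg
    exact_mod_cast (by linarith : -R ≤ 0)
  have hGW : ∀ x ∈ outer R, ∀ i, G (extend (f i) x) ≤ κ ^ α * G x := by
    rintro x (h | h) i <;> simp only [hG]
    · rw [if_pos (hR.trans h.le), if_pos (hR.trans (H.gt_map i x h).le),
        ← Real.mul_rpow H.κ_nonneg (m.d_nonneg _ _)]
      exact Real.rpow_le_rpow (m.d_nonneg _ _) (H.contract_top i x h) hα.le
    · rw [if_neg (not_le.2 (h.trans_le hR')), if_neg (not_le.2 ((H.map_lt i x h).trans_le hR')),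
        ← Real.mul_rpow H.κ_nonneg (m.d_nonneg _ _)]
      exact Real.rpow_le_rpow (m.d_nonneg _ _) (H.contract_bot i x h) hα.le
  obtain ⟨n, -, hn⟩ := exists_avg_pow_le (F := fun i => extend (f i)) hw0 hw1 (l := ⊤)
    (fun i => tendsto_top) (D := G) (B := 1) (fun x => by
      simp only [hG]
      split_ifs <;> exact Real.rpow_nonneg (m.d_nonneg _ _) _) (fun _ => zero_le_one)
    (W := outer R) (Real.rpow_nonneg H.κ_nonneg α)
    (Real.rpow_lt_one H.κ_nonneg H.κ_lt_one hα) (eventually_top.2 fun x hx i =>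
      ⟨H.mapsTo_outer i hx, hGW x hx i⟩) hN hθ0 hθ1
    (eventually_top.2 fun x => by simpa using hθ x) (C := Δ ^ α) hΔ0
    (eventually_top.2 fun x => by
      have := avg_pow_mono hw0 (F := fun i => extend (f i)) hGle N x
      rw [avg_pow_const hw1] at this
      simpa using this) (C' := Δ ^ α)
    (eventually_top.2 fun x => by simpa using hGle x) he
  exact ⟨n, fun x => by simpa using eventually_top.1 hn x⟩

/-! ### The Doeblin–Fortet estimate for the transition operator -/

variable {𝕜 : Type*} [RCLike 𝕜] {A : HolderSpace m α 𝕜 →L[𝕜] HolderSpace m α 𝕜}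

theorem _root_.RandomLine.pow_succ_apply_of_isAvg
    (hA : ∀ h x, (A h) x = ∑ i, (w i : 𝕜) * h (extend (f i) x))
    (n : ℕ) (h : HolderSpace m α 𝕜) (x : EReal) :
    ((A ^ (n + 1)) h) x = ∑ i, (w i : 𝕜) * ((A ^ n) h) (extend (f i) x) := by
  rw [pow_succ', mul_apply_eq_comp, hA]

theorem _root_.RandomLine.norm_pow_apply_sub_le (hw : ∀ i, 0 ≤ w i)
    (hA : ∀ h x, (A h) x = ∑ i, (w i : 𝕜) * h (extend (f i) x))
    (n : ℕ) (h : HolderSpace m α 𝕜) (q : EReal × EReal) :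
    ‖((A ^ n) h) q.1 - ((A ^ n) h) q.2‖ ≤
      HolderSpace.variation h * (avg w (pairMap f) ^ n) (m.dpow α) q := by
  have h1 := norm_le_avg_pow hw (F := pairMap f) (G := HolderSpace.variation h • m.dpow α)
    (φ := fun n q => ((A ^ n) h) q.1 - ((A ^ n) h) q.2) (fun n q => by
      rw [pow_succ_apply_of_isAvg hA, pow_succ_apply_of_isAvg hA, ← Finset.sum_sub_distrib]
      exact Finset.sum_congr rfl fun i _ => (mul_sub _ _ _).symm)
    (fun q => HolderSpace.norm_sub_le h q.1 q.2) n q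
  rwa [map_smul] at h1

/-- The Hölder constant after `n` steps is at most half the old one plus a multiple of the sup norm:
close pairs use mean contraction, pairs at distance at least `η` use the sup norm. For functions
vanishing at the infinities the sup norm is bounded by the averaged distance to infinity, hence
becomes small, and iterating the inequality makes the Hölder constant small too. -/
theorem contract_kernel [Nonempty ι] (H : IsAbsorbing m f lam Λ R κ)
    (hfix : HasNoCommonFixedPoint f) (hα : 0 < α) (hw : ∀ i, 0 < w i) (hw1 : ∑ i, w i = 1)
    (hmc : IsMeanContracting m f w R α)
    (hA : ∀ h x, (A h) x = ∑ i, (w i : 𝕜) * h (extend (f i) x)) {e : ℝ} (he : 0 < e) :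
    ∃ k : ℕ, k ≠ 0 ∧ ∀ h : HolderSpace m α 𝕜, h ⊤ = 0 → h ⊥ = 0 → ‖(A ^ k) h‖ ≤ e * ‖h‖ := by
  have hw0 : ∀ i, 0 ≤ w i := fun i => (hw i).le
  obtain ⟨n, hn, hnear⟩ := H.exists_avg_pow_dpow_le hα hw0 hw1 hmc (e := 1 / 2) (by norm_num)
  obtain ⟨η, hη, hηn⟩ := m.exists_pos_of_eventually_nhdsSet_diagonal hnear
  have hηα : 0 < η ^ α := Real.rpow_pos_of_pos hη α
  set c := 2 / η ^ α with hc
  have hc0 : 0 < c := div_pos two_pos hηα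
  obtain ⟨Δ, hΔ1, hΔ⟩ := m.exists_d_le
  have hΔ0 : 0 ≤ Δ ^ α := Real.rpow_nonneg (zero_le_one.trans hΔ1) α
  -- The inequality has the limiting value `2 * c * δ`; together with the sup norm bound `δ` this
  -- uses up `e / 2`.
  set δ := e / (2 * (2 * c + 1)) with hδ
  have hδ0 : 0 < δ := by positivity
  obtain ⟨j, hj⟩ := H.exists_avg_pow_dist_le hfix hα hw hw1 hδ0
  set G : EReal → ℝ := fun x => if 0 ≤ x then m.d x ⊤ ^ α else m.d x ⊥ ^ α with hG
  set C := 1 + 2 * c * Δ ^ α with hC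
  have hC0 : 0 < C := by positivity
  obtain ⟨l, hl⟩ := exists_pow_lt_of_lt_one (show 0 < e / (2 * C) by positivity)
    (show (1 / 2 : ℝ) < 1 by norm_num)
  -- The first `j + 1` blocks make the sup norm small while the Hölder constant stays below `C * v`;
  -- the last `l` halve it down to `e / 2`.
  refine ⟨n * (j + 1 + l), mul_ne_zero hn (by omega), fun h h1 h2 => ?_⟩
  set v := HolderSpace.variation h with hv
  have hv0 : 0 ≤ v := HolderSpace.variation_nonneg h
  have sup : ∀ k x, ‖((A ^ k) h) x‖ ≤ v * (avg w (fun i => extend (f i)) ^ k) G x := by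
    intro k x
    have h3 := norm_le_avg_pow hw0 (F := fun i => extend (f i)) (G := v • G)
      (φ := fun n x => ((A ^ n) h) x) (fun n x => pow_succ_apply_of_isAvg hA n h x)
      (fun x => by
        simp only [Pi.smul_apply, smul_eq_mul, hG]
        have h4 := HolderSpace.norm_sub_le h x ⊤
        have h5 := HolderSpace.norm_sub_le h x ⊥
        rw [h1, sub_zero] at h4
        rw [h2, sub_zero] at h5
        split_ifs
        · exact h4
        · exact h5) k x
    rwa [map_smul] at h3
  have supΔ : ∀ k x, ‖((A ^ k) h) x‖ ≤ v * Δ ^ α := fun k x => by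
    refine (sup k x).trans (mul_le_mul_of_nonneg_left ?_ hv0)
    have h3 := avg_pow_mono hw0 (F := fun i => extend (f i)) (G := G) (H := fun _ => Δ ^ α)
      (fun y => by
        simp only [hG]
        split_ifs <;> exact Real.rpow_le_rpow (m.d_nonneg _ _) (hΔ _ _) hα.le) k x
    rwa [avg_pow_const hw1] at h3
  have supδ : ∀ k ≥ j, ∀ x, ‖((A ^ k) h) x‖ ≤ v * δ := fun k hk x => by
    refine (sup k x).trans (mul_le_mul_of_nonneg_left ?_ hv0)
    obtain ⟨i, rfl⟩ := Nat.exists_eq_add_of_le' hk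
    have h3 := avg_pow_mono hw0 (F := fun i => extend (f i)) (H := fun _ => δ) hj i x
    rwa [avg_pow_const hw1, ← avg_pow_add_apply] at h3
  have step : ∀ (g : HolderSpace m α 𝕜) (S : ℝ), 0 ≤ S → (∀ x, ‖((A ^ n) g) x‖ ≤ S) →
      HolderSpace.variation ((A ^ n) g) ≤ 1 / 2 * HolderSpace.variation g + c * S := by
    intro g S hS0 hS
    have hg0 := HolderSpace.variation_nonneg g
    refine HolderSpace.variation_le (by positivity) fun x y => ?_
    have hd0 : 0 ≤ m.d x y ^ α := Real.rpow_nonneg (m.d_nonneg _ _) α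
    rcases lt_or_ge (m.d x y) η with hxy | hxy
    · have h3 := norm_pow_apply_sub_le hw0 hA n g (x, y)
      have h4 := mul_le_mul_of_nonneg_left (hηn x y hxy) hg0
      have h5 : 0 ≤ c * S * m.d x y ^ α := by positivity
      have h6 : m.dpow α (x, y) = m.d x y ^ α := rfl
      rw [h6] at h4
      calc _ ≤ _ := h3.trans h4
        _ ≤ _ := by linarith
    · have h3 : η ^ α ≤ m.d x y ^ α := Real.rpow_le_rpow hη.le hxy hα.le
      have h4 : 2 * S = c * S * η ^ α := by
        rw [hc]
        field_simp
      have h5 : c * S * η ^ α ≤ c * S * m.d x y ^ α := mul_le_mul_of_nonneg_left h3 (by positivity)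
      have h6 : 0 ≤ 1 / 2 * HolderSpace.variation g * m.d x y ^ α := by positivity
      have h7 := _root_.norm_sub_le (((A ^ n) g) x) (((A ^ n) g) y)
      linarith [hS x, hS y]
  have hsucc : ∀ k, (A ^ (n * (k + 1))) h = (A ^ n) ((A ^ (n * k)) h) := fun k => by
    rw [mul_add, mul_one, add_comm, pow_add, mul_apply_eq_comp]
  have bound : ∀ k, HolderSpace.variation ((A ^ (n * k)) h) ≤ C * v := by
    intro k
    induction k with
    | zero =>
      have : 0 ≤ 2 * c * Δ ^ α * v := by positivity
      simp only [mul_zero, pow_zero, one_apply_eq_self]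
      rw [hC, add_mul, one_mul]
      linarith
    | succ k ih =>
      have h3 := step ((A ^ (n * k)) h) (v * Δ ^ α) (by positivity) fun x => by
        rw [← hsucc]
        exact supΔ _ x
      rw [hsucc]
      refine h3.trans ?_
      rw [hC] at ih ⊢
      calc _ ≤ 1 / 2 * ((1 + 2 * c * Δ ^ α) * v) + c * (v * Δ ^ α) := by linarith
        _ = (1 / 2 + 2 * c * Δ ^ α) * v := by ring
        _ ≤ _ := mul_le_mul_of_nonneg_right (by linarith) hv0
  have decay : ∀ i, HolderSpace.variation ((A ^ (n * (j + 1 + i))) h) ≤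
      ((1 / 2) ^ i * C + 2 * c * δ) * v := by
    intro i
    induction i with
    | zero =>
      refine (bound _).trans (mul_le_mul_of_nonneg_right ?_ hv0)
      have : 0 ≤ 2 * c * δ := by positivity
      simpa using this
    | succ i ih =>
      have hge : j ≤ n * (j + 1 + i + 1) := by
        have := Nat.le_mul_of_pos_left (j + 1 + i + 1) (Nat.pos_of_ne_zero hn)
        omega
      have h3 := step ((A ^ (n * (j + 1 + i))) h) (v * δ) (by positivity) fun x => by
        rw [← hsucc]
        exact supδ _ hge x
      rw [← add_assoc, hsucc]
      refine h3.trans ?_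
      calc _ ≤ 1 / 2 * (((1 / 2) ^ i * C + 2 * c * δ) * v) + c * (v * δ) := by linarith
        _ = _ := by ring
  have hge : j ≤ n * (j + 1 + l) := by
    have := Nat.le_mul_of_pos_left (j + 1 + l) (Nat.pos_of_ne_zero hn)
    omega
  rw [HolderSpace.norm_eq]
  have h3 : ‖HolderSpace.toCont ((A ^ (n * (j + 1 + l))) h)‖ ≤ v * δ :=
    (ContinuousMap.norm_le _ (by positivity)).2 (supδ _ hge)
  have h4 : (1 / 2) ^ l * C ≤ e / 2 := by
    rw [lt_div_iff₀ (by positivity)] at hl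
    linarith
  have h5 : (2 * c + 1) * δ = e / 2 := by
    rw [hδ]
    have : 2 * c + 1 ≠ 0 := by positivity
    field_simp
  have h6 : ((1 / 2) ^ l * C + 2 * c * δ) * v + v * δ ≤ e * v := by
    rw [mul_comm v δ, ← add_mul]
    exact mul_le_mul_of_nonneg_right (by linarith) hv0
  have h7 := mul_le_mul_of_nonneg_left (HolderSpace.variation_le_norm h) he.le
  linarith [decay l]

theorem isAbsorbed [Nonempty ι] (H : IsAbsorbing m f lam Λ R κ)
    (hfix : HasNoCommonFixedPoint f) (hα : 0 < α) (hw : ∀ i, 0 < w i) (hw1 : ∑ i, w i = 1)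
    (hmc : IsMeanContracting m f w R α)
    (hA : ∀ h x, (A h) x = ∑ i, (w i : 𝕜) * h (extend (f i) x)) {u : HolderSpace m α 𝕜}
    (hu1 : u ⊤ = 1) (hu2 : u ⊥ = 0) :
    IsAbsorbed A (HolderSpace.evalCLM ⊤) (HolderSpace.evalCLM ⊥) u 1 where
  fst_u := hu1
  snd_u := hu2
  fst_v := rfl
  snd_v := rfl
  fst_map h := by
    simp only [HolderSpace.evalCLM_apply, hA, extend_top, ← Finset.sum_mul]
    rw [← RCLike.ofReal_sum, hw1, RCLike.ofReal_one, one_mul]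
  snd_map h := by
    simp only [HolderSpace.evalCLM_apply, hA, extend_bot, ← Finset.sum_mul]
    rw [← RCLike.ofReal_sum, hw1, RCLike.ofReal_one, one_mul]
  map_v := HolderSpace.ext fun x => by
    rw [hA]
    simp only [HolderSpace.one_apply, mul_one]
    rw [← RCLike.ofReal_sum, hw1, RCLike.ofReal_one]
  contract e he := H.contract_kernel hfix hα hw hw1 hmc hA he

end IsAbsorbing

/-! ## The random orbit -/

theorem orbit_congr {ι X : Type*} (F : ι → X → X) {ω τ : ℕ → ι} {n : ℕ} (h : ∀ k < n, ω k = τ k)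
    (x : X) : orbit F ω n x = orbit F τ n x := by
  induction n with
  | zero => rfl
  | succ n ih =>
    change F (ω n) (orbit F ω n x) = F (τ n) (orbit F τ n x)
    rw [ih fun k hk => h k (hk.trans n.lt_succ_self), h n n.lt_succ_self]

/-! ### Expectations along the random orbit -/

section Bernoulli

variable {s : ℕ} {p : EuclideanSpace ℝ (Fin s)} (hp : p ∈ params s)

instance : IsProbabilityMeasure (bernoulli p hp) := by
  unfold bernoulli
  infer_instance

theorem bernoulli_real_letter (n : ℕ) (i : Fin (s + 1)) :
    (bernoulli p hp).real {ω | ω n = i} = weight p i := by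
  have h1 : (bernoulli p hp).map (fun ω => ω n) = (letterLaw p hp).toMeasure :=
    Measure.infinitePi_map_eval _ n
  have h2 : (bernoulli p hp) {ω | ω n = i} = (letterLaw p hp).toMeasure {i} := by
    rw [← h1, Measure.map_apply (measurable_pi_apply n) (measurableSet_singleton i)]
    rfl
  rw [measureReal_def, h2, PMF.toMeasure_apply_singleton _ _ (measurableSet_singleton i)]
  exact ENNReal.toReal_ofReal (weight_pos hp i).le

variable {X : Type*} (F : Fin (s + 1) → X → X)

/-- The orbit up to time `n` is a function of finitely many letters from a finite alphabet. Hence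
any function of it is measurable and bounded, without any structure on `X`; the letter 0 is mere
padding. -/
theorem exists_eq_comp_restrict (n : ℕ) (x : X) :
    ∃ ψ : ({k // k ∈ Finset.range n} → Fin (s + 1)) → X,
      ∀ ω, orbit F ω n x = ψ fun k => ω k := by
  refine ⟨fun v => orbit F (fun k => if h : k ∈ Finset.range n then v ⟨k, h⟩ else 0) n x,
    fun ω => orbit_congr F (fun k hk => ?_) x⟩
  rw [dif_pos (Finset.mem_range.2 hk)]

theorem measurable_comp_orbit {Y : Type*} [MeasurableSpace Y] (g : X → Y) (n : ℕ) (x : X) :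
    Measurable fun ω : ℕ → Fin (s + 1) => g (orbit F ω n x) := by
  obtain ⟨ψ, hψ⟩ := exists_eq_comp_restrict F n x
  simp only [hψ]
  exact (measurable_of_countable (g ∘ ψ)).comp
    (measurable_pi_lambda _ fun k => measurable_pi_apply (k : ℕ))

theorem measurableSet_orbit_mem (S : Set X) (n : ℕ) (x : X) :
    MeasurableSet {ω : ℕ → Fin (s + 1) | orbit F ω n x ∈ S} :=
  measurableSet_setOfPred.2 (measurable_comp_orbit F (fun y => y ∈ S) n x)

theorem exists_norm_comp_orbit_le (g : X → ℝ) (n : ℕ) (x : X) :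
    ∃ C, ∀ ω : ℕ → Fin (s + 1), ‖g (orbit F ω n x)‖ ≤ C := by
  obtain ⟨ψ, hψ⟩ := exists_eq_comp_restrict F n x
  obtain ⟨C, hC⟩ := (finite_range fun v => ‖g (ψ v)‖).bddAbove
  exact ⟨C, fun ω => by
    rw [hψ]
    exact hC ⟨_, rfl⟩⟩

theorem integrable_comp_orbit (g : X → ℝ) (n : ℕ) (x : X) :
    Integrable (fun ω => g (orbit F ω n x)) (bernoulli p hp) := by
  obtain ⟨C, hC⟩ := exists_norm_comp_orbit_le F g n x
  exact Integrable.of_bound (measurable_comp_orbit F g n x).aestronglyMeasurable C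
    (Eventually.of_forall hC)

/-- The orbit at time `n` involves the letters with index below `n` and is independent of letter
`n`, the next one applied. -/
theorem integral_letter_mul_comp_orbit (g : X → ℝ) (n : ℕ) (x : X) (i : Fin (s + 1)) :
    ∫ ω : ℕ → Fin (s + 1), (if ω n = i then 1 else 0) * g (orbit F ω n x) ∂bernoulli p hp =
      weight p i * ∫ ω, g (orbit F ω n x) ∂bernoulli p hp := by
  obtain ⟨ψ, hψ⟩ := exists_eq_comp_restrict F n x
  have hind : ProbabilityTheory.iIndepFun (fun (k : ℕ) (ω : ℕ → Fin (s + 1)) => ω k)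
      (bernoulli p hp) :=
    ProbabilityTheory.iIndepFun_infinitePi (X := fun _ a => a) fun _ => measurable_id
  have h1 := hind.indepFun_finset {n} (Finset.range n) (by simp) fun k => measurable_pi_apply k
  have h2 := h1.comp (φ := fun v : {k // k ∈ ({n} : Finset ℕ)} → Fin (s + 1) =>
      if v ⟨n, Finset.mem_singleton_self n⟩ = i then (1 : ℝ) else 0)
    (ψ := g ∘ ψ) (measurable_of_countable _) (measurable_of_countable _)
  have hm : MeasurableSet {ω : ℕ → Fin (s + 1) | ω n = i} :=
    (show Measurable fun ω : ℕ → Fin (s + 1) => ω n from measurable_pi_apply n)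
      (measurableSet_singleton i)
  have e1 : (fun ω : ℕ → Fin (s + 1) => if ω n = i then (1 : ℝ) else 0) =
      {ω : ℕ → Fin (s + 1) | ω n = i}.indicator 1 := by
    funext ω
    by_cases h : ω n = i
    · rw [indicator_of_mem (by exact h), if_pos h, Pi.one_apply]
    · rw [indicator_of_notMem (by exact h), if_neg h]
  have e2 : ((g ∘ ψ) ∘ fun (ω : ℕ → Fin (s + 1)) (k : {k // k ∈ Finset.range n}) => ω k) =
      fun ω => g (orbit F ω n x) := by
    funext ω
    simp [hψ]
  rw [e2] at h2
  change ProbabilityTheory.IndepFun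
    (fun ω : ℕ → Fin (s + 1) => if ω n = i then (1 : ℝ) else 0) _ _ at h2
  rw [h2.integral_fun_mul_eq_mul_integral
    (by rw [e1]; exact (measurable_one.indicator hm).aestronglyMeasurable)
    (measurable_comp_orbit F g n x).aestronglyMeasurable, e1, integral_indicator_one hm,
    bernoulli_real_letter]

/-- Conditioning on the last letter replaces `g` by its average at the previous time, so the
induction must run over all `g`. -/
theorem integral_comp_orbit (g : X → ℝ) (n : ℕ) (x : X) :
    ∫ ω, g (orbit F ω n x) ∂bernoulli p hp = (avg (weight p) F ^ n) g x := by
  induction n generalizing g with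
  | zero => simp [orbit]
  | succ n ih =>
    have e : ∀ ω : ℕ → Fin (s + 1), g (orbit F ω (n + 1) x) =
        ∑ i, (if ω n = i then 1 else 0) * g (F i (orbit F ω n x)) := by
      intro ω
      rw [Finset.sum_eq_single (ω n) (fun i _ hi => by rw [if_neg (Ne.symm hi), zero_mul])
        (by simp), if_pos rfl, one_mul]
      rfl
    have hint : ∀ i, Integrable (fun ω : ℕ → Fin (s + 1) => (if ω n = i then 1 else 0) *
        g (F i (orbit F ω n x))) (bernoulli p hp) := fun i => by
      have h1 := (integrable_comp_orbit hp F (fun y => g (F i y)) n x).indicator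
        (measurable_pi_apply n (measurableSet_singleton i))
      refine h1.congr (Eventually.of_forall fun ω => ?_)
      by_cases h : ω n = i <;> simp [h]
    simp only [e]
    rw [integral_finsetSum _ fun i _ => hint i, pow_succ, Module.End.mul_apply, ← ih]
    simp only [avg_apply]
    rw [integral_finsetSum _ fun i _ =>
      (integrable_comp_orbit hp F (fun y => g (F i y)) n x).const_mul _]
    refine Finset.sum_congr rfl fun i _ => ?_
    rw [integral_letter_mul_comp_orbit hp F (fun y => g (F i y)), integral_const_mul]

end Bernoulli

/-! ### Almost sure absorption and the invariant function -/

namespace IsAbsorbing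

variable {s : ℕ} {m : LineMetric} {f : Fin (s + 1) → ℝ → ℝ} {lam Λ R κ : ℝ}
  {p : EuclideanSpace ℝ (Fin s)}

theorem tendsto_orbit_top {ι : Type*} {f : ι → ℝ → ℝ} (H : IsAbsorbing m f lam Λ R κ)
    (ω : ℕ → ι) {x : EReal} (hx : (R : EReal) < x) :
    Tendsto (fun n => orbit (fun i => extend (f i)) ω n x) atTop (𝓝 ⊤) := by
  induction x with
  | bot => exact absurd hx not_lt_bot
  | top => simp [orbit_extend_top]
  | coe x =>
    rw [EReal.coe_lt_coe_iff] at hx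
    have key : ∀ n : ℕ, x + n ≤ orbit f ω n x := by
      intro n
      induction n with
      | zero => simp [orbit]
      | succ n ih =>
        have h0 : (0 : ℝ) ≤ n := n.cast_nonneg
        have := H.add_one_le (ω n) (orbit f ω n x) (by linarith)
        change x + ((n + 1 : ℕ) : ℝ) ≤ f (ω n) (orbit f ω n x)
        push_cast
        linarith
    simp only [orbit_extend_coe]
    exact EReal.tendsto_coe_nhds_top_iff.2 (tendsto_atTop_mono key
      (tendsto_atTop_add_const_left _ _ tendsto_natCast_atTop_atTop))

theorem tendsto_orbit_bot {ι : Type*} {f : ι → ℝ → ℝ} (H : IsAbsorbing m f lam Λ R κ)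
    (ω : ℕ → ι) {x : EReal} (hx : x < ((-R : ℝ) : EReal)) :
    Tendsto (fun n => orbit (fun i => extend (f i)) ω n x) atTop (𝓝 ⊥) := by
  induction x with
  | top => exact absurd hx not_top_lt
  | bot => simp [orbit_extend_bot]
  | coe x =>
    rw [EReal.coe_lt_coe_iff] at hx
    have key : ∀ n : ℕ, orbit f ω n x ≤ x - n := by
      intro n
      induction n with
      | zero => simp [orbit]
      | succ n ih =>
        have h0 : (0 : ℝ) ≤ n := n.cast_nonneg
        have := H.le_sub_one (ω n) (orbit f ω n x) (by linarith)
        change f (ω n) (orbit f ω n x) ≤ x - ((n + 1 : ℕ) : ℝ)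
        push_cast
        linarith
    simp only [orbit_extend_coe]
    exact EReal.tendsto_coe_nhds_bot_iff.2 (tendsto_atBot_mono key
      (tendsto_atBot_add_const_left _ _ (tendsto_neg_atTop_atBot.comp
        tendsto_natCast_atTop_atTop)))

theorem tendsto_orbit_of_mem_outer {ι : Type*} {f : ι → ℝ → ℝ} (H : IsAbsorbing m f lam Λ R κ)
    (ω : ℕ → ι) {x : EReal} {n : ℕ} (hn : orbit (fun i => extend (f i)) ω n x ∈ outer R) :
    Tendsto (fun n => orbit (fun i => extend (f i)) ω n x) atTop (𝓝 ⊤) ∨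
      Tendsto (fun n => orbit (fun i => extend (f i)) ω n x) atTop (𝓝 ⊥) := by
  rw [← tendsto_add_atTop_iff_nat n, ← tendsto_add_atTop_iff_nat (l := 𝓝 ⊥) n]
  simp only [add_comm _ n, orbit_add]
  exact hn.imp (H.tendsto_orbit_top _) (H.tendsto_orbit_bot _)

theorem ae_exists_orbit_mem_outer (H : IsAbsorbing m f lam Λ R κ) (hfix : HasNoCommonFixedPoint f)
    (hp : p ∈ params s) (x : EReal) :
    ∀ᵐ ω ∂bernoulli p hp, ∃ n, orbit (fun i => extend (f i)) ω n x ∈ outer R := by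
  have hw : ∀ i, 0 < weight p i := weight_pos hp
  have hw0 : ∀ i, 0 ≤ weight p i := fun i => (hw i).le
  obtain ⟨N, hN, θ, hθ0, hθ1, hθ⟩ := H.exists_escape hfix hw (sum_weight p)
  have hI0 : ∀ y, (0 : ℝ) ≤ (outer R)ᶜ.indicator (1 : EReal → ℝ) y := fun y =>
    indicator_nonneg (fun _ _ => zero_le_one) y
  have hI1 : ∀ y, (outer R)ᶜ.indicator (1 : EReal → ℝ) y ≤ 1 := fun y =>
    indicator_le_self' (fun _ _ => zero_le_one) y
  have key : (bernoulli p hp).real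
      {ω | ¬ ∃ n, orbit (fun i => extend (f i)) ω n x ∈ outer R} ≤ 0 := by
    refine le_of_forall_pos_le_add fun e he => ?_
    rw [zero_add]
    -- The contraction factor is 0 here, since the indicator of the complement vanishes on the
    -- invariant set `outer R`. The average is the probability of not being absorbed at time `n`.
    obtain ⟨n, -, hn⟩ := exists_avg_pow_le (F := fun i => extend (f i)) hw0 (sum_weight p) (l := ⊤)
      (fun i => tendsto_top) (D := (outer R)ᶜ.indicator 1) (B := 1) hI0 (fun _ => zero_le_one)
      (W := outer R) le_rfl one_pos (eventually_top.2 fun y hy i =>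
        ⟨H.mapsTo_outer i hy, by simp [H.mapsTo_outer i hy]⟩) hN hθ0 hθ1
      (eventually_top.2 fun y => by simpa using hθ y) hθ0
      (eventually_top.2 fun y => by simpa using hθ y) (C' := 1)
      (eventually_top.2 fun y => by simpa using hI1 y) he
    have h1 := eventually_top.1 hn x
    rw [← integral_comp_orbit hp, Pi.one_apply, mul_one] at h1
    refine le_trans ?_ h1
    have h2 : (fun ω => (outer R)ᶜ.indicator (1 : EReal → ℝ)
        (orbit (fun i => extend (f i)) ω n x)) =
        {ω | orbit (fun i => extend (f i)) ω n x ∈ (outer R)ᶜ}.indicator 1 := by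
      funext ω
      by_cases h : orbit (fun i => extend (f i)) ω n x ∈ (outer R)ᶜ
      · rw [indicator_of_mem h, indicator_of_mem (by exact h), Pi.one_apply, Pi.one_apply]
      · rw [indicator_of_notMem h, indicator_of_notMem (by exact h)]
    rw [h2, integral_indicator_one (measurableSet_orbit_mem _ _ n x)]
    exact measureReal_mono fun ω hω hmem => hω ⟨n, hmem⟩
  rw [ae_iff]
  exact (measureReal_eq_zero_iff).1 (le_antisymm key measureReal_nonneg)

/-- A continuous invariant function with values `1` and `0` at `+∞` and `-∞` is the probability of
tending to `+∞`. -/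
theorem eq_probInfty (H : IsAbsorbing m f lam Λ R κ) (hfix : HasNoCommonFixedPoint f)
    (hp : p ∈ params s) {T : EReal → ℝ} (hT : Continuous T) (h1 : T ⊤ = 1) (h0 : T ⊥ = 0)
    (hinv : avg (weight p) (fun i => extend (f i)) T = T) (x : EReal) :
    T x = probInfty f p hp x := by
  set E := {ω | Tendsto (fun n => orbit (fun i => extend (f i)) ω n x) atTop (𝓝 ⊤)} with hE
  have hconst : ∀ n, ∫ ω, T (orbit (fun i => extend (f i)) ω n x) ∂bernoulli p hp = T x := by
    intro n
    rw [integral_comp_orbit]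
    induction n with
    | zero => simp
    | succ n ih => rw [pow_succ, Module.End.mul_apply, hinv, ih]
  have hEm : MeasurableSet E := by
    have : E = ⋃ n, {ω | orbit (fun i => extend (f i)) ω n x ∈ {y : EReal | (R : EReal) < y}} := by
      ext ω
      simp only [mem_iUnion]
      constructor
      · intro h
        exact (h.eventually (eventually_gt_nhds (EReal.coe_lt_top R))).exists
      · rintro ⟨n, hn⟩
        rw [hE]
        change Tendsto _ _ _
        rw [← tendsto_add_atTop_iff_nat n]
        simp only [add_comm _ n, orbit_add]
        exact H.tendsto_orbit_top _ hn
    rw [this]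
    exact MeasurableSet.iUnion fun n => measurableSet_orbit_mem _ _ n x
  obtain ⟨C, hC⟩ := (isCompact_range hT.norm).bddAbove
  -- Along almost every orbit `T` tends to 1 or 0 according to the infinity reached, while its
  -- expectation remains `T x`.
  have hlim := tendsto_integral_of_dominated_convergence (μ := bernoulli p hp)
    (F := fun n ω => T (orbit (fun i => extend (f i)) ω n x)) (f := E.indicator 1) (fun _ => C)
    (fun n => (measurable_comp_orbit _ T n x).aestronglyMeasurable) (integrable_const C)
    (fun n => Eventually.of_forall fun ω => hC ⟨_, rfl⟩) (by
      filter_upwards [H.ae_exists_orbit_mem_outer hfix hp x] with ω hω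
      obtain ⟨n, hn⟩ := hω
      rcases H.tendsto_orbit_of_mem_outer ω hn with h | h
      · rw [indicator_of_mem (show ω ∈ E from h), Pi.one_apply, ← h1]
        exact (hT.tendsto _).comp h
      · rw [indicator_of_notMem, ← h0]
        · exact (hT.tendsto _).comp h
        · intro h'
          exact absurd (tendsto_nhds_unique h h') (by simp))
  rw [integral_indicator_one hEm] at hlim
  simp only [hconst] at hlim
  exact tendsto_nhds_unique tendsto_const_nhds hlim

end IsAbsorbing

/-! ## The spectral gap from mean contraction -/

theorem transition_eq_sum {s : ℕ} {m : LineMetric} {α : ℝ} {𝕜 : Type*} [RCLike 𝕜]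
    {f : Fin (s + 1) → ℝ → ℝ} {K : Fin (s + 1) → HolderSpace m α 𝕜 →L[𝕜] HolderSpace m α 𝕜}
    (hK : ∀ i h x, (K i h) x = h (extend (f i) x)) (p : EuclideanSpace ℝ (Fin s)) :
    IsTransition f p (∑ i, (weight p i : 𝕜) • K i) := by
  intro h x
  rw [_root_.sum_apply, HolderSpace.sum_apply]
  exact Finset.sum_congr rfl fun i _ => by rw [← hK]; rfl

theorem analyticAt_weight {s : ℕ} (i : Fin (s + 1)) (p : EuclideanSpace ℝ (Fin s)) :
    AnalyticAt ℝ (fun q => weight q i) p := by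
  have h : ∀ j : Fin s, AnalyticAt ℝ (fun q : EuclideanSpace ℝ (Fin s) => q j) p := fun j =>
    (EuclideanSpace.proj (𝕜 := ℝ) j).analyticAt p
  induction i using Fin.lastCases with
  | last =>
    simp only [weight, Fin.lastCases_last]
    exact analyticAt_const.sub (Finset.analyticAt_fun_sum _ fun j _ => h j)
  | cast i => simpa only [weight, Fin.lastCases_castSucc] using h i

/-- The same composition operators are taken over both fields: the complex ones for the spectrum,
the real ones for convergence and analyticity. Analyticity holds because the operator is a
combination of fixed operators with coefficients affine in the parameter. -/
theorem IsAbsorbing.spectralGapOnBall {s : ℕ} {m : LineMetric} {f : Fin (s + 1) → ℝ → ℝ}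
    {lam Λ R κ α δ : ℝ} {p₀ : EuclideanSpace ℝ (Fin s)} (H : IsAbsorbing m f lam Λ R κ)
    (hfix : HasNoCommonFixedPoint f) (hα : 0 < α) (hα1 : α ≤ 1)
    (hball : Metric.ball p₀ δ ⊆ params s)
    (hmc : ∀ p ∈ Metric.ball p₀ δ, IsMeanContracting m f (weight p) R α) :
    SpectralGapOnBall m f p₀ δ α := by
  choose K hK using fun i => HolderSpace.exists_compCLM (m := m) (𝕜 := ℝ)
    (H.continuous_extend i) hα (H.lipschitz i)
  choose K' hK' using fun i => HolderSpace.exists_compCLM (m := m) (𝕜 := ℂ)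
    (H.continuous_extend i) hα (H.lipschitz i)
  obtain ⟨u, hu1, hu0⟩ := HolderSpace.exists_top_eq_one m ℝ hα hα1
  obtain ⟨u', hu1', hu0'⟩ := HolderSpace.exists_top_eq_one m ℂ hα hα1
  have habs : ∀ p ∈ Metric.ball p₀ δ, IsAbsorbed (∑ i, (weight p i : ℝ) • K i)
      (HolderSpace.evalCLM ⊤) (HolderSpace.evalCLM ⊥) u 1 := fun p hp =>
    H.isAbsorbed hfix hα (weight_pos (hball hp)) (sum_weight p) (hmc p hp)
      (transition_eq_sum hK p) hu1 hu0
  refine ⟨hball, fun p hp => ⟨_, transition_eq_sum hK' p, ?_⟩,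
    fun p => fixedVec (∑ i, (weight p i : ℝ) • K i) (HolderSpace.evalCLM ⊤)
      (HolderSpace.evalCLM ⊥) u 1, fun p hp hp' x => ?_, fun p hp => ⟨_, transition_eq_sum hK p, ?_⟩,
    fun p hp => ?_⟩
  · exact (H.isAbsorbed hfix hα (weight_pos (hball hp)) (sum_weight p) (hmc p hp)
      (transition_eq_sum hK' p) hu1' hu0').hasSpectralGap
  · refine H.eq_probInfty hfix hp' (HolderSpace.toCont (fixedVec (∑ i, (weight p i : ℝ) • K i)
      (HolderSpace.evalCLM ⊤) (HolderSpace.evalCLM ⊥) u 1)).continuous (habs p hp).fst_fixedVec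
      (habs p hp).snd_fixedVec (funext fun y => ?_) x
    have h1 := transition_eq_sum hK p (fixedVec (∑ i, (weight p i : ℝ) • K i)
      (HolderSpace.evalCLM ⊤) (HolderSpace.evalCLM ⊥) u 1) y
    have h2 := (habs p hp).map_fixedVec
    simp only [RCLike.ofReal_real_eq_id, id_eq] at h1
    rw [h2] at h1
    exact h1.symm
  · obtain ⟨C, r, hr0, hr1, hb⟩ := (habs p hp).exists_norm_pow_sub_le
    refine ⟨C, r, hr0, hr1, fun h n => ?_⟩
    have := hb h n
    rwa [interp_apply, ← sub_sub] at this
  · exact analyticAt_fixedVec (Finset.analyticAt_fun_sum _ fun i _ =>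
      (analyticAt_weight i p).smul analyticAt_const) (habs p hp)

/-! ## Mean contraction: stability and small exponents -/

theorem mem_params_of_weight_pos {s : ℕ} {p : EuclideanSpace ℝ (Fin s)}
    (h : ∀ i, 0 < weight p i) : p ∈ params s := by
  have h1 : ∀ i : Fin s, 0 < p i := fun i => by simpa [weight] using h i.castSucc
  have h2 : ∑ i, p i < 1 := by simpa [weight] using h (Fin.last s)
  exact ⟨fun i => ⟨h1 i, (Finset.single_le_sum (fun j _ => (h1 j).le)
    (Finset.mem_univ i)).trans_lt h2⟩, h2⟩

/-- Choose `t > 1` with `t ^ N * θ < 1`; as long as no weight grows by more than the factor `t`, the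
same `N` and the same neighbourhood of the diagonal work. -/
theorem IsMeanContracting.exists_ball {s : ℕ} {m : LineMetric} {f : Fin (s + 1) → ℝ → ℝ}
    {R α : ℝ} {p₀ : EuclideanSpace ℝ (Fin s)} (hp₀ : p₀ ∈ params s)
    (h : IsMeanContracting m f (weight p₀) R α) :
    ∃ δ : ℝ, 0 < δ ∧ Metric.ball p₀ δ ⊆ params s ∧
      ∀ p ∈ Metric.ball p₀ δ, IsMeanContracting m f (weight p) R α := by
  obtain ⟨N, hN, θ, hθ0, hθ1, hθ⟩ := h
  have h1 : Tendsto (fun t : ℝ => t ^ N * θ) (𝓝[>] 1) (𝓝 (1 ^ N * θ)) :=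
    (((continuous_pow N).mul continuous_const).tendsto 1).mono_left nhdsWithin_le_nhds
  rw [one_pow, one_mul] at h1
  obtain ⟨t, ht, ht1⟩ := ((h1.eventually (gt_mem_nhds hθ1)).and self_mem_nhdsWithin).exists
  have h2 : ∀ᶠ p in 𝓝 p₀, ∀ i, 0 < weight p i ∧ weight p i < t * weight p₀ i := by
    refine eventually_all.2 fun i => ?_
    have hc := (analyticAt_weight i p₀).continuousAt
    have hpos := weight_pos hp₀ i
    exact (hc.eventually (lt_mem_nhds hpos)).and (hc.eventually (gt_mem_nhds (by nlinarith)))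
  obtain ⟨δ, hδ, hball⟩ := Metric.eventually_nhds_iff_ball.1 h2
  refine ⟨δ, hδ, fun p hp => mem_params_of_weight_pos fun i => (hball p hp i).1,
    fun p hp => ⟨N, hN, t ^ N * θ, by positivity, ht, ?_⟩⟩
  filter_upwards [hθ] with q hq
  refine (avg_pow_le_of_weight_le (fun i => (hball p hp i).1.le) (fun i => (hball p hp i).2.le)
    (fun x => indicator_nonneg (fun y _ => m.dpow_nonneg α y) x) N q).trans ?_
  rw [mul_assoc]
  exact mul_le_mul_of_nonneg_left hq (by positivity)

theorem avg_pow_eq_zero {ι X : Type*} [Fintype ι] {w : ι → ℝ} {F : ι → X → X} {G : X → ℝ}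
    {S : ℕ → Set X} (h0 : ∀ x ∈ S 0, G x = 0) (hS : ∀ n, ∀ x ∈ S (n + 1), ∀ i, F i x ∈ S n)
    (n : ℕ) {x : X} (hx : x ∈ S n) : (avg w F ^ n) G x = 0 := by
  induction n generalizing x with
  | zero => simpa using h0 x hx
  | succ n ih =>
    rw [avg_pow_succ_apply]
    exact Finset.sum_eq_zero fun i _ => by rw [ih (hS n x hx i), mul_zero]

namespace IsAbsorbing

section

variable {ι : Type*} [Fintype ι] {m : LineMetric} {f : ι → ℝ → ℝ} {lam Λ R κ α : ℝ} {w : ι → ℝ}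

theorem avg_pow_indicator_dpow_le (H : IsAbsorbing m f lam Λ R κ) (hα : 0 < α)
    (hw : ∀ i, 0 ≤ w i) (n : ℕ) (q : EReal × EReal) :
    (avg w (pairMap f) ^ n) ((Prod.fst ⁻¹' outer R)ᶜ.indicator (m.dpow α)) q ≤
      (Λ ^ α) ^ n * (avg w (fun i => extend (f i)) ^ n) ((outer R)ᶜ.indicator 1) q.1 *
        m.dpow α q := by
  have hΛ : 0 ≤ Λ ^ α := Real.rpow_nonneg (zero_le_one.trans H.one_le_Λ) α
  induction n generalizing q with
  | zero =>
    by_cases h : q.1 ∈ outer R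
    · simp [h]
    · simp [h]
  | succ n ih =>
    rw [avg_pow_succ_apply, avg_pow_succ_apply, Finset.mul_sum, Finset.sum_mul]
    refine Finset.sum_le_sum fun i _ => ?_
    have h0 := avg_pow_nonneg hw (F := fun i => extend (f i)) (G := (outer R)ᶜ.indicator 1)
      (fun y => indicator_nonneg (fun _ _ => zero_le_one) y) n (extend (f i) q.1)
    have h1 := mul_le_mul_of_nonneg_left (H.dpow_pairMap_le hα i q)
      (mul_nonneg (pow_nonneg hΛ n) h0)
    refine (mul_le_mul_of_nonneg_left ((ih (pairMap f i q)).trans h1) (hw i)).trans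
      (le_of_eq ?_)
    ring

/-- As `α` tends to 0 the growth factor `(Λ ^ α) ^ N` tends to 1, so the escaping mass wins. -/
theorem exists_isMeanContracting [Nonempty ι] (H : IsAbsorbing m f lam Λ R κ)
    (hfix : HasNoCommonFixedPoint f) (hw : ∀ i, 0 < w i) (hw1 : ∑ i, w i = 1) :
    ∃ α : ℝ, 0 < α ∧ α ≤ 1 ∧ IsMeanContracting m f w R α := by
  obtain ⟨N, hN, θ, hθ0, hθ1, hθ⟩ := H.exists_escape hfix hw hw1
  have hΛ : 0 < Λ := zero_lt_one.trans_le H.one_le_Λ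
  have h1 : Tendsto (fun α : ℝ => (Λ ^ α) ^ N * θ) (𝓝[>] 0) (𝓝 ((Λ ^ (0 : ℝ)) ^ N * θ)) :=
    ((((Real.continuous_const_rpow hΛ.ne').pow N).mul continuous_const).tendsto 0).mono_left
      nhdsWithin_le_nhds
  rw [Real.rpow_zero, one_pow, one_mul] at h1
  obtain ⟨α, ⟨hα, hα1⟩, hα0⟩ := (((h1.eventually (gt_mem_nhds hθ1)).and
    (mem_nhdsWithin_of_mem_nhds (gt_mem_nhds one_pos))).and self_mem_nhdsWithin).exists
  have hΛα : 0 ≤ Λ ^ α := Real.rpow_nonneg hΛ.le α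
  refine ⟨α, hα0, le_of_lt hα1, N, hN, (Λ ^ α) ^ N * θ, by positivity, hα,
    Eventually.of_forall fun q => ?_⟩
  exact (H.avg_pow_indicator_dpow_le hα0 (fun i => (hw i).le) N q).trans
    (mul_le_mul_of_nonneg_right (mul_le_mul_of_nonneg_left (hθ q.1) (pow_nonneg hΛα N))
      (m.dpow_nonneg α q))

end

/-- Mean contraction is impossible for the exponent one: the invariant function would be Lipschitz
continuous with vanishing derivative. -/
theorem not_isMeanContracting_one {s : ℕ} {m : LineMetric} {f : Fin (s + 1) → ℝ → ℝ}
    {lam Λ R κ : ℝ} {w : Fin (s + 1) → ℝ} (H : IsAbsorbing m f lam Λ R κ)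
    (hfix : HasNoCommonFixedPoint f) (hw : ∀ i, 0 < w i) (hw1 : ∑ i, w i = 1) :
    ¬ IsMeanContracting m f w R 1 := by
  intro hmc
  have hw0 : ∀ i, 0 ≤ w i := fun i => (hw i).le
  choose K hK using fun i => HolderSpace.exists_compCLM (m := m) (α := 1) (𝕜 := ℝ)
    (H.continuous_extend i) one_pos (H.lipschitz i)
  obtain ⟨u, hu1, hu0⟩ := HolderSpace.exists_top_eq_one m ℝ one_pos le_rfl
  set A := ∑ i, w i • K i with hAdef
  have hA : ∀ h x, (A h) x = ∑ i, ((w i : ℝ) : ℝ) * h (extend (f i) x) := fun h x => by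
    rw [hAdef, _root_.sum_apply, HolderSpace.sum_apply]
    exact Finset.sum_congr rfl fun i _ => by rw [← hK]; rfl
  have habs := H.isAbsorbed hfix one_pos hw hw1 hmc hA hu1 hu0
  set T := fixedVec A (HolderSpace.evalCLM ⊤) (HolderSpace.evalCLM ⊥) u 1
  have hT : ∀ n, (A ^ n) T = T := fun n => by
    induction n with
    | zero => simp
    | succ n ih => rw [pow_succ', mul_apply_eq_comp, ih, habs.map_fixedVec]
  set v := HolderSpace.variation T with hv
  have hv0 : 0 ≤ v := HolderSpace.variation_nonneg T
  -- Invariance gives `T = A ^ n T`, so increments of `T` at close points are at most `v` times the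
  -- averaged distance, an arbitrarily small multiple of the distance. The `+ 1` below avoids
  -- division by zero.
  have hderiv : ∀ z : ℝ, HasDerivAt (fun x : ℝ => T (x : EReal)) 0 z := by
    intro z
    rw [hasDerivAt_iff_isLittleO, Asymptotics.isLittleO_iff]
    intro c hc
    obtain ⟨C, hC0, hC⟩ := m.strongly_equiv (Icc (z - 1) (z + 1)) isCompact_Icc
    obtain ⟨n, -, hn⟩ := H.exists_avg_pow_dpow_le one_pos hw0 hw1 hmc
      (show 0 < c / (v * C + 1) by positivity)
    have h1 := eventually_nhds_coe_coe.1
      (eventually_nhdsSet_iff_forall.1 hn ((z : EReal), (z : EReal)) rfl)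
    have h2 : ∀ᶠ x : ℝ in 𝓝 z, (avg w (pairMap f) ^ n) (m.dpow 1) ((x : EReal), (z : EReal)) ≤
        c / (v * C + 1) * m.dpow 1 ((x : EReal), (z : EReal)) :=
      (continuous_id.prodMk continuous_const).continuousAt.eventually h1
    filter_upwards [h2, Icc_mem_nhds (show z - 1 < z by linarith) (show z < z + 1 by linarith)]
      with x hx hxI
    have h3 := norm_pow_apply_sub_le hw0 hA n T ((x : EReal), (z : EReal))
    rw [hT] at h3
    have h4 : m.dpow 1 ((x : EReal), (z : EReal)) ≤ C * |x - z| := by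
      rw [LineMetric.dpow, Real.rpow_one]
      exact (hC x hxI z ⟨by linarith, by linarith⟩).2
    rw [smul_zero, sub_zero, Real.norm_eq_abs (x - z)]
    refine (h3.trans (mul_le_mul_of_nonneg_left hx hv0)).trans ?_
    calc v * (c / (v * C + 1) * m.dpow 1 ((x : EReal), (z : EReal)))
        ≤ v * (c / (v * C + 1) * (C * |x - z|)) := by gcongr
      _ = (v * C / (v * C + 1)) * (c * |x - z|) := by ring
      _ ≤ 1 * (c * |x - z|) := by
          refine mul_le_mul_of_nonneg_right ?_ (by positivity)
          rw [div_le_one (by positivity)]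
          linarith
      _ = c * |x - z| := one_mul _
  have hconst : ∀ x : ℝ, T (x : EReal) = T ((0 : ℝ) : EReal) := fun x =>
    is_const_of_deriv_eq_zero (fun z => (hderiv z).differentiableAt) (fun z => (hderiv z).deriv) x 0
  have hTc : Continuous fun x : EReal => T x := (HolderSpace.toCont T).continuous
  have h1 : Tendsto (fun x : ℝ => T (x : EReal)) atTop (𝓝 (T ⊤)) :=
    (hTc.tendsto ⊤).comp (EReal.tendsto_coe_nhds_top_iff.2 tendsto_id)
  have h0 : Tendsto (fun x : ℝ => T (x : EReal)) atBot (𝓝 (T ⊥)) :=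
    (hTc.tendsto ⊥).comp (EReal.tendsto_coe_nhds_bot_iff.2 tendsto_id)
  simp only [hconst] at h1 h0
  have e1 := tendsto_nhds_unique tendsto_const_nhds h1
  have e0 := tendsto_nhds_unique tendsto_const_nhds h0
  have h3 : T ⊤ = 1 := habs.fst_fixedVec
  have h4 : T ⊥ = 0 := habs.snd_fixedVec
  rw [h3] at e1
  rw [h4] at e0
  exact one_ne_zero (e1.symm.trans e0)

end IsAbsorbing

/-! ## Separated families -/

/-- The interval `[a, b]` is mapped over itself with margin `c`, and its preimages under different
maps are disjoint. -/
structure IsSeparated {ι : Type*} (f : ι → ℝ → ℝ) (a b c : ℝ) : Prop where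
  c_pos : 0 < c
  monotone : ∀ i, Monotone (f i)
  map_left : ∀ i, f i a ≤ a - c
  le_map_right : ∀ i, b + c ≤ f i b
  eq_of_mem : ∀ i j x, f i x ∈ Icc a b → f j x ∈ Icc a b → i = j

/-- The endpoints of the given interval may be fixed points, so there is no margin yet. Enlarging by
`η` creates one, since expansion pushes the new endpoints outward by `(lam - 1) * η`. The compact
preimages have disjoint thickenings, and for small `η` the enlarged preimages lie in these. -/
theorem SeparatingCondition.exists_isSeparated {ι : Type*} [Finite ι] [Nonempty ι]
    {f : ι → ℝ → ℝ} {lam : ℝ} (hlam : 1 < lam) (hmono : ∀ i, StrictMono (f i))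
    (hsurj : ∀ i, Function.Surjective (f i))
    (hexp : ∀ i x y, lam * |x - y| ≤ |f i x - f i y|) (h : SeparatingCondition f) :
    ∃ a b c : ℝ, IsSeparated f a b c := by
  obtain ⟨a, b, hab, hO, hdisj⟩ := h
  rw [closure_Ioo hab.ne] at hdisj
  have hmid : ∀ i, ∃ y, f i y = (a + b) / 2 ∧ a < y ∧ y < b := fun i => by
    obtain ⟨y, hy⟩ := hsurj i ((a + b) / 2)
    have : y ∈ Ioo a b := hO i (show f i y ∈ Ioo a b by rw [hy]; constructor <;> linarith)
    exact ⟨y, hy, this.1, this.2⟩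
  -- If `f i a > a`, monotonicity would place `f i a` between `a` and the midpoint, forcing `a` into
  -- the open interval.
  have ha : ∀ i, f i a ≤ a := fun i => by
    by_contra! h1
    obtain ⟨y, hy, hay, hyb⟩ := hmid i
    have h2 := hmono i hay
    have : a ∈ Ioo a b := hO i (show f i a ∈ Ioo a b from ⟨h1, by linarith⟩)
    exact lt_irrefl _ this.1
  have hb : ∀ i, b ≤ f i b := fun i => by
    by_contra! h1
    obtain ⟨y, hy, hay, hyb⟩ := hmid i
    have h2 := hmono i hyb
    have : b ∈ Ioo a b := hO i (show f i b ∈ Ioo a b from ⟨by linarith, h1⟩)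
    exact lt_irrefl _ this.2
  have hcompact : ∀ i, IsCompact (f i ⁻¹' Icc a b) := fun i => by
    obtain ⟨ya, hya⟩ := hsurj i a
    obtain ⟨yb, hyb⟩ := hsurj i b
    have : f i ⁻¹' Icc a b = Icc ya yb := by
      ext x
      rw [mem_preimage, mem_Icc, mem_Icc, ← hya, ← hyb, (hmono i).le_iff_le, (hmono i).le_iff_le]
    rw [this]
    exact isCompact_Icc
  have hthick : ∀ q : ι × ι, ∃ δ : ℝ, 0 < δ ∧ (q.1 ≠ q.2 →
      Disjoint (Metric.thickening δ (f q.1 ⁻¹' Icc a b))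
        (Metric.thickening δ (f q.2 ⁻¹' Icc a b))) := fun q => by
    by_cases hq : q.1 = q.2
    · exact ⟨1, one_pos, fun h => absurd hq h⟩
    · obtain ⟨δ, hδ, hd⟩ := (hdisj _ _ hq).exists_thickenings (hcompact q.1)
        (hcompact q.2).isClosed
      exact ⟨δ, hδ, fun _ => hd⟩
  choose δ hδ hδd using hthick
  obtain ⟨q₀, hq₀⟩ := Finite.exists_min δ
  set η := δ q₀ / 2 with hη
  have hη0 : 0 < η := half_pos (hδ q₀)
  have hηδ : ∀ q, η < δ q := fun q => (half_lt_self (hδ q₀)).trans_le (hq₀ q)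
  -- Clip the image to the original interval and pull it back; inverse branches do not increase
  -- distances.
  have hclip : ∀ i x, f i x ∈ Icc (a - η) (b + η) →
      ∃ y ∈ f i ⁻¹' Icc a b, |x - y| ≤ η := by
    intro i x hx
    obtain ⟨y, hy⟩ := hsurj i (max a (min b (f i x)))
    refine ⟨y, ?_, ?_⟩
    · rw [mem_preimage, hy]
      exact ⟨le_max_left _ _, max_le hab.le (min_le_left _ _)⟩
    · have h1 : |f i x - f i y| ≤ η := by
        rw [hy, abs_le]
        obtain ⟨h2, h3⟩ := hx
        rcases le_total b (f i x) with h | h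
        · rw [min_eq_left h, max_eq_right hab.le]
          constructor <;> linarith
        · rw [min_eq_right h]
          rcases le_total a (f i x) with h' | h'
          · rw [max_eq_right h']
            constructor <;> linarith
          · rw [max_eq_left h']
            constructor <;> linarith
      have h2 := hexp i x y
      have h3 := le_mul_of_one_le_left (abs_nonneg (x - y)) hlam.le
      linarith
  refine ⟨a - η, b + η, (lam - 1) * η, ?_⟩
  refine
    { c_pos := mul_pos (by linarith) hη0
      monotone := fun i => (hmono i).monotone
      map_left := fun i => ?_
      le_map_right := fun i => ?_
      eq_of_mem := fun i j x hi hj => ?_ }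
  · have h1 := hexp i a (a - η)
    have h2 := (hmono i).monotone (show a - η ≤ a by linarith)
    rw [abs_of_nonneg (sub_nonneg.2 h2), abs_of_nonneg (by linarith)] at h1
    have := ha i
    have e : lam * (a - (a - η)) = (lam - 1) * η + η := by ring
    linarith
  · have h1 := hexp i (b + η) b
    have h2 := (hmono i).monotone (show b ≤ b + η by linarith)
    rw [abs_of_nonneg (sub_nonneg.2 h2), abs_of_nonneg (by linarith)] at h1
    have := hb i
    have e : lam * (b + η - b) = (lam - 1) * η + η := by ring
    linarith
  · by_contra hij
    obtain ⟨y, hy, hxy⟩ := hclip i x hi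
    obtain ⟨y', hy', hxy'⟩ := hclip j x hj
    have hd := hδd (i, j) hij
    exact Set.disjoint_left.1 hd (Metric.mem_thickening_iff.2 ⟨y, hy, hxy.trans_lt (hηδ _)⟩)
      (Metric.mem_thickening_iff.2 ⟨y', hy', hxy'.trans_lt (hηδ _)⟩)

/-- The points which have an image under some word of length `n` in `[a, b]`. -/
def surviving {ι : Type*} (f : ι → ℝ → ℝ) (a b : ℝ) : ℕ → Set EReal
  | 0 => Icc (a : EReal) (b : EReal)
  | n + 1 => ⋃ i, extend (f i) ⁻¹' surviving f a b n

/-- The power `d(x, y)^α` on the pairs with `x ∈ [a, b]`. -/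
def LineMetric.dpowOn (m : LineMetric) (a b α : ℝ) : EReal × EReal → ℝ :=
  (Prod.fst ⁻¹' Icc (a : EReal) (b : EReal)).indicator (m.dpow α)

theorem LineMetric.dpowOn_of_mem (m : LineMetric) {a b : ℝ} (α : ℝ) {q : EReal × EReal}
    (hq : q.1 ∈ Icc (a : EReal) b) : m.dpowOn a b α q = m.dpow α q :=
  indicator_of_mem (s := Prod.fst ⁻¹' Icc (a : EReal) (b : EReal)) hq _

theorem LineMetric.dpowOn_of_notMem (m : LineMetric) {a b : ℝ} (α : ℝ) {q : EReal × EReal}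
    (hq : q.1 ∉ Icc (a : EReal) b) : m.dpowOn a b α q = 0 :=
  indicator_of_notMem (s := Prod.fst ⁻¹' Icc (a : EReal) (b : EReal)) hq _

theorem LineMetric.dpowOn_nonneg (m : LineMetric) (a b α : ℝ) (q : EReal × EReal) :
    0 ≤ m.dpowOn a b α q :=
  indicator_nonneg (fun _ _ => m.dpow_nonneg α _) q

theorem LineMetric.dpowOn_le (m : LineMetric) (a b α : ℝ) (q : EReal × EReal) :
    m.dpowOn a b α q ≤ m.dpow α q :=
  indicator_le_self' (fun _ _ => m.dpow_nonneg α _) q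

theorem orbit_succ_eq_shift {ι X : Type*} (F : ι → X → X) (ω : ℕ → ι) (n : ℕ) (x : X) :
    orbit F ω (n + 1) x = orbit F (shift ω) n (F (ω 0) x) := by
  induction n with
  | zero => rfl
  | succ n ih =>
    change F (ω (n + 1)) (orbit F ω (n + 1) x) = F (ω (n + 1)) (orbit F (shift ω) n (F (ω 0) x))
    rw [ih]

theorem iterate_shift_apply {ι : Type*} (ω : ℕ → ι) (n k : ℕ) : shift^[n] ω k = ω (n + k) := by
  induction n generalizing ω with
  | zero => simp
  | succ n ih =>
    rw [Function.iterate_succ_apply, ih, shift]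
    congr 1
    omega

namespace IsSeparated

/-! ### Itineraries of points surviving in the interval -/

section

variable {ι : Type*} {f : ι → ℝ → ℝ} {a b c : ℝ}

theorem mem_of_extend_mem (S : IsSeparated f a b c) {i : ι} {x : EReal}
    (hx : extend (f i) x ∈ Icc (a : EReal) b) : x ∈ Icc (a : EReal) b := by
  induction x with
  | bot => exact absurd hx.1 (by simp [extend_bot])
  | top => exact absurd hx.2 (by simp [extend_top])
  | coe x =>
    simp only [extend_coe, mem_Icc, EReal.coe_le_coe_iff] at hx ⊢
    have hc := S.c_pos
    constructor
    · by_contra! h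
      linarith [S.monotone i h.le, S.map_left i, hx.1]
    · by_contra! h
      linarith [S.monotone i h.le, S.le_map_right i, hx.2]

theorem eq_of_extend_mem (S : IsSeparated f a b c) {i j : ι} {x : EReal}
    (hi : extend (f i) x ∈ Icc (a : EReal) b) (hj : extend (f j) x ∈ Icc (a : EReal) b) :
    i = j := by
  induction x with
  | bot => exact absurd hi.1 (by simp [extend_bot])
  | top => exact absurd hi.2 (by simp [extend_top])
  | coe x =>
    simp only [extend_coe, mem_Icc, EReal.coe_le_coe_iff] at hi hj
    exact S.eq_of_mem i j x hi hj

theorem surviving_succ_subset (S : IsSeparated f a b c) (n : ℕ) :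
    surviving f a b (n + 1) ⊆ surviving f a b n := by
  induction n with
  | zero =>
    intro x hx
    obtain ⟨i, hi⟩ := mem_iUnion.1 hx
    exact S.mem_of_extend_mem hi
  | succ n ih =>
    intro x hx
    obtain ⟨i, hi⟩ := mem_iUnion.1 hx
    exact mem_iUnion.2 ⟨i, ih hi⟩

theorem surviving_subset (S : IsSeparated f a b c) (n : ℕ) :
    surviving f a b n ⊆ Icc (a : EReal) b := by
  induction n with
  | zero => exact Subset.rfl
  | succ n ih => exact (S.surviving_succ_subset n).trans ih

/-- Survival for `n` steps provides a first letter depending on `n`. By separation it is always the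
same letter, so its image again survives forever and the choice can be iterated. -/
theorem exists_orbit_mem (S : IsSeparated f a b c) {z : EReal}
    (hz : ∀ n, z ∈ surviving f a b n) :
    ∃ ω : ℕ → ι, ∀ n, orbit (fun i => extend (f i)) ω n z ∈ Icc (a : EReal) b := by
  have step : ∀ x : EReal, (∀ n, x ∈ surviving f a b n) →
      ∃ i, ∀ n, extend (f i) x ∈ surviving f a b n := by
    intro x hx
    have h1 : ∀ n, ∃ i, extend (f i) x ∈ surviving f a b n := fun n => by
      simpa using mem_iUnion.1 (hx (n + 1))
    choose j hj using h1
    refine ⟨j 0, fun n => ?_⟩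
    rw [S.eq_of_extend_mem (hj 0) (S.surviving_subset n (hj n))]
    exact hj n
  have : Nonempty ι := ⟨(step z hz).choose⟩
  choose! I hI using step
  let y : ℕ → EReal := fun n => (fun x => extend (f (I x)) x)^[n] z
  have hy : ∀ n, ∀ k, y n ∈ surviving f a b k := by
    intro n
    induction n with
    | zero => exact hz
    | succ n ih =>
      intro k
      simp only [y, Function.iterate_succ_apply']
      exact hI _ ih k
  refine ⟨fun n => I (y n), fun n => ?_⟩
  have horb : orbit (fun i => extend (f i)) (fun n => I (y n)) n z = y n := by
    induction n with
    | zero => rfl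
    | succ n ih =>
      change extend (f (I (y n))) (orbit _ _ n z) = _
      rw [ih]
      simp only [y, Function.iterate_succ_apply']
  rw [horb]
  exact hy n 0

end

/-! ### From local to uniform contraction for separated families -/

section

variable {ι : Type*} [Fintype ι] {m : LineMetric} {f : ι → ℝ → ℝ} {a b c lam Λ R κ α : ℝ}
  {w : ι → ℝ}

theorem isClosed_surviving (H : IsAbsorbing m f lam Λ R κ) (n : ℕ) :
    IsClosed (surviving f a b n) := by
  induction n with
  | zero => exact isClosed_Icc
  | succ n ih => exact isClosed_iUnion_of_finite fun i => ih.preimage (H.continuous_extend i)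

theorem avg_pow_dpowOn_eq_zero (n : ℕ) {q : EReal × EReal} (hq : q.1 ∉ surviving f a b n) :
    (avg w (pairMap f) ^ n) (m.dpowOn a b α) q = 0 :=
  avg_pow_eq_zero (F := pairMap f) (S := fun n => {q : EReal × EReal | q.1 ∉ surviving f a b n})
    (fun _ hx => m.dpowOn_of_notMem α hx)
    (fun _ _ hx i hi => hx (mem_iUnion.2 ⟨i, hi⟩)) n hq

theorem avg_pow_dpowOn_eq_zero_of_notMem (S : IsSeparated f a b c) (n : ℕ) {q : EReal × EReal}
    (hq : q.1 ∉ Icc (a : EReal) b) : (avg w (pairMap f) ^ n) (m.dpowOn a b α) q = 0 :=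
  avg_pow_dpowOn_eq_zero n fun h => hq (S.surviving_subset n h)

/-- After finitely many steps all points outside `[a, b]` have entered `outer R`. -/
theorem exists_avg_pow_indicator_le (S : IsSeparated f a b c) (H : IsAbsorbing m f lam Λ R κ)
    (hα : 0 < α) (hw : ∀ i, 0 ≤ w i) (hw1 : ∑ i, w i = 1) :
    ∃ n, n ≠ 0 ∧ ∀ q, (avg w (pairMap f) ^ n) ((Prod.fst ⁻¹' outer R)ᶜ.indicator (m.dpow α)) q ≤
      (Λ ^ α) ^ n * m.dpowOn a b α q := by
  have hc := S.c_pos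
  obtain ⟨n, hn⟩ := exists_nat_gt (max ((R - b) / c) ((R + a) / c))
  have hn1 : R - n * c < b := by
    have := (le_max_left _ _).trans_lt hn
    rw [div_lt_iff₀ hc] at this
    linarith
  have hn2 : a < -R + n * c := by
    have := (le_max_right _ _).trans_lt hn
    rw [div_lt_iff₀ hc] at this
    linarith
  refine ⟨n + 1, n.succ_ne_zero, fun q => ?_⟩
  by_cases hq : q.1 ∈ Icc (a : EReal) b
  · rw [m.dpowOn_of_mem α hq]
    exact (avg_pow_mono hw (fun x => indicator_le_self' (fun _ _ => m.dpow_nonneg α _) x) _ q).trans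
      (H.avg_pow_dpow_le hα hw hw1 (n + 1) q)
  · refine le_trans (le_of_eq ?_) (mul_nonneg (pow_nonneg (Real.rpow_nonneg
      (zero_le_one.trans H.one_le_Λ) α) _) (m.dpowOn_nonneg a b α q))
    rw [mem_Icc, not_and_or, not_le, not_le] at hq
    have h0 : ∀ x : EReal × EReal, x.1 ∈ outer R →
        (Prod.fst ⁻¹' outer R)ᶜ.indicator (m.dpow α) x = 0 := fun x hx =>
      indicator_of_notMem (by simpa using hx) _
    rcases hq with hq | hq
    -- A point left of `a` moves left by at least `c` per step; `S k` consists of such points that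
    -- pass `-R` within `k` steps.
    · refine avg_pow_eq_zero (S := fun k => {x : EReal × EReal |
        x.1 < (a : EReal) ∧ x.1 < ((-R + k * c : ℝ) : EReal)}) (fun x hx => h0 x (Or.inr ?_))
        (fun k x hx i => ?_) (n + 1) ⟨hq, hq.trans (EReal.coe_lt_coe_iff.2 ?_)⟩
      · simpa using hx.2
      · obtain ⟨x, y⟩ := x
        obtain ⟨hx1, hx2⟩ := hx
        change extend (f i) x < _ ∧ extend (f i) x < _
        induction x with
        | bot => exact ⟨EReal.bot_lt_coe _, EReal.bot_lt_coe _⟩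
        | top => exact absurd hx1 not_top_lt
        | coe x =>
          simp only [EReal.coe_lt_coe_iff, extend_coe] at hx1 hx2 ⊢
          have h1 := H.expand i a x
          have h2 := S.monotone i hx1.le
          rw [abs_of_nonneg (sub_nonneg.2 h2), abs_of_pos (sub_pos.2 hx1)] at h1
          have h3 := le_mul_of_one_le_left (sub_pos.2 hx1).le H.one_lt_lam.le
          have h4 := S.map_left i
          push_cast at hx2
          constructor <;> linarith
      · push_cast
        linarith
    · refine avg_pow_eq_zero (S := fun k => {x : EReal × EReal |
        (b : EReal) < x.1 ∧ ((R - k * c : ℝ) : EReal) < x.1}) (fun x hx => h0 x (Or.inl ?_))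
        (fun k x hx i => ?_) (n + 1) ⟨hq, lt_trans (EReal.coe_lt_coe_iff.2 ?_) hq⟩
      · simpa using hx.2
      · obtain ⟨x, y⟩ := x
        obtain ⟨hx1, hx2⟩ := hx
        change _ < extend (f i) x ∧ _ < extend (f i) x
        induction x with
        | top => exact ⟨EReal.coe_lt_top _, EReal.coe_lt_top _⟩
        | bot => exact absurd hx1 not_lt_bot
        | coe x =>
          simp only [EReal.coe_lt_coe_iff, extend_coe] at hx1 hx2 ⊢
          have h1 := H.expand i x b
          have h2 := S.monotone i hx1.le
          rw [abs_of_nonneg (sub_nonneg.2 h2), abs_of_pos (sub_pos.2 hx1)] at h1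
          have h3 := le_mul_of_one_le_left (sub_pos.2 hx1).le H.one_lt_lam.le
          have h4 := S.le_map_right i
          push_cast at hx2
          constructor <;> linarith
      · push_cast
        linarith

/-- Near a point whose orbit along `ω` stays in `[a, b]`, only the word `ω` contributes. -/
theorem eventually_avg_pow_dpowOn_le (S : IsSeparated f a b c) (H : IsAbsorbing m f lam Λ R κ)
    (hw : ∀ i, 0 ≤ w i) (k : ℕ) {ω : ℕ → ι} {z : EReal}
    (hz : ∀ n, orbit (fun i => extend (f i)) ω n z ∈ Icc (a : EReal) b) :
    ∀ᶠ q in 𝓝 (z, z), (avg w (pairMap f) ^ k) (m.dpowOn a b α) q ≤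
      (∏ j ∈ Finset.range k, w (ω j)) * m.dpow α (orbit (fun i => extend (f i)) ω k q.1,
        orbit (fun i => extend (f i)) ω k q.2) := by
  induction k generalizing ω z with
  | zero =>
    refine Eventually.of_forall fun q => ?_
    simpa [orbit] using m.dpowOn_le a b α q
  | succ k ih =>
    have hz' : ∀ n, orbit (fun i => extend (f i)) (shift ω) n (extend (f (ω 0)) z) ∈
        Icc (a : EReal) b := fun n => by
      have := hz (n + 1)
      rwa [orbit_succ_eq_shift] at this
    have h1 : ∀ᶠ q in 𝓝 (z, z), _ :=
      (((H.continuous_extend (ω 0)).prodMap (H.continuous_extend (ω 0))).tendsto (z, z)).eventually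
        (ih hz')
    -- By separation every other first letter sends `z`, hence nearby points, out of the closed
    -- interval, from which there is no return.
    have h2 : ∀ᶠ q : EReal × EReal in 𝓝 (z, z), ∀ i, i ≠ ω 0 →
        extend (f i) q.1 ∉ Icc (a : EReal) b := by
      refine eventually_all.2 fun i => ?_
      by_cases hi : i = ω 0
      · exact Eventually.of_forall fun q h => absurd hi h
      · have hni : extend (f i) z ∉ Icc (a : EReal) b := fun h =>
          hi (S.eq_of_extend_mem h (hz' 0))
        have := (((H.continuous_extend i).comp continuous_fst).tendsto (z, z)).eventually
          (isClosed_Icc.isOpen_compl.mem_nhds hni)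
        exact this.mono fun q hq _ => hq
    filter_upwards [h1, h2] with q hq1 hq2
    rw [avg_pow_succ_apply, Finset.sum_eq_single (ω 0) (fun i _ hi => by
      rw [S.avg_pow_dpowOn_eq_zero_of_notMem k (q := pairMap f i q) (hq2 i hi), mul_zero])
      (by simp), Finset.prod_range_succ', orbit_succ_eq_shift, orbit_succ_eq_shift]
    refine (mul_le_mul_of_nonneg_left hq1 (hw (ω 0))).trans (le_of_eq ?_)
    simp only [shift, Prod.map_fst, Prod.map_snd]
    ring

/-- If locally the mass staying in `[a, b]` is contracted after some time, then it becomes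
uniformly small. -/
theorem exists_avg_pow_dpowOn_le (S : IsSeparated f a b c) (H : IsAbsorbing m f lam Λ R κ)
    (hα : 0 < α) (hw : ∀ i, 0 ≤ w i) (hw1 : ∑ i, w i = 1)
    (hloc : ∀ z : EReal, ∃ k, k ≠ 0 ∧ ∀ᶠ q in 𝓝 (z, z),
      (avg w (pairMap f) ^ k) (m.dpowOn a b α) q ≤ 1 / 2 * m.dpow α q) {e : ℝ} (he : 0 < e) :
    ∃ n, ∀ᶠ q in 𝓝ˢ (diagonal EReal),
      (avg w (pairMap f) ^ n) (m.dpowOn a b α) q ≤ e * m.dpow α q := by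
  obtain ⟨k₀, hk₀⟩ := isClosed_diagonal.isCompact.exists_nat_eventually_nhdsSet
    (P := fun n q => ∃ k, k ≠ 0 ∧ k ≤ n ∧
      (avg w (pairMap f) ^ k) (m.dpowOn a b α) q ≤ 1 / 2 * m.dpow α q)
    (fun n n' q hn ⟨k, h0, h1, h2⟩ => ⟨k, h0, h1.trans hn, h2⟩) (by
      rintro ⟨z, z'⟩ hz
      obtain rfl : z = z' := hz
      obtain ⟨k, h0, hk⟩ := hloc z
      exact ⟨k, hk.mono fun q hq => ⟨k, h0, le_rfl, hq⟩⟩)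
  have hk₀0 : k₀ ≠ 0 := by
    rintro rfl
    obtain ⟨k, h0, h1, -⟩ := (eventually_nhdsSet_iff_forall.1 hk₀ (⊤, ⊤) rfl).self_of_nhds
    exact h0 (Nat.le_zero.1 h1)
  have hk₀pos : 0 < k₀ := Nat.pos_of_ne_zero hk₀0
  have hΛ1 : 1 ≤ Λ ^ α := Real.one_le_rpow H.one_le_Λ hα.le
  set M := (Λ ^ α) ^ k₀ with hM
  have hM0 : 0 ≤ M := pow_nonneg (zero_le_one.trans hΛ1) _
  have main : ∀ n, ∀ᶠ q in 𝓝ˢ (diagonal EReal),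
      (avg w (pairMap f) ^ n) (m.dpowOn a b α) q ≤ M * (1 / 2) ^ (n / k₀) * m.dpow α q := by
    intro n
    induction n using Nat.strong_induction_on with
    | _ n ih =>
      rcases lt_or_ge n k₀ with h | h
      · refine Eventually.of_forall fun q => ?_
        rw [Nat.div_eq_of_lt h, pow_zero, mul_one]
        refine (avg_pow_mono hw (m.dpowOn_le a b α) n q).trans
          ((H.avg_pow_dpow_le hα hw hw1 n q).trans ?_)
        exact mul_le_mul_of_nonneg_right (pow_le_pow_right₀ hΛ1 h.le) (m.dpow_nonneg α q)
      -- The contraction time varies with the pair, so the inequality is prepared for all times from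
      -- 1 to `k₀` at once; the index is shifted by one.
      · have h1 : ∀ k : Fin k₀, ∀ᶠ q in 𝓝ˢ (diagonal EReal),
            (avg w (pairMap f) ^ n) (m.dpowOn a b α) q ≤
              M * (1 / 2) ^ ((n - (k + 1)) / k₀) *
                (avg w (pairMap f) ^ (k + 1 : ℕ)) (m.dpowOn a b α) q := by
          intro k
          have hle : (avg w (pairMap f) ^ (n - (k + 1))) (m.dpowOn a b α) ≤ᶠ[𝓝ˢ (diagonal EReal)]
              (M * (1 / 2) ^ ((n - (k + 1)) / k₀)) • m.dpowOn a b α := by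
            filter_upwards [ih (n - (k + 1)) (by omega)] with q hq
            rw [Pi.smul_apply, smul_eq_mul]
            -- Off the interval the left side vanishes, so `dpow` can be replaced by `dpowOn`; only
            -- then can the bound be averaged again.
            by_cases hqm : q.1 ∈ Icc (a : EReal) b
            · rwa [m.dpowOn_of_mem α hqm]
            · rw [S.avg_pow_dpowOn_eq_zero_of_notMem _ hqm]
              exact mul_nonneg (by positivity) (m.dpowOn_nonneg a b α q)
          filter_upwards [avg_pow_le_of_eventuallyLE hw H.tendsto_pairMap hle (k + 1)] with q hq
          rwa [← avg_pow_add_apply, show (k : ℕ) + 1 + (n - (k + 1)) = n by omega, map_smul] at hq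
        filter_upwards [hk₀, eventually_all.2 h1] with q hq hq1
        obtain ⟨k, hk0, hkk, hk⟩ := hq
        have h2 := hq1 ⟨k - 1, by omega⟩
        simp only [Nat.sub_add_cancel (Nat.one_le_iff_ne_zero.2 hk0)] at h2
        refine h2.trans ((mul_le_mul_of_nonneg_left hk (by positivity)).trans ?_)
        have h3 : n / k₀ ≤ (n - k) / k₀ + 1 := by
          rw [← Nat.add_div_right _ hk₀pos]
          exact Nat.div_le_div_right (by omega)
        have h4 : ((1 : ℝ) / 2) ^ ((n - k) / k₀ + 1) ≤ (1 / 2) ^ (n / k₀) :=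
          pow_le_pow_of_le_one (by norm_num) (by norm_num) h3
        calc M * (1 / 2) ^ ((n - k) / k₀) * (1 / 2 * m.dpow α q)
            = M * (1 / 2) ^ ((n - k) / k₀ + 1) * m.dpow α q := by ring
          _ ≤ _ := mul_le_mul_of_nonneg_right (mul_le_mul_of_nonneg_left h4 hM0)
              (m.dpow_nonneg α q)
  have hlim : Tendsto (fun l => M * (1 / 2 : ℝ) ^ l) atTop (𝓝 (M * 0)) :=
    (tendsto_pow_atTop_nhds_zero_of_lt_one (by norm_num) (by norm_num)).const_mul M
  rw [mul_zero] at hlim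
  obtain ⟨l, hl⟩ := (hlim.eventually (gt_mem_nhds he)).exists
  refine ⟨k₀ * l, ?_⟩
  filter_upwards [main (k₀ * l)] with q hq
  rw [Nat.mul_div_cancel_left l hk₀pos] at hq
  exact hq.trans (mul_le_mul_of_nonneg_right hl.le (m.dpow_nonneg α q))

/-- A path still outside `outer R` at time `n + n₀` must be in the interval at time `n`. The
surviving mass is made small enough to beat the growth during the last `n₀` steps. -/
theorem isMeanContracting (S : IsSeparated f a b c) (H : IsAbsorbing m f lam Λ R κ)
    (hα : 0 < α) (hw : ∀ i, 0 ≤ w i) (hw1 : ∑ i, w i = 1)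
    (hloc : ∀ z : EReal, ∃ k, k ≠ 0 ∧ ∀ᶠ q in 𝓝 (z, z),
      (avg w (pairMap f) ^ k) (m.dpowOn a b α) q ≤ 1 / 2 * m.dpow α q) :
    IsMeanContracting m f w R α := by
  obtain ⟨n₀, hn₀, hle⟩ := S.exists_avg_pow_indicator_le H hα hw hw1
  have hΛ : 0 < (Λ ^ α) ^ n₀ :=
    pow_pos (Real.rpow_pos_of_pos (zero_lt_one.trans_le H.one_le_Λ) α) _
  obtain ⟨n, hn⟩ := S.exists_avg_pow_dpowOn_le H hα hw hw1 hloc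
    (show 0 < 1 / (2 * (Λ ^ α) ^ n₀) by positivity)
  refine ⟨n + n₀, by omega, 1 / 2, by norm_num, by norm_num, ?_⟩
  filter_upwards [hn] with q hq
  rw [avg_pow_add_apply]
  refine (avg_pow_mono hw (H := (Λ ^ α) ^ n₀ • m.dpowOn a b α) hle n q).trans ?_
  rw [map_smul, Pi.smul_apply, smul_eq_mul]
  refine (mul_le_mul_of_nonneg_left hq hΛ.le).trans (le_of_eq ?_)
  field_simp

end

end IsSeparated

/-! ## Exponents below the bottom of the spectrum -/

theorem hasStrictDerivAt_orbit {ι : Type*} {f : ι → ℝ → ℝ} (hf : ∀ i, ContDiff ℝ 1 (f i))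
    (ω : ℕ → ι) (n : ℕ) (x : ℝ) :
    HasStrictDerivAt (orbit f ω n) (∏ j ∈ Finset.range n, deriv (f (ω j)) (orbit f ω j x)) x := by
  induction n with
  | zero => simpa [orbit] using hasStrictDerivAt_id x
  | succ n ih =>
    rw [Finset.prod_range_succ, mul_comm]
    exact HasStrictDerivAt.comp x
      ((hf (ω n)).contDiffAt.hasStrictDerivAt (by norm_num)) ih

/-- The tail of a bounded orbit is a bounded orbit of the shifted word; uniqueness identifies its
starting point. -/
theorem codingMap_iterate_shift {ι : Type*} [Finite ι] {f : ι → ℝ → ℝ} (hexp : IsExpanding f)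
    (hd : ∀ i, Differentiable ℝ (f i)) (hs : ∀ i, Function.Surjective (f i)) {ω : ℕ → ι} {x : ℝ}
    (hx : Bornology.IsBounded (range fun n => orbit f ω n x)) (j : ℕ) :
    codingMap f (shift^[j] ω) = orbit f ω j x := by
  refine (existsUnique_bounded_orbit hexp hd hs (shift^[j] ω)).unique
    (codingMap_spec hexp hd hs _) (hx.subset ?_)
  rintro _ ⟨n, rfl⟩
  refine ⟨j + n, ?_⟩
  simp only [orbit_add]
  rw [show shift^[j] ω = fun k => ω (j + k) from funext fun k => iterate_shift_apply ω j k]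

theorem birkhoffSum_weightPotential {s : ℕ} {p : EuclideanSpace ℝ (Fin s)} (hp : p ∈ params s)
    (ω : ℕ → Fin (s + 1)) (n : ℕ) :
    birkhoffSum shift (weightPotential p) n ω =
      Real.log (∏ j ∈ Finset.range n, weight p (ω j)) := by
  rw [Real.log_prod fun j _ => (weight_pos hp (ω j)).ne', birkhoffSum]
  simp [weightPotential, iterate_shift_apply]

theorem birkhoffSum_geomPotential {ι : Type*} [Finite ι] {f : ι → ℝ → ℝ} (hexp : IsExpanding f)
    (hd : ∀ i, Differentiable ℝ (f i)) (hs : ∀ i, Function.Surjective (f i)) {ω : ℕ → ι} {x : ℝ}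
    (hx : Bornology.IsBounded (range fun n => orbit f ω n x)) (n : ℕ) :
    birkhoffSum shift (geomPotential f) n ω =
      -Real.log (∏ j ∈ Finset.range n, deriv (f (ω j)) (orbit f ω j x)) := by
  obtain ⟨lam, hlam, hl⟩ := hexp
  rw [Real.log_prod fun j _ => (zero_lt_one.trans (hlam.trans_le (hl (ω j) _))).ne', birkhoffSum,
    ← Finset.sum_neg_distrib]
  refine Finset.sum_congr rfl fun j _ => ?_
  rw [geomPotential, codingMap_iterate_shift ⟨lam, hlam, hl⟩ hd hs hx, iterate_shift_apply,
    add_zero, Real.log_abs]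

/-- Along every word the products `∏ p_{ω_j} · ((f_{ω_n} ∘ ⋯ ∘ f_{ω_1})')^α` tend to zero if
`α < α_-(p)`. -/
theorem exists_prod_weight_mul_le {s : ℕ} {f : Fin (s + 1) → ℝ → ℝ}
    {p : EuclideanSpace ℝ (Fin s)} (hp : p ∈ params s) (hexp : IsExpanding f)
    (hd : ∀ i, Differentiable ℝ (f i)) (hs : ∀ i, Function.Surjective (f i)) {α : ℝ}
    (hαm : (α : EReal) < alphaMinus f p) {ω : ℕ → Fin (s + 1)} {x : ℝ}
    (hx : Bornology.IsBounded (range fun n => orbit f ω n x)) {C e : ℝ} (hC : 0 < C) (he : 0 < e) :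
    ∃ n, n ≠ 0 ∧ (∏ j ∈ Finset.range n, weight p (ω j)) *
      (C * ∏ j ∈ Finset.range n, deriv (f (ω j)) (orbit f ω j x)) ^ α ≤ e := by
  obtain ⟨β, hαβ, hβ⟩ := EReal.lt_iff_exists_real_btwn.1 hαm
  rw [EReal.coe_lt_coe_iff] at hαβ
  have hev := eventually_lt_of_lt_liminf (hβ.trans_le (iInf_le _ ω))
  have hexp' := hexp
  obtain ⟨lam, hlam, hl⟩ := hexp'
  have hlog : 0 < Real.log lam := Real.log_pos hlam
  have hlim : Tendsto (fun n : ℕ => (n : ℝ) * ((β - α) * Real.log lam)) atTop atTop :=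
    tendsto_natCast_atTop_atTop.atTop_mul_const (mul_pos (sub_pos.2 hαβ) hlog)
  -- With `β` strictly between `α` and `alphaMinus`, the logarithm of the weights lies below `-β *
  -- log D`. The surplus `(β - α) * log D` grows at least linearly in `n` by expansion and absorbs
  -- `C` and `e`.
  obtain ⟨n, ⟨hn1, hn2⟩, hn0⟩ := ((hev.and (hlim.eventually_ge_atTop
    (α * Real.log C - Real.log e))).and (eventually_ne_atTop 0)).exists
  refine ⟨n, hn0, ?_⟩
  rw [EReal.coe_lt_coe_iff, birkhoffSum_weightPotential hp,
    birkhoffSum_geomPotential hexp hd hs hx] at hn1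
  set P := ∏ j ∈ Finset.range n, weight p (ω j)
  set D := ∏ j ∈ Finset.range n, deriv (f (ω j)) (orbit f ω j x)
  have hP : 0 < P := Finset.prod_pos fun j _ => weight_pos hp _
  have hDlam : lam ^ n ≤ D := by
    have := Finset.prod_le_prod (s := Finset.range n) (f := fun _ => lam)
      (g := fun j => deriv (f (ω j)) (orbit f ω j x)) (fun _ _ => by linarith)
      (fun j _ => hl (ω j) _)
    simpa using this
  have hDpos : 0 < D := (pow_pos (by linarith) n).trans_le hDlam
  have hlogD : n * Real.log lam ≤ Real.log D := by
    rw [← Real.log_pow]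
    exact Real.log_le_log (pow_pos (by linarith) n) hDlam
  have hnpos : (0 : ℝ) < n := by exact_mod_cast Nat.pos_of_ne_zero hn0
  have hDlog : 0 < Real.log D := (mul_pos hnpos hlog).trans_le hlogD
  rw [lt_div_iff_of_neg (neg_lt_zero.2 hDlog)] at hn1
  rw [← Real.log_le_log_iff (mul_pos hP (Real.rpow_pos_of_pos (mul_pos hC hDpos) α)) he,
    Real.log_mul hP.ne' (Real.rpow_pos_of_pos (mul_pos hC hDpos) α).ne',
    Real.log_rpow (mul_pos hC hDpos), Real.log_mul hC.ne' hDpos.ne']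
  have h1 := mul_le_mul_of_nonneg_left hlogD (sub_pos.2 hαβ).le
  have h2 : (β - α) * (n * Real.log lam) = n * ((β - α) * Real.log lam) := by ring
  have h3 : (β - α) * Real.log D = β * Real.log D - α * Real.log D := by ring
  have h4 : α * (Real.log C + Real.log D) = α * Real.log C + α * Real.log D := by ring
  have h5 : β * -Real.log D = -(β * Real.log D) := by ring
  linarith

/-- Either `z` survives forever, and near it only its itinerary contributes, with a product small at
some time; or `z` leaves, and then nothing near it survives. -/
theorem IsSeparated.exists_eventually_avg_pow_le {s : ℕ} {m : LineMetric}
    {f : Fin (s + 1) → ℝ → ℝ} {a b c lam Λ R κ α : ℝ} {p : EuclideanSpace ℝ (Fin s)}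
    (S : IsSeparated f a b c) (H : IsAbsorbing m f lam Λ R κ) (hp : p ∈ params s)
    (hexp : IsExpanding f) (hf : ∀ i, ContDiff ℝ 1 (f i)) (hs : ∀ i, Function.Surjective (f i))
    (hα : 0 < α) (hαm : (α : EReal) < alphaMinus f p) (z : EReal) :
    ∃ k, k ≠ 0 ∧ ∀ᶠ q in 𝓝 (z, z),
      (avg (weight p) (pairMap f) ^ k) (m.dpowOn a b α) q ≤ 1 / 2 * m.dpow α q := by
  have hw : ∀ i, 0 ≤ weight p i := fun i => (weight_pos hp i).le
  by_cases hz : ∀ n, z ∈ surviving f a b n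
  · obtain ⟨ω, hω⟩ := S.exists_orbit_mem hz
    have hz0 : z ∈ Icc (a : EReal) b := hz 0
    lift z to ℝ using ⟨fun h => by simp [h] at hz0, fun h => by simp [h] at hz0⟩
    have horb : ∀ n, orbit f ω n z ∈ Icc a b := fun n => by
      have := hω n
      rw [orbit_extend_coe, mem_Icc, EReal.coe_le_coe_iff, EReal.coe_le_coe_iff] at this
      exact this
    have hbdd : Bornology.IsBounded (range fun n => orbit f ω n z) :=
      (Metric.isBounded_Icc a b).subset (range_subset_iff.2 horb)
    obtain ⟨C, hC0, hC⟩ := m.exists_coe_comparison a b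
    -- The 2 allows for the Lipschitz constant near `z`, which may exceed the derivative `D` at `z`
    -- but stays below `2 * D`.
    obtain ⟨k, hk0, hk⟩ := exists_prod_weight_mul_le hp hexp
      (fun i => (hf i).differentiable (by norm_num)) hs hαm hbdd (C := C * 2) (e := 1 / 2)
      (by positivity) (by norm_num)
    refine ⟨k, hk0, ?_⟩
    set D := ∏ j ∈ Finset.range k, deriv (f (ω j)) (orbit f ω j z) with hD
    obtain ⟨l, hl1, hl⟩ := hexp
    have hDpos : 0 < D := Finset.prod_pos fun j _ => by linarith [hl (ω j) (orbit f ω j z)]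
    have h1 := eventually_nhds_coe_coe.1 (S.eventually_avg_pow_dpowOn_le (α := α) H hw k hω)
    have h2 := hC (orbit f ω k) z D (2 * D) (horb 0) (horb k) (hasStrictDerivAt_orbit hf ω k z)
      (by rw [abs_of_pos hDpos]; linarith)
    rw [eventually_nhds_coe_coe]
    filter_upwards [h1, h2] with q hq1 hq2
    refine hq1.trans ?_
    simp only [orbit_extend_coe]
    have h3 : m.dpow α (((orbit f ω k q.1 : ℝ) : EReal), ((orbit f ω k q.2 : ℝ) : EReal)) ≤
        (C * 2 * D) ^ α * m.dpow α ((q.1 : EReal), (q.2 : EReal)) := by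
      unfold LineMetric.dpow
      rw [← Real.mul_rpow (by positivity) (m.d_nonneg _ _), mul_assoc C]
      exact Real.rpow_le_rpow (m.d_nonneg _ _) hq2 hα.le
    calc _ ≤ (∏ j ∈ Finset.range k, weight p (ω j)) *
          ((C * 2 * D) ^ α * m.dpow α ((q.1 : EReal), (q.2 : EReal))) :=
          mul_le_mul_of_nonneg_left h3 (Finset.prod_nonneg fun j _ => hw _)
      _ ≤ _ := by
          rw [← mul_assoc]
          exact mul_le_mul_of_nonneg_right hk (m.dpow_nonneg _ _)
  · push Not at hz
    obtain ⟨n, hn⟩ := hz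
    -- One more step merely keeps the time nonzero; the surviving sets decrease.
    refine ⟨n + 1, n.succ_ne_zero, ?_⟩
    have h1 : ∀ᶠ q : EReal × EReal in 𝓝 (z, z), q.1 ∉ surviving f a b (n + 1) :=
      (continuous_fst.tendsto (z, z)).eventually
        ((isClosed_surviving H (n + 1)).isOpen_compl.mem_nhds
          fun h => hn (S.surviving_succ_subset n h))
    filter_upwards [h1] with q hq
    rw [avg_pow_dpowOn_eq_zero (n + 1) hq]
    exact mul_nonneg (by norm_num) (m.dpow_nonneg α q)

end RandomLine

end

/-! ### Both parts of the theorem from mean contraction -/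

theorem theorem1p1 (s : ℕ) (hs : 1 ≤ s) (m : RandomLine.LineMetric)
    (f : Fin (s + 1) → ℝ → ℝ) (ε : ℝ) (hε : 0 < ε)
    (hdiff : ∀ i, RandomLine.IsHolderDiffeo ε (f i))
    (hexp : RandomLine.IsExpanding f)
    (hfix : RandomLine.HasNoCommonFixedPoint f)
    (hcontr : RandomLine.IsContractingNearInfinity m f) :
    (∀ p₀ ∈ RandomLine.params s, ∃ δ : ℝ, 0 < δ ∧ ∃ α : ℝ, 0 < α ∧
      RandomLine.SpectralGapOnBall m f p₀ δ α) ∧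
    (RandomLine.SeparatingCondition f → ∀ p₀ ∈ RandomLine.params s, ∀ α : ℝ, 0 < α →
      (α : EReal) < RandomLine.alphaMinus f p₀ →
      ∃ δ : ℝ, 0 < δ ∧ RandomLine.SpectralGapOnBall m f p₀ δ α) := by
  obtain ⟨lam, Λ, R, κ, H⟩ := RandomLine.exists_isAbsorbing hdiff hexp hcontr
  refine ⟨fun p₀ hp₀ => ?_, fun hsep p₀ hp₀ => ?_⟩
  · obtain ⟨α, hα, hα1, hmc⟩ :=
      H.exists_isMeanContracting hfix (RandomLine.weight_pos hp₀) (RandomLine.sum_weight p₀)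
    obtain ⟨δ, hδ, hball, hmcδ⟩ := hmc.exists_ball hp₀
    exact ⟨δ, hδ, α, hα, H.spectralGapOnBall hfix hα hα1 hball hmcδ⟩
  · have hf : ∀ i, ContDiff ℝ 1 (f i) := fun i => (hdiff i).contDiff
    have hsurj : ∀ i, Function.Surjective (f i) := fun i => by
      obtain ⟨k, -, hk, -⟩ := (hdiff i).inverse
      exact hk.surjective
    have hmono : ∀ i, StrictMono (f i) := fun i => strictMono_of_deriv_pos fun x => by
      obtain ⟨l, hl1, hl⟩ := hexp
      linarith [hl i x]
    obtain ⟨a, b, c, S⟩ := hsep.exists_isSeparated H.one_lt_lam hmono hsurj H.expand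
    have hmc : ∀ α : ℝ, 0 < α → (α : EReal) < RandomLine.alphaMinus f p₀ →
        RandomLine.IsMeanContracting m f (RandomLine.weight p₀) R α := fun α hα hαm =>
      S.isMeanContracting H hα (fun i => (RandomLine.weight_pos hp₀ i).le)
        (RandomLine.sum_weight p₀) (S.exists_eventually_avg_pow_le H hp₀ hexp hf hsurj hα hαm)
    intro α hα hαm
    -- If `α > 1`, then 1 is below `alphaMinus` as well, which would give the impossible mean
    -- contraction with exponent one.
    have hα1 : α ≤ 1 := by
      by_contra! h
      exact H.not_isMeanContracting_one hfix (RandomLine.weight_pos hp₀)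
        (RandomLine.sum_weight p₀)
        (hmc 1 one_pos ((EReal.coe_lt_coe_iff.2 h).trans hαm))
    obtain ⟨δ, hδ, hball, hmcδ⟩ := (hmc α hα hαm).exists_ball hp₀
    exact ⟨δ, hδ, H.spectralGapOnBall hfix hα hα1 hball hmcδ⟩
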